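/- **Setting.** Let $p\equiv 1\pmod 4$ be a prime, $m\ge 2$, $q=p^m$, $\zeta_p=e^{2\pi i/p}$, $\mathrm{Tr}:\mathbb F_q\to\mathbb F_p$ the trace, $\eta$ the quadratic character of $\mathbb F_p$ ($\eta(0)=0$), $S_q$ the set of nonzero squares and $N_{sq}$ the set of non-squares of $\mathbb F_p$, and $I_4(a)=\sum_{x\in\mathbb F_p}\eta(x^4+a)$. For $f:\mathbb F_q\to\mathbb F_p$ put $\widehat\chi_f(\beta)=\sum_{x\in\mathbb F_q}\zeta_p^{f(x)-\mathrm{Tr}(\beta x)}$. For $0\le s\le m$, $f$ is *$s$-plateaued* if $|\widehat\chi_f(\beta)|^2\in\{0,p^{m+s}\}$ for all $\beta$; its Walsh support is $\mathcal S_f=\{\beta:|\widehat\chi_f(\beta)|^2=p^{m+s}\}$. It is *weakly regular* if moreover there are $u\in\mathbb C$ with $|u|=1$ and $r:\mathbb F_q\to\mathbb F_p$ vanishing outside $\mathcal S_f$ such that $\widehat\chi_f(\beta)\in\{0,u\,p^{(m+s)/2}\zeta_p^{r(\beta)}\}$ for all $\beta$. The class WRP (resp. WRPB) consists of the weakly regular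 plateaued $f$ with $\widehat\chi_f(0)\ne 0$ (resp. $\widehat\chi_f(0)=0$), $f(0)=0$, and $f(zx)=z^hf(x)$ for all $z\in\mathbb F_p^*$, $x\in\mathbb F_q$, for some even $h>0$ with $\gcd(h-1,p-1)=1$. A sign $\varepsilon_f\in\{\pm1\}$ and a dual function $f^\star:\mathbb F_q\to\mathbb F_p$ of $f$ are given by $\widehat\chi_f(\beta)=\varepsilon_f\sqrt p^{\,m+s}\zeta_p^{f^\star(\beta)}$ for $\beta\in\mathcal S_f$ and $f^\star(\beta)=0$ for $\beta\notin\mathcal S_f$. An even $l>0$ with $\gcd(l-1,p-1)=1$ is called an *index* of $f$, written $l_f=l$, if $f^\star(z\beta)=z^{l}f^\star(\beta)$ for all $z\in\mathbb F_p^*$, $\beta\in\mathcal S_f$. Let $\mathcal N_f(c)=\#\{\beta\in\mathcal S_f:f^\star(\beta)=c\}$. For $f,g:\mathbb F_q\to\mathbb F_p$ let $D_{f,g}=\{(x,y)\in\mathbb F_q^2\setminus\{(0,0)\}:f(x)+g(y)=0\}$ and $C_{D_{f,g}}=\{(\mathrm{Tr}(ax+by))_{(x,y)\in D_{f,g}}:a,b\in\mathbb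 F_q\}$. A linear code is *$k$-weight* if its nonzero codewords have exactly $k$ different Hamming weights. In a table, the frequencies of rows with equal weight are added. **Theorem.** Let $f,g\in$ WRP or $f,g\in$ WRPB be $s$- and $t$-plateaued, respectively, with $s+t$ odd and $s+t\le 2m-2$. Then $f$ and $g$ have signs and dual functions $\varepsilon_f,f^\star$ and $\varepsilon_g,g^\star$. Assume that $l_g=\frac{p-1}2$. Write $\tau=2m+s+t$, $\gamma=2m-s-t$, $\varepsilon=\varepsilon_f\varepsilon_g$, $W=(p-1)p^{2m-2}$ and $\rho=\sqrt p^{\,\tau-3}$. 1. If $l_f=\frac{p-1}2$, then $C_{D_{f,g}}$ is a three-weight $[p^{2m-1}-1,2m]$ code with weight distribution | weight | frequency | |---|---| | $0$ | $1$ | | $W$ | $p^{2m}-(p-1)p^{\gamma-1}-1$ | | $W-(p-1)\rho$ | $\frac{p-1}2(p^{\gamma-1}+\sqrt p^{\,\gamma-1})$ | | $W+(p-1)\rho$ | $\frac{p-1}2(p^{\gamma-1}-\sqrt p^{\,\gamma-1})$ | 2. If $l_f=p-1$, then $C_{D_{f,g}}$ is a $[p^{2m-1}-1,2m]$ code, which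 is five-weight if $s,t\le m-2$, with weight distribution | weight | frequency | |---|---| | $0$ | $1$ | | $W$ | $p^{2m}-1-E_1-E_2-B_{S_q}-B_{N_{sq}}$ | | $W-\frac{p-1}2\varepsilon\,\eta(2)\rho$ | $E_1$ | | $W+\frac{p-1}2\varepsilon\,\eta(2)\rho$ | $E_2$ | | $W-(p-1)\varepsilon\rho$ | $B_{S_q}$ | | $W+(p-1)\varepsilon\rho$ | $B_{N_{sq}}$ | 3. If $l_f=2$ and $p\equiv1\pmod 8$, then $C_{D_{f,g}}$ is a $[p^{2m-1}-1,2m]$ code, which is five-weight if $s,t\le m-2$, with, for all $i\in S_q$ and $j\in N_{sq}$, weight distribution | weight | frequency | |---|---| | $0$ | $1$ | | $W$ | $p^{2m}-1-E_3-E_4-\frac{(p-1)^2}4\big(\mathcal N_f(i)\mathcal N_g(i)+\mathcal N_f(j)\mathcal N_g(j)\big)$ | | $W-(p-1)\varepsilon\rho$ | $E_3$ | | $W+(p-1)\varepsilon\rho$ | $E_4$ | | $W+2\varepsilon\rho$ | $\frac{(p-1)^2}4\mathcal N_f(i)\mathcal N_g(i)$ | | $W-2\varepsilon\rho$ | $\frac{(p-1)^2}4\mathcal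 N_f(j)\mathcal N_g(j)$ | 4. If $l_f=2$ and $p\equiv5\pmod 8$, then $C_{D_{f,g}}$ is a $[p^{2m-1}-1,2m]$ code with weight distribution | weight | frequency | |---|---| | $0$ | $1$ | | $W$ | $p^{2m}-1-E_3-E_4-\sum_{u,v\in\mathbb F_p^*}\mathcal N_f(u)\mathcal N_g(v)$ | | $W-(p-1)\varepsilon\rho$ | $E_3$ | | $W+(p-1)\varepsilon\rho$ | $E_4$ | | $W-\varepsilon\rho\,\eta(u)\big(I_4(\tfrac vu)-\eta(\tfrac vu)\big)$, one row for each $u,v\in\mathbb F_p^*$ | $\mathcal N_f(u)\mathcal N_g(v)$ | Here $E_1,E_3,B_{S_q}$ (with $R=S_q$) and $E_2,E_4,B_{N_{sq}}$ (with $R=N_{sq}$) are the numbers of $(a,b)\in\mathcal S_f\times\mathcal S_g$ such that, respectively, - $E_1,E_2$: $f^\star(a)\in R$ and $g^\star(b)=\pm f^\star(a)$; - $E_3,E_4$: $f^\star(a)=0,\ g^\star(b)\in R$, or $g^\star(b)=0,\ f^\star(a)\in R$; - $B_{S_q},B_{N_{sq}}$: $f^\star(a)+g^\star(b)\in R$ and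 $f^\star(a)-g^\star(b)\in R$. Their values are as follows, for all $i\in S_q$ and $j\in N_{sq}$: $E_1=(p-1)\mathcal N_f(i)\mathcal N_g(i)$, $E_2=(p-1)\mathcal N_f(j)\mathcal N_g(j)$, $E_3=\frac{p-1}2\big(\mathcal N_f(0)\mathcal N_g(i)+\mathcal N_f(i)\mathcal N_g(0)\big)$, $E_4=\frac{p-1}2\big(\mathcal N_f(0)\mathcal N_g(j)+\mathcal N_f(j)\mathcal N_g(0)\big)$. If $m-s$ is even, then $\mathcal N_f(0)=p^{m-s-1}+(p-1)\varepsilon_f\sqrt p^{\,m-s-2}$ and $\mathcal N_f(c)=p^{m-s-1}-\varepsilon_f\sqrt p^{\,m-s-2}$ for $c\ne0$; if $m-s$ is odd, then $\mathcal N_f(c)=p^{m-s-1}+\eta(c)\varepsilon_f\sqrt p^{\,m-s-1}$ for all $c$; likewise for $g$ with $t$. If $m-s$ is odd, then, with the upper signs for $B_{S_q}$ and the lower signs for $B_{N_{sq}}$, $$\tfrac{p-1}2\sqrt p^{\,\gamma-3}\Big(\tfrac{p-1}2\sqrt p^{\,\gamma-1}\mp\eta(2)\varepsilon_f\sqrt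 p^{\,m-t}+\tfrac{p+1}2\varepsilon_g\sqrt p^{\,m-s-1}\pm(\eta(2)+p)\varepsilon_f\varepsilon_g\Big)$$ is the value of $B_{S_q}$, $B_{N_{sq}}$; if $m-s$ is even, the same holds with $(f,s)$ and $(g,t)$ exchanged. -/

import Mathlib

open scoped BigOperators

noncomputable section

namespace PlateauedCode

/-! ### Characters and companion sums over the prime field -/

/-- The non-zero squares of `𝔽_p`. -/
def squares (p : ℕ) : Set (ZMod p) := {c | c ≠ 0 ∧ IsSquare c}

/-- The non-squares of `𝔽_p` (zero is a square). -/
def nonSquares (p : ℕ) : Set (ZMod p) := {c | ¬ IsSquare c}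

/-- The quadratic character `η` of `𝔽_p`, with `η 0 = 0`. -/
def eta (p : ℕ) [Fact p.Prime] (c : ZMod p) : ℤ := quadraticChar (ZMod p) c

/-- The companion sum `I_n(a) = ∑_x η(x^n + a)` over `𝔽_p`. -/
def companionSum (p : ℕ) [Fact p.Prime] (n : ℕ) (a : ZMod p) : ℤ :=
  ∑ x : ZMod p, eta p (x ^ n + a)

/-! ### Weakly regular plateaued functions -/

section Walsh

variable {K : Type*} [Field K] [Fintype K] (p m : ℕ) [Fact p.Prime] [Algebra (ZMod p) K]

/-- The Walsh transform `β ↦ ∑_x ζ_p ^ (f x - Tr (β x))`; here `ZMod.stdAddChar c` is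
`exp (2 π i c / p)`. -/
def walsh (f : K → ZMod p) (β : K) : ℂ :=
  ∑ x : K, ZMod.stdAddChar (f x - Algebra.trace (ZMod p) K (β * x))

/-- The Walsh support of an `s`-plateaued function on the field with `p ^ m` elements. -/
def walshSupport (s : ℕ) (f : K → ZMod p) : Set K :=
  {β | ‖walsh p f β‖ ^ 2 = (p : ℝ) ^ (m + s)}

/-- `s`-plateaued functions on the field with `p ^ m` elements, `0 ≤ s ≤ m`. -/
def IsPlateaued (s : ℕ) (f : K → ZMod p) : Prop :=
  s ≤ m ∧ ∀ β, ‖walsh p f β‖ ^ 2 = 0 ∨ ‖walsh p f β‖ ^ 2 = (p : ℝ) ^ (m + s)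

/-- Weakly regular `s`-plateaued functions: every Walsh value is `0` or `u p^((m+s)/2) ζ_p^(r β)`
with one complex number `u` of modulus one and a function `r` that vanishes off the support. -/
def IsWeaklyRegularPlateaued (s : ℕ) (f : K → ZMod p) : Prop :=
  IsPlateaued p m s f ∧
    ∃ (u : ℂ) (r : K → ZMod p), ‖u‖ = 1 ∧ (∀ β, β ∉ walshSupport p m s f → r β = 0) ∧
      ∀ β, walsh p f β = 0 ∨
        walsh p f β = u * ((Real.sqrt p : ℝ) : ℂ) ^ (m + s) * ZMod.stdAddChar (r β)

/-- `f 0 = 0` and `f (z x) = z ^ h f x` for all `z ∈ 𝔽_p^*`, for some even positive `h` with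
`gcd (h - 1, p - 1) = 1`. -/
def IsHomogeneous (f : K → ZMod p) : Prop :=
  f 0 = 0 ∧ ∃ h : ℕ, 0 < h ∧ 2 ∣ h ∧ Nat.gcd (h - 1) (p - 1) = 1 ∧
    ∀ (z : ZMod p) (x : K), z ≠ 0 → f (z • x) = z ^ h * f x

/-- The class WRP: unbalanced, weakly regular `s`-plateaued, homogeneous. -/
def IsWRP (s : ℕ) (f : K → ZMod p) : Prop :=
  IsWeaklyRegularPlateaued p m s f ∧ walsh p f 0 ≠ 0 ∧ IsHomogeneous p f

/-- The class WRPB: balanced, weakly regular `s`-plateaued, homogeneous. -/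
def IsWRPB (s : ℕ) (f : K → ZMod p) : Prop :=
  IsWeaklyRegularPlateaued p m s f ∧ walsh p f 0 = 0 ∧ IsHomogeneous p f

/-- `ε = ±1` is the sign of the Walsh transform of `f` and `fd` is the dual function of `f`
(for `p ≡ 1 mod 4`, so that `p^* = p`). These two conditions determine `ε` and `fd`. -/
def IsSignDual (s : ℕ) (f : K → ZMod p) (ε : ℤ) (fd : K → ZMod p) : Prop :=
  (ε = 1 ∨ ε = -1) ∧
  (∀ β ∈ walshSupport p m s f,
    walsh p f β = (ε : ℂ) * ((Real.sqrt p : ℝ) : ℂ) ^ (m + s) * ZMod.stdAddChar (fd β)) ∧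
  ∀ β, β ∉ walshSupport p m s f → fd β = 0

/-- `l` is an index of `f`, whose dual function is `fd`. -/
def IsIndex (s : ℕ) (f fd : K → ZMod p) (l : ℕ) : Prop :=
  0 < l ∧ 2 ∣ l ∧ Nat.gcd (l - 1) (p - 1) = 1 ∧
    ∀ z : ZMod p, z ≠ 0 → ∀ β ∈ walshSupport p m s f, fd (z • β) = z ^ l * fd β

/-- `𝒩_f(c)`, the number of `β` in the Walsh support of `f` with `f^*(β) = c`. -/
def dualCount (s : ℕ) (f fd : K → ZMod p) (c : ZMod p) : ℕ :=
  Set.ncard {β | β ∈ walshSupport p m s f ∧ fd β = c}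

/-- The number of `(a, b) ∈ S_f × S_g` such that `(f^*(a), g^*(b))` satisfies `P`. -/
def pairCount (s t : ℕ) (f g fd gd : K → ZMod p) (P : ZMod p → ZMod p → Prop) : ℕ :=
  Set.ncard {ab : K × K | ab.1 ∈ walshSupport p m s f ∧ ab.2 ∈ walshSupport p m t g ∧
    P (fd ab.1) (gd ab.2)}

end Walsh

/-- The condition counted by `B_{S_q}` (with `R = squares p`) and by `B_{N_sq}`
(with `R = nonSquares p`). -/
def predB (p : ℕ) (R : Set (ZMod p)) (u v : ZMod p) : Prop := u + v ∈ R ∧ u - v ∈ R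

/-- The condition counted by `E_1` (with `R = squares p`) and by `E_2`
(with `R = nonSquares p`). -/
def predE12 (p : ℕ) (R : Set (ZMod p)) (u v : ZMod p) : Prop := u ∈ R ∧ (v = u ∨ v = -u)

/-- The condition counted by `E_3` (with `R = squares p`) and by `E_4`
(with `R = nonSquares p`). -/
def predE34 (p : ℕ) (R : Set (ZMod p)) (u v : ZMod p) : Prop :=
  (u = 0 ∧ v ∈ R) ∨ (v = 0 ∧ u ∈ R)

/-! ### The codes -/

section Code

variable {K : Type*} [Field K] [Fintype K] (p : ℕ) [Fact p.Prime] [Algebra (ZMod p) K]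

open scoped Classical in
/-- The defining set `D_{f,g} = {(x, y) ≠ (0, 0) : f x + g y = 0}`. -/
def definingSet (f g : K → ZMod p) : Finset (K × K) :=
  Finset.univ.filter fun xy => xy ≠ (0, 0) ∧ f xy.1 + g xy.2 = 0

/-- The map `(a, b) ↦ (Tr (a x + b y))_{(x, y) ∈ D}`. -/
def codewordMap (D : Finset (K × K)) : (K × K) →ₗ[ZMod p] (D → ZMod p) where
  toFun ab := fun d => Algebra.trace (ZMod p) K (ab.1 * d.1.1 + ab.2 * d.1.2)
  map_add' x y := by
    funext d
    simp only [Prod.fst_add, Prod.snd_add, Pi.add_apply, ← map_add]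
    congr 1
    ring
  map_smul' r x := by
    funext d
    simp only [Prod.smul_fst, Prod.smul_snd, smul_mul_assoc, ← smul_add, map_smul,
      RingHom.id_apply, Pi.smul_apply]

/-- The linear code `C_D`, with coordinates indexed by the elements of `D`. -/
def code (D : Finset (K × K)) : Submodule (ZMod p) (D → ZMod p) :=
  LinearMap.range (codewordMap p D)

end Code

section Weights

variable {p : ℕ} {ι : Type*} [Fintype ι]

/-- `C` is an `[n, k]` code. -/
def HasParameters (C : Submodule (ZMod p) (ι → ZMod p)) (n k : ℕ) : Prop :=
  Fintype.card ι = n ∧ Module.finrank (ZMod p) C = k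

/-- `A_w`, the number of codewords of Hamming weight `w`. -/
def weightCount (C : Submodule (ZMod p) (ι → ZMod p)) (w : ℕ) : ℕ :=
  Set.ncard {c : ι → ZMod p | c ∈ C ∧ hammingNorm c = w}

/-- `C` is a `k`-weight code: exactly `k` of the numbers `A_1, …, A_n` are non-zero. -/
def IsWeightCode (C : Submodule (ZMod p) (ι → ZMod p)) (k : ℕ) : Prop :=
  Set.ncard {w : ℕ | 1 ≤ w ∧ w ≤ Fintype.card ι ∧ weightCount C w ≠ 0} = k

/-- The weight distribution of `C` is listed in a table. A table is a formal sum of its rows, the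
row with weight `w` and frequency `A` being `Finsupp.single w A`; so the frequencies of rows of
equal weight are added, and the total frequency of a number that is no weight is zero. -/
def HasWeightDistribution (C : Submodule (ZMod p) (ι → ZMod p)) (T : ℝ →₀ ℝ) : Prop :=
  ∀ x : ℝ, T x = (Set.ncard {c : ι → ZMod p | c ∈ C ∧ (hammingNorm c : ℝ) = x} : ℝ)

end Weights

/-! ### Closed forms and tables

All exponents are integers, so that nothing is truncated; `√p` is `Real.sqrt p`. -/

/-- The closed form of `𝒩_f(c)`, with `k = m - s`. -/
def dualCountFormula (p : ℕ) [Fact p.Prime] (k : ℤ) (ε : ℤ) (c : ZMod p) : ℝ :=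
  if Even k then
    if c = 0 then (p : ℝ) ^ (k - 1) + ((p : ℝ) - 1) * ε * Real.sqrt p ^ (k - 2)
    else (p : ℝ) ^ (k - 1) - ε * Real.sqrt p ^ (k - 2)
  else
    if c = 0 then (p : ℝ) ^ (k - 1)
    else (p : ℝ) ^ (k - 1) + eta p c * ε * Real.sqrt p ^ (k - 1)

/-- The closed form of `B_{S_q}` (for `σ = 1`) and of `B_{N_sq}` (for `σ = -1`), where
`k₁` is the odd one and `k₂` the even one of `m - s` and `m - t`, and `ε₁`, `ε₂` are the
corresponding signs. -/
def bFormula (p : ℕ) [Fact p.Prime] (k₁ k₂ ε₁ ε₂ σ : ℤ) : ℝ :=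
  ((p : ℝ) - 1) / 2 * Real.sqrt p ^ (k₁ + k₂ - 3) *
    (((p : ℝ) - 1) / 2 * Real.sqrt p ^ (k₁ + k₂ - 1) - σ * eta p 2 * ε₁ * Real.sqrt p ^ k₂
      + ((p : ℝ) + 1) / 2 * ε₂ * Real.sqrt p ^ (k₁ - 1) + σ * (eta p 2 + p) * ε₁ * ε₂)

/-- The weight `(p - 1) p ^ (2m - 2)`. -/
def mainWeight (p m : ℕ) : ℝ := ((p : ℝ) - 1) * (p : ℝ) ^ (2 * (m : ℤ) - 2)

/-- The number `√p ^ (2m + s + t - 3)`. -/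
def dev (p m s t : ℕ) : ℝ := Real.sqrt p ^ (2 * (m : ℤ) + s + t - 3)

/-- The weight distribution for `l_f = (p - 1) / 2`. -/
def table1 (p m s t : ℕ) : ℝ →₀ ℝ :=
  Finsupp.single 0 1
  + Finsupp.single (mainWeight p m)
      ((p : ℝ) ^ (2 * (m : ℤ)) - ((p : ℝ) - 1) * (p : ℝ) ^ (2 * (m : ℤ) - s - t - 1) - 1)
  + Finsupp.single (mainWeight p m - ((p : ℝ) - 1) * dev p m s t)
      (((p : ℝ) - 1) / 2 *
        ((p : ℝ) ^ (2 * (m : ℤ) - s - t - 1) + Real.sqrt p ^ (2 * (m : ℤ) - s - t - 1)))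
  + Finsupp.single (mainWeight p m + ((p : ℝ) - 1) * dev p m s t)
      (((p : ℝ) - 1) / 2 *
        ((p : ℝ) ^ (2 * (m : ℤ) - s - t - 1) - Real.sqrt p ^ (2 * (m : ℤ) - s - t - 1)))

/-- The weight distribution for `l_f = p - 1`; `ε` is the product of the two signs. -/
def table2 (p m s t : ℕ) [Fact p.Prime] (ε : ℤ) (E₁ E₂ BS BN : ℝ) : ℝ →₀ ℝ :=
  Finsupp.single 0 1
  + Finsupp.single (mainWeight p m) ((p : ℝ) ^ (2 * (m : ℤ)) - 1 - E₁ - E₂ - BS - BN)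
  + Finsupp.single (mainWeight p m - ((p : ℝ) - 1) / 2 * ε * eta p 2 * dev p m s t) E₁
  + Finsupp.single (mainWeight p m + ((p : ℝ) - 1) / 2 * ε * eta p 2 * dev p m s t) E₂
  + Finsupp.single (mainWeight p m - ((p : ℝ) - 1) * ε * dev p m s t) BS
  + Finsupp.single (mainWeight p m + ((p : ℝ) - 1) * ε * dev p m s t) BN

/-- The weight distribution for `l_f = 2` and `p ≡ 1 mod 8`; `ε` is the product of the two signs,
`NS` is `𝒩_f(i) 𝒩_g(i)` and `NN` is `𝒩_f(j) 𝒩_g(j)` for a non-zero square `i` and a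
non-square `j`. -/
def table3 (p m s t : ℕ) (ε : ℤ) (E₃ E₄ NS NN : ℝ) : ℝ →₀ ℝ :=
  Finsupp.single 0 1
  + Finsupp.single (mainWeight p m)
      ((p : ℝ) ^ (2 * (m : ℤ)) - 1 - E₃ - E₄ - ((p : ℝ) - 1) ^ 2 / 4 * (NS + NN))
  + Finsupp.single (mainWeight p m - ((p : ℝ) - 1) * ε * dev p m s t) E₃
  + Finsupp.single (mainWeight p m + ((p : ℝ) - 1) * ε * dev p m s t) E₄
  + Finsupp.single (mainWeight p m + 2 * ε * dev p m s t) (((p : ℝ) - 1) ^ 2 / 4 * NS)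
  + Finsupp.single (mainWeight p m - 2 * ε * dev p m s t) (((p : ℝ) - 1) ^ 2 / 4 * NN)

/-- The weight distribution for `l_f = 2` and `p ≡ 5 mod 8`; `ε` is the product of the two signs,
`Nf` and `Ng` are the functions `𝒩_f` and `𝒩_g`. -/
def table4 (p m s t : ℕ) [Fact p.Prime] (ε : ℤ) (E₃ E₄ : ℝ) (Nf Ng : ZMod p → ℝ) : ℝ →₀ ℝ :=
  Finsupp.single 0 1
  + Finsupp.single (mainWeight p m)
      ((p : ℝ) ^ (2 * (m : ℤ)) - 1 - E₃ - E₄ - ∑ u : (ZMod p)ˣ, ∑ v : (ZMod p)ˣ, Nf u * Ng v)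
  + Finsupp.single (mainWeight p m - ((p : ℝ) - 1) * ε * dev p m s t) E₃
  + Finsupp.single (mainWeight p m + ((p : ℝ) - 1) * ε * dev p m s t) E₄
  + ∑ u : (ZMod p)ˣ, ∑ v : (ZMod p)ˣ,
      Finsupp.single
        (mainWeight p m - ε * dev p m s t * (eta p u *
          (companionSum p 4 ((v : ZMod p) / u) - eta p ((v : ZMod p) / u)) : ℤ))
        (Nf u * Ng v)

end PlateauedCode

end

/-!
For `p ≡ 1 mod 4` the quadratic Gauss sum of `𝔽_p` is `+√p` (`gauss_sum_eq_sqrt`), so `√p` lies in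
`ℤ[ζ_p]` and its Galois conjugates are `η(z) √p`. An element of `ℤ[ζ_p]` of absolute value
`√p ^ N` is `±√p ^ N` times a power of `ζ_p`, because `p` is totally ramified and by Kronecker's
theorem (`eq_sign_mul_sqrt_pow`). Applied to one non-zero Walsh value, this gives signs and dual
functions (`exists_isSignDual`).

Inversion of the Walsh transform at `0` gives `∑_c 𝒩_f(c) ζ_p ^ c = ±√p ^ (m - s)`, and Parseval's
identity gives `∑_c 𝒩_f(c) = p ^ (m - s)`. The only integral relation between the `p`-th roots of
unity is that their sum vanishes, so the numbers `𝒩_f(c)` follow by comparison of coefficients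
(`dualCount_eq_formula`). The Walsh support has `p ^ (m - s)` elements, an odd number, and it is
stable under negation; hence it contains `0` (`zero_mem_walshSupport`), and a similar parity
argument shows `f^*(0) = 0` (`dual_zero_eq_zero`). In particular the two alternatives of the
hypothesis need not be told apart: the class WRPB is empty.

The weight of the codeword of `(a, b)` is found by counting the zeros of `f x + g y` on the
hyperplane `Tr (a x + b y) = 0` with additive characters. This leads to sums over `c` and `z` of
Galois conjugates by `z` of products of Walsh values at `c a` and `c b`. As `s + t` is odd, the
sum over `z` is a quadratic Gauss sum, and by the homogeneity of the dual functions the weight is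
`(p - 1) p ^ (2m - 2) - ε_f ε_g √p ^ (2m + s + t - 3) ∑_c η(c ^ l_f f^*(a) + c ^ l_g g^*(b))` for
a non-zero point `(a, b)` of `S_f × S_g` (`hammingNorm_of_mem`), and just the main term for the
other non-zero points (`hammingNorm_of_not_mem`). The character sum is at most `p - 1` in absolute
value; so, by the bound on `s + t`, these weights are positive, and the encoding map is injective
(`codewordMap_injective`).

The weight distribution is thus the distribution of the character sum `pairSum` over the pairs of
dual values (`hasWeightDistribution_code`). With `l_g = (p - 1) / 2`, Euler's criterion evaluates
the sum for `l_f` equal to `(p - 1) / 2`, `p - 1` and `2`; in the last case the substitution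
`c ↦ i c` with `i ^ 2 = -1` leads to the character sum of a quadratic polynomial if `i` is a
square, and to the companion sum `I_4` if it is not. The pairs with a given value of the sum are
counted with the closed forms of `𝒩_f` and `𝒩_g`, of which one is affine in `η` and the other
constant away from `0` (`pairCount_predE12`, `pairCount_predE34`, `pairCount_predB`,
`pairCount_eta_add`).
-/

namespace PlateauedCode

/-! ### Linear relations between `p`-th roots of unity -/

section PrimeField

open Polynomial

variable {p : ℕ} [Fact p.Prime]

lemma sum_zmod_eq_sum_range {M : Type*} [AddCommMonoid M] (F : ZMod p → M) :
    ∑ c, F c = ∑ j ∈ Finset.range p, F (j : ZMod p) := by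
  refine Finset.sum_bij' (fun c _ => c.val) (fun j _ => (j : ZMod p)) ?_ ?_ ?_ ?_ ?_
  · intro c _; exact Finset.mem_range.2 (ZMod.val_lt c)
  · intro j _; exact Finset.mem_univ _
  · intro c _; exact ZMod.natCast_zmod_val c
  · intro j hj; exact ZMod.val_cast_of_lt (Finset.mem_range.1 hj)
  · intro c _; rw [ZMod.natCast_zmod_val c]

lemma stdAddChar_isPrimitiveRoot : IsPrimitiveRoot (ZMod.stdAddChar (1 : ZMod p)) p := by
  have h := ZMod.stdAddChar_coe (N := p) 1
  have h2 := Complex.isPrimitiveRoot_exp p (NeZero.ne p)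
  simp only [Int.cast_one, mul_one] at h
  rwa [h]

lemma stdAddChar_natCast (j : ℕ) :
    ZMod.stdAddChar (j : ZMod p) = ZMod.stdAddChar (1 : ZMod p) ^ j := by
  rw [← AddChar.map_nsmul_eq_pow, nsmul_one]

lemma cyclotomic_dvd_of_aeval_eq_zero {F : ℤ[X]}
    (h : aeval (ZMod.stdAddChar (1 : ZMod p)) F = 0) : cyclotomic p ℤ ∣ F := by
  have hζ := stdAddChar_isPrimitiveRoot (p := p)
  rw [cyclotomic_eq_minpoly hζ (NeZero.pos p)]
  exact minpoly.isIntegrallyClosed_dvd (hζ.isIntegral (NeZero.pos p)) h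

/-- The only linear relations with integer coefficients between the `p`-th roots of unity are the
multiples of the relation that their sum is zero. -/
lemma coeff_eq_of_sum_eq_zero {n : ZMod p → ℤ}
    (h : ∑ c, (n c : ℂ) * ZMod.stdAddChar c = 0) (c : ZMod p) : n c = n 0 := by
  have hp := Fact.out (p := p.Prime)
  set F : ℤ[X] := ∑ j ∈ Finset.range p, C (n j) * X ^ j with hF
  have hF0 : aeval (ZMod.stdAddChar (1 : ZMod p)) F = 0 := by
    rw [sum_zmod_eq_sum_range] at h
    rw [hF, map_sum, ← h]
    refine Finset.sum_congr rfl fun j _ => ?_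
    rw [stdAddChar_natCast]
    simp
  obtain ⟨Q, hQ⟩ := cyclotomic_dvd_of_aeval_eq_zero hF0
  -- `F` has degree at most `p - 1`, so it is a constant times the cyclotomic polynomial
  have hcoeff : ∀ j < p, F.coeff j = n j := by
    intro j hj
    simp only [hF, finsetSum_coeff, coeff_C_mul, coeff_X_pow, mul_ite, mul_one, mul_zero]
    rw [Finset.sum_ite_eq]
    simp [hj]
  have hdeg : F.natDegree < p := by
    rw [Nat.lt_iff_le_pred hp.pos]
    refine natDegree_sum_le_of_forall_le _ _ fun j hj => ?_
    refine (natDegree_C_mul_X_pow_le _ _).trans ?_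
    have := Finset.mem_range.1 hj
    lia
  have hQdeg : Q.natDegree = 0 := by
    by_cases hQ0 : Q = 0
    · simp [hQ0]
    · have := (cyclotomic.monic p ℤ).natDegree_mul' hQ0
      rw [← hQ, natDegree_cyclotomic, Nat.totient_prime hp] at this
      lia
  have hconst : ∀ j < p, F.coeff j = Q.coeff 0 := by
    intro j hj
    rw [hQ, eq_C_of_natDegree_eq_zero hQdeg, coeff_mul_C, cyclotomic_prime]
    simp [coeff_X_pow, hj]
  have h1 := hcoeff c.val (ZMod.val_lt c)
  have h2 := hcoeff 0 hp.pos
  rw [hconst _ (ZMod.val_lt c), ZMod.natCast_zmod_val] at h1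
  rw [hconst _ hp.pos, Nat.cast_zero] at h2
  rw [← h1, ← h2]

/-! ### The sign of the quadratic Gauss sum -/

/-- The Euler operator `X d/dX` on polynomials. -/
noncomputable def eulerOp (R : Type*) [CommRing R] : R[X] →ₗ[R] R[X] :=
  LinearMap.mulLeft R X ∘ₗ derivative

lemma eulerOp_apply {R : Type*} [CommRing R] (F : R[X]) : eulerOp R F = X * derivative F := rfl

lemma eulerOp_pow_X_pow {R : Type*} [CommRing R] (n j : ℕ) :
    (eulerOp R ^ n) (X ^ j) = C ((j : R) ^ n) * X ^ j := by
  induction n with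
  | zero => simp
  | succ n ih =>
    rw [pow_succ', Module.End.mul_apply, ih, eulerOp_apply, derivative_C_mul, derivative_X_pow,
      pow_succ, C_mul]
    rcases j with _ | j
    · simp
    · simp only [Nat.add_sub_cancel]
      ring

/-- The `n`-th iterate of the Euler operator sees, at `1`, only the leading coefficient of a
polynomial that vanishes to order `n` there. -/
lemma eval_one_eulerOp_pow {R : Type*} [CommRing R] (n : ℕ) (G : R[X]) :
    eval 1 ((eulerOp R ^ n) ((X - 1) ^ n * G)) = n.factorial * eval 1 G := by
  induction n generalizing G with
  | zero => simp
  | succ n ih =>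
    have h : eulerOp R ((X - 1) ^ (n + 1) * G) =
        (X - 1) ^ n * (((n + 1 : ℕ) : R[X]) * X * G + X * (X - 1) * derivative G) := by
      rw [eulerOp_apply, derivative_mul, derivative_pow, derivative_sub, derivative_X,
        derivative_one, Nat.add_sub_cancel, pow_succ]
      simp only [map_natCast]
      ring
    rw [pow_succ, Module.End.mul_apply, h, ih]
    simp [Nat.factorial_succ]
    ring

lemma factorial_half_sq {n : ℕ} (hpn : p = 2 * n + 1) (hn : Even n) :
    ((n.factorial : ZMod p)) ^ 2 = -1 := by
  have h1 := ZMod.wilsons_lemma p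
  have h2 : p - 1 = n + n := by lia
  rw [h2, ← Nat.factorial_mul_ascFactorial, Nat.cast_mul] at h1
  rw [← h1, sq]
  congr 1
  rw [Nat.ascFactorial_eq_prod_range, Nat.cast_prod, ← Finset.prod_range_add_one_eq_factorial,
    Nat.cast_prod, ← Finset.prod_range_reflect]
  have h3 : ∏ i ∈ Finset.range n, ((n + 1 + i : ℕ) : ZMod p)
      = ∏ i ∈ Finset.range n, (-1) * ((n - 1 - i + 1 : ℕ) : ZMod p) := by
    refine Finset.prod_congr rfl fun i hi => ?_
    have hi := Finset.mem_range.1 hi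
    have h0 : ((n + 1 + i : ℕ) : ZMod p) + ((n - 1 - i + 1 : ℕ) : ZMod p) = 0 := by
      rw [← Nat.cast_add, show n + 1 + i + (n - 1 - i + 1) = p by lia, ZMod.natCast_self]
    linear_combination h0
  rw [h3, Finset.prod_mul_distrib, Finset.prod_const, Finset.card_range, hn.neg_one_pow, one_mul]

lemma ringChar_zmod_ne_two {n : ℕ} (hpn : p = 2 * n + 1) : ringChar (ZMod p) ≠ 2 := by
  rw [ZMod.ringChar_zmod_n]; lia

/-- If the quadratic Gauss sum is an integer multiple `δ` of the half-system product, then `δ = 1`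
in `𝔽_p`: modulo `p` the cyclotomic polynomial is `(X - 1) ^ (p - 1)`, and one compares the
expansions of both sides at `1` to order `(p - 1) / 2`. -/
lemma multiplier_gauss_product {n : ℕ} (hpn : p = 2 * n + 1) (hn : Even n) (δ : ℤ)
    (h : ∑ c : ZMod p, (eta p c : ℂ) * ZMod.stdAddChar c =
      δ * ∏ k ∈ Finset.range n, (ZMod.stdAddChar (1 : ZMod p) ^ ((n + 1) * (k + 1)) -
        ZMod.stdAddChar (1 : ZMod p) ^ (n * (k + 1)))) :
    (δ : ZMod p) = 1 := by
  have hp := Fact.out (p := p.Prime)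
  have hn0 : 0 < n := by
    rcases Nat.eq_zero_or_pos n with h0 | h0
    · subst h0; exact absurd (by lia) hp.one_lt.ne
    · exact h0
  set F : ℤ[X] := ∑ j ∈ Finset.range p, C (eta p j) * X ^ j -
    C δ * ∏ k ∈ Finset.range n, (X ^ ((n + 1) * (k + 1)) - X ^ (n * (k + 1))) with hF
  have hF0 : aeval (ZMod.stdAddChar (1 : ZMod p)) F = 0 := by
    rw [sum_zmod_eq_sum_range] at h
    rw [hF, map_sub, sub_eq_zero, map_mul, map_prod, map_sum]
    simp only [map_mul, map_sub, map_pow, aeval_X, eq_intCast, map_intCast]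
    rw [← h]
    exact Finset.sum_congr rfl fun j _ => by rw [stdAddChar_natCast]
  obtain ⟨Q, hQ⟩ := cyclotomic_dvd_of_aeval_eq_zero hF0
  have hcyc : cyclotomic p (ZMod p) = (X - 1) ^ (n + n) := by
    have := cyclotomic_mul_prime_eq_pow_of_not_dvd (ZMod p) (p := p) (n := 1)
      (fun hd => hp.one_lt.ne' (Nat.dvd_one.1 hd))
    rw [one_mul, cyclotomic_one] at this
    rw [this]; congr 1; lia
  have hmap : F.map (Int.castRingHom (ZMod p)) =
      (X - 1) ^ n * ((X - 1) ^ n * Q.map (Int.castRingHom (ZMod p))) := by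
    rw [hQ, Polynomial.map_mul, map_cyclotomic, hcyc, pow_add, mul_assoc]
  -- modulo `p`, `F` vanishes at `1` to order `2 * n`, which is more than `n`
  have hz : eval 1 ((eulerOp (ZMod p) ^ n) (F.map (Int.castRingHom (ZMod p)))) = 0 := by
    rw [hmap, eval_one_eulerOp_pow]
    simp [hn0.ne']
  have hprod : ∏ k ∈ Finset.range n, ((X : (ZMod p)[X]) ^ ((n + 1) * (k + 1)) - X ^ (n * (k + 1)))
      = (X - 1) ^ n * ∏ k ∈ Finset.range n,
          (X ^ (n * (k + 1)) * ∑ i ∈ Finset.range (k + 1), X ^ i) := by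
    have : (X - 1 : (ZMod p)[X]) ^ n = ∏ _k ∈ Finset.range n, (X - 1) := by simp
    rw [this, ← Finset.prod_mul_distrib]
    refine Finset.prod_congr rfl fun k _ => ?_
    have := mul_geom_sum (X : (ZMod p)[X]) (k + 1)
    linear_combination (-X ^ (n * (k + 1))) * this
  -- Euler's criterion: the operator turns the coefficient `η j` into `j ^ (p - 1)`
  have hsum : ∀ j : ℕ, ((eta p (j : ZMod p) : ℤ) : ZMod p) * (j : ZMod p) ^ n
      = (j : ZMod p) ^ (p - 1) := by
    intro j
    have := quadraticChar_eq_pow_of_char_ne_two' (ringChar_zmod_ne_two hpn) (j : ZMod p)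
    rw [ZMod.card, show p / 2 = n by lia] at this
    rw [eta, this, ← pow_add]
    congr 1; lia
  have hexp : F.map (Int.castRingHom (ZMod p)) =
      ∑ j ∈ Finset.range p, ((eta p (j : ZMod p) : ℤ) : ZMod p) • X ^ j -
      (δ : ZMod p) • ((X - 1) ^ n * ∏ k ∈ Finset.range n,
          (X ^ (n * (k + 1)) * ∑ i ∈ Finset.range (k + 1), X ^ i)) := by
    rw [← hprod, hF]
    simp [Polynomial.map_sum, Polynomial.map_prod, smul_eq_C_mul]
  rw [hexp, map_sub, map_smul, map_sum, eval_sub, eval_smul, eval_one_eulerOp_pow,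
    eval_finsetSum, eval_prod] at hz
  simp only [map_smul, eulerOp_pow_X_pow, eval_smul, eval_mul, eval_C, eval_pow, eval_X, one_pow,
    mul_one, smul_eq_mul, hsum, eval_finsetSum, one_mul, Finset.sum_const, Finset.card_range,
    nsmul_eq_mul] at hz
  have hfac : ∏ k ∈ Finset.range n, ((k + 1 : ℕ) : ZMod p) = n.factorial := by
    rw [← Nat.cast_prod, Finset.prod_range_add_one_eq_factorial]
  rw [hfac, ← sq, factorial_half_sq hpn hn,
    ← sum_zmod_eq_sum_range (fun c : ZMod p => c ^ (p - 1))] at hz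
  have hone : ∑ c : ZMod p, c ^ (p - 1) = -1 := by
    have : ∀ c : ZMod p, c ^ (p - 1) = 1 - if c = 0 then 1 else 0 := by
      intro c
      split_ifs with hc
      · rw [hc, zero_pow (by lia)]; simp
      · rw [ZMod.pow_card_sub_one_eq_one hc]; simp
    simp [this]
  rw [hone] at hz
  linear_combination hz

/-- The product over a half-system is a product of `n` factors `± 2 i sin (π k / p)` whose units
multiply to `1`; so it is positive, and the square of its absolute value is `∏ (1 - ζ ^ k) = p`. -/
lemma half_system_product {n : ℕ} (hpn : p = 2 * n + 1) (hn : Even n) :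
    ∏ k ∈ Finset.range n, (ZMod.stdAddChar (1 : ZMod p) ^ ((n + 1) * (k + 1)) -
        ZMod.stdAddChar (1 : ZMod p) ^ (n * (k + 1))) = ((Real.sqrt p : ℝ) : ℂ) := by
  have hp := Fact.out (p := p.Prime)
  set ζ := ZMod.stdAddChar (1 : ZMod p) with hζdef
  have hζ : IsPrimitiveRoot ζ p := stdAddChar_isPrimitiveRoot
  have hp0 : (p : ℂ) ≠ 0 := by exact_mod_cast hp.ne_zero
  have hpR : (0 : ℝ) < p := by exact_mod_cast hp.pos
  have hpn' : (p : ℂ) = 2 * n + 1 := by exact_mod_cast hpn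
  have hexp : ∀ j : ℕ, ζ ^ j = Complex.exp (2 * Real.pi * Complex.I * j / p) := by
    intro j
    have := ZMod.stdAddChar_coe (N := p) j
    rw [Int.cast_natCast, stdAddChar_natCast] at this
    rw [hζdef, this]
    simp
  have hfactor : ∀ k : ℕ, ζ ^ ((n + 1) * (k + 1)) - ζ ^ (n * (k + 1)) =
      ((-1) ^ (k + 1) * Complex.I) * ((2 * Real.sin (Real.pi * (k + 1) / p) : ℝ) : ℂ) := by
    intro k
    have e1 : (2 * Real.pi * Complex.I * ((n + 1) * (k + 1) : ℕ) / p : ℂ) =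
        (k + 1 : ℕ) * (Real.pi * Complex.I) + (Real.pi * (k + 1) / p) * Complex.I := by
      push_cast
      field_simp
      rw [hpn']; ring
    have e2 : (2 * Real.pi * Complex.I * (n * (k + 1) : ℕ) / p : ℂ) =
        (k + 1 : ℕ) * (Real.pi * Complex.I) + -(Real.pi * (k + 1) / p) * Complex.I := by
      push_cast
      field_simp
      rw [hpn']; ring
    rw [hexp, hexp, e1, e2, Complex.exp_add, Complex.exp_add, Complex.exp_nat_mul,
      Complex.exp_pi_mul_I]
    push_cast
    rw [Complex.sin]
    linear_combination (-(-1) ^ (k + 1) *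
      (Complex.exp (-(Real.pi * (k + 1) / p) * Complex.I)
        - Complex.exp ((Real.pi * (k + 1) / p) * Complex.I))) * Complex.I_sq
  have hunits : ∏ k ∈ Finset.range n, ((-1 : ℂ) ^ (k + 1) * Complex.I) = 1 := by
    obtain ⟨l, rfl⟩ := hn
    clear hpn hpn' hfactor
    induction l with
    | zero => simp
    | succ l ih =>
      rw [show l + 1 + (l + 1) = (l + l) + 1 + 1 by ring, Finset.prod_range_succ,
        Finset.prod_range_succ, ih, ← two_mul]
      have h1 : (-1 : ℂ) ^ (2 * l) = 1 := by rw [pow_mul]; norm_num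
      simp only [pow_succ, h1]
      linear_combination -Complex.I_sq
  set r : ℝ := ∏ k ∈ Finset.range n, (2 * Real.sin (Real.pi * (k + 1) / p)) with hr
  have hP : ∏ k ∈ Finset.range n, (ζ ^ ((n + 1) * (k + 1)) - ζ ^ (n * (k + 1))) = (r : ℂ) := by
    rw [Finset.prod_congr rfl fun k _ => hfactor k, Finset.prod_mul_distrib, hunits, one_mul, hr,
      Complex.ofReal_prod]
  have hrpos : 0 < r := by
    refine Finset.prod_pos fun k hk => ?_
    have hk := Finset.mem_range.1 hk
    have hk' : ((k : ℝ) + 1) < p := by exact_mod_cast (by lia : k + 1 < p)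
    refine mul_pos two_pos (Real.sin_pos_of_pos_of_lt_pi (by positivity) ?_)
    rw [div_lt_iff₀ hpR]
    exact mul_lt_mul_of_pos_left hk' Real.pi_pos
  have hnorm : ‖ζ‖ = 1 := hζ.norm'_eq_one hp.ne_zero
  have hrnorm : r = ∏ k ∈ Finset.range n, ‖1 - ζ ^ (k + 1)‖ := by
    have := congrArg norm hP
    rw [Complex.norm_real, Real.norm_of_nonneg hrpos.le, norm_prod] at this
    rw [← this]
    refine Finset.prod_congr rfl fun k _ => ?_
    have : ζ ^ ((n + 1) * (k + 1)) - ζ ^ (n * (k + 1)) =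
        -(ζ ^ (n * (k + 1)) * (1 - ζ ^ (k + 1))) := by ring
    rw [this, norm_neg, norm_mul, norm_pow, hnorm, one_pow, one_mul]
  have hsq : r ^ 2 = p := by
    have h1 := IsPrimitiveRoot.prod_one_sub_pow_eq_order (n := n + n)
      (show IsPrimitiveRoot ζ (n + n + 1) by rwa [show n + n + 1 = p by lia])
    have h2 := congrArg norm h1
    rw [norm_prod, Finset.prod_range_add, ← hrnorm] at h2
    have h3 : ∏ i ∈ Finset.range n, ‖1 - ζ ^ (n + i + 1)‖ = r := by
      rw [hrnorm, ← Finset.prod_range_reflect]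
      refine Finset.prod_congr rfl fun i hi => ?_
      have hi := Finset.mem_range.1 hi
      have h4 : ζ ^ (n + (n - 1 - i) + 1) * ζ ^ (i + 1) = 1 := by
        rw [← pow_add, show n + (n - 1 - i) + 1 + (i + 1) = p by lia, hζ.pow_eq_one]
      have h5 : 1 - ζ ^ (n + (n - 1 - i) + 1) =
          -(ζ ^ (n + (n - 1 - i) + 1) * (1 - ζ ^ (i + 1))) := by
        linear_combination -h4
      rw [h5, norm_neg, norm_mul, norm_pow, hnorm, one_pow, one_mul]
    rw [h3] at h2
    rw [sq, h2]
    have : ((n + n : ℕ) : ℂ) + 1 = ((p : ℝ) : ℂ) := by rw [hpn]; push_cast; ring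
    rw [this, Complex.norm_real, Real.norm_of_nonneg hpR.le]
  rw [hP, ← hsq, Real.sqrt_sq hrpos.le]

lemma exists_half {p : ℕ} (hp4 : p % 4 = 1) : ∃ n, p = 2 * n + 1 ∧ Even n :=
  ⟨p / 2, by lia, by rw [Nat.even_iff]; lia⟩

lemma five_le (hp4 : p % 4 = 1) : 5 ≤ p := by
  have := (Fact.out (p := p.Prime)).one_lt
  lia

lemma eta_neg_one (hp4 : p % 4 = 1) : eta p (-1) = 1 := by
  rw [eta, quadraticChar_one_iff_isSquare (neg_ne_zero.2 one_ne_zero),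
    ZMod.exists_sq_eq_neg_one_iff]
  lia

lemma eta_mul (a b : ZMod p) : eta p (a * b) = eta p a * eta p b := map_mul _ a b

lemma eta_zero : eta p 0 = 0 := quadraticChar_zero

lemma eta_one : eta p 1 = 1 := map_one _

lemma eta_neg (hp4 : p % 4 = 1) (a : ZMod p) : eta p (-a) = eta p a := by
  rw [← neg_one_mul, eta_mul, eta_neg_one hp4, one_mul]

lemma eta_sq {a : ZMod p} (ha : a ≠ 0) : eta p a ^ 2 = 1 := quadraticChar_sq_one ha

lemma eta_eq_zero_iff {a : ZMod p} : eta p a = 0 ↔ a = 0 := quadraticChar_eq_zero_iff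

lemma sum_eta (hp4 : p % 4 = 1) : ∑ c, eta p c = 0 := by
  obtain ⟨n, hpn, -⟩ := exists_half hp4
  exact quadraticChar_sum_zero (ringChar_zmod_ne_two hpn)

/-- Gauss's determination of the sign of the quadratic Gauss sum, for `p ≡ 1 mod 4`. -/
theorem gauss_sum_eq_sqrt (hp4 : p % 4 = 1) :
    ∑ c : ZMod p, (eta p c : ℂ) * ZMod.stdAddChar c = ((Real.sqrt p : ℝ) : ℂ) := by
  obtain ⟨n, hpn, hn⟩ := exists_half hp4
  have hp := Fact.out (p := p.Prime)
  have hc := ringChar_zmod_ne_two hpn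
  have hsq : (∑ c : ZMod p, (eta p c : ℂ) * ZMod.stdAddChar c) ^ 2
      = ((Real.sqrt p : ℝ) : ℂ) ^ 2 := by
    set χ : MulChar (ZMod p) ℂ := (quadraticChar (ZMod p)).ringHomComp (Int.castRingHom ℂ)
    have hinj : Function.Injective (Int.castRingHom ℂ) := Int.cast_injective
    have h1 : χ ≠ 1 := (MulChar.ringHomComp_ne_one_iff hinj).2 (quadraticChar_ne_one hc)
    have h2 : χ.IsQuadratic := (quadraticChar_isQuadratic (ZMod p)).comp _
    have h3 := gaussSum_sq h1 h2 (ZMod.isPrimitive_stdAddChar p)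
    have h4 : χ (-1) = 1 := by
      have : χ (-1) = ((eta p (-1) : ℤ) : ℂ) := rfl
      rw [this, eta_neg_one hp4, Int.cast_one]
    rw [h4, one_mul, ZMod.card] at h3
    rw [← Complex.ofReal_pow, Real.sq_sqrt (Nat.cast_nonneg p)]
    exact_mod_cast h3
  have hδ : ∀ δ : ℤ, ∑ c : ZMod p, (eta p c : ℂ) * ZMod.stdAddChar c
      = δ * ((Real.sqrt p : ℝ) : ℂ) → (δ : ZMod p) = 1 := fun δ h =>
    multiplier_gauss_product hpn hn δ (by rw [half_system_product hpn hn]; exact h)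
  rcases sq_eq_sq_iff_eq_or_eq_neg.1 hsq with h | h
  · exact h
  · have := hδ (-1) (by rw [h]; simp)
    exfalso
    have h2 : ((2 : ℕ) : ZMod p) = 0 := by
      push_cast at this ⊢
      linear_combination -this
    rw [ZMod.natCast_eq_zero_iff] at h2
    have := Nat.le_of_dvd two_pos h2
    have := five_le hp4
    lia

/-- The quadratic Gauss sum of the additive character `z ↦ ζ ^ (z e)`. -/
lemma gauss_sum_mul (hp4 : p % 4 = 1) (e : ZMod p) :
    ∑ z : ZMod p, (eta p z : ℂ) * ZMod.stdAddChar (z * e) = eta p e * ((Real.sqrt p : ℝ) : ℂ) := by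
  by_cases he : e = 0
  · subst he
    simp only [mul_zero, AddChar.map_zero_eq_one, mul_one, eta_zero, Int.cast_zero, zero_mul]
    exact_mod_cast sum_eta hp4
  · rw [← gauss_sum_eq_sqrt hp4, Finset.mul_sum]
    refine Fintype.sum_equiv (Equiv.mulRight₀ e he) _ _ fun z => ?_
    have : (eta p e : ℂ) * eta p e = 1 := by exact_mod_cast (sq (eta p e)) ▸ eta_sq he
    simp only [Equiv.mulRight₀_apply, eta_mul]
    push_cast
    linear_combination (-(eta p z : ℂ) * ZMod.stdAddChar (z * e)) * this

end PrimeField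

/-! ### Elements of `ℤ[ζ_p]` whose absolute value is a power of `√p` -/

section CyclotomicIntegers

open Polynomial

variable {p : ℕ} [Fact p.Prime]

open NumberField in
/-- The argument takes place in an abstract `p`-th cyclotomic field `F`. As `p` is totally ramified,
an element of square modulus `p ^ N` and its complex conjugate are associated to powers of the prime
`ζ_p - 1`, so that one divides the other; by Kronecker's theorem their quotient is a root of
unity. -/
theorem eq_sign_mul_sqrt_pow_of_cyclotomic (F : Type*) [Field F] [NumberField F]
    [IsCyclotomicExtension {p} ℚ F] (hp4 : p % 4 = 1) (n : ZMod p → ℤ) (N : ℕ)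
    (h : ‖∑ c, (n c : ℂ) * ZMod.stdAddChar c‖ ^ 2 = (p : ℝ) ^ N) :
    ∃ (ε : ℤ) (d : ZMod p), (ε = 1 ∨ ε = -1) ∧
      ∑ c, (n c : ℂ) * ZMod.stdAddChar c
        = (ε : ℂ) * ((Real.sqrt p : ℝ) : ℂ) ^ N * ZMod.stdAddChar d := by
  have hp := Fact.out (p := p.Prime)
  obtain ⟨φ₀⟩ : Nonempty (F →+* ℂ) := inferInstance
  obtain ⟨ζ, hζ, hζφ⟩ : ∃ ζ : F, IsPrimitiveRoot ζ p ∧ φ₀ ζ = ZMod.stdAddChar (1 : ZMod p) := by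
    have h1 := IsCyclotomicExtension.zeta_spec p ℚ F
    have h2 := h1.map_of_injective φ₀.injective
    obtain ⟨i, -, hi⟩ := h2.eq_pow_of_pow_eq_one
      (stdAddChar_isPrimitiveRoot (p := p)).pow_eq_one
    refine ⟨IsCyclotomicExtension.zeta p ℚ F ^ i, ?_, by rw [map_pow, hi]⟩
    refine IsPrimitiveRoot.of_map_of_injective (f := φ₀) ?_ φ₀.injective
    rw [map_pow, hi]
    exact stdAddChar_isPrimitiveRoot
  -- `x` is the element in question and `y` its complex conjugate
  set z : 𝓞 F := hζ.toInteger with hz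
  have hzζ : algebraMap (𝓞 F) F z = ζ := rfl
  set x : 𝓞 F := ∑ j ∈ Finset.range p, (n j : 𝓞 F) * z ^ j with hx
  set y : 𝓞 F := ∑ j ∈ Finset.range p, (n j : 𝓞 F) * (z ^ (p - 1)) ^ j with hy
  set W : ℂ := ∑ c, (n c : ℂ) * ZMod.stdAddChar c with hW
  have hφx : φ₀ (algebraMap (𝓞 F) F x) = W := by
    rw [hW, sum_zmod_eq_sum_range, hx, map_sum, map_sum]
    refine Finset.sum_congr rfl fun j _ => ?_
    rw [stdAddChar_natCast, ← hζφ, ← hzζ]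
    simp
  have hconj : ∀ φ : F →+* ℂ, φ (algebraMap (𝓞 F) F y)
      = (starRingEnd ℂ) (φ (algebraMap (𝓞 F) F x)) := by
    intro φ
    have hζ' : IsPrimitiveRoot (φ ζ) p := hζ.map_of_injective φ.injective
    have hn : ‖φ ζ‖ = 1 := hζ'.norm'_eq_one hp.ne_zero
    have hc : (starRingEnd ℂ) (φ ζ) = φ ζ ^ (p - 1) := by
      rw [← Complex.inv_eq_conj hn]
      refine inv_eq_of_mul_eq_one_left ?_
      rw [← pow_succ, Nat.sub_add_cancel hp.one_le, hζ'.pow_eq_one]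
    simp only [hx, hy, map_sum, map_mul, map_pow, map_intCast, hzζ, hc]
  have hxy : x * y = (p : 𝓞 F) ^ N := by
    have : φ₀ (algebraMap (𝓞 F) F (x * y)) = φ₀ (algebraMap (𝓞 F) F ((p : 𝓞 F) ^ N)) := by
      rw [map_mul, map_mul, hconj, hφx, Complex.mul_conj, Complex.normSq_eq_norm_sq, h]
      simp
    exact RingOfIntegers.ext (φ₀.injective this)
  have hnorm : ∀ φ : F →+* ℂ, ‖φ (algebraMap (𝓞 F) F y)‖ = ‖φ (algebraMap (𝓞 F) F x)‖ := by
    intro φ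
    rw [hconj, Complex.norm_conj]
  have hpow0 : (p : 𝓞 F) ^ N ≠ 0 := pow_ne_zero _ (by exact_mod_cast hp.ne_zero)
  have hx0 : x ≠ 0 := fun h0 => hpow0 (by rw [← hxy, h0, zero_mul])
  have hy0 : y ≠ 0 := fun h0 => hpow0 (by rw [← hxy, h0, mul_zero])
  have hφ0 : ∀ (φ : F →+* ℂ) (a : 𝓞 F), a ≠ 0 → ‖φ (algebraMap (𝓞 F) F a)‖ ≠ 0 := by
    intro φ a ha h0
    rw [norm_eq_zero, map_eq_zero, RingOfIntegers.coe_eq_zero_iff] at h0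
    exact ha h0
  have hπ : Prime (z - 1) := hζ.zeta_sub_one_prime'
  have hassoc : Associated ((p : 𝓞 F)) ((z - 1) ^ (p - 1)) :=
    (IsCyclotomicExtension.Rat.associated_zeta_sub_one_pow_prime p hζ).symm
  have hassocN : Associated ((p : 𝓞 F) ^ N) ((z - 1) ^ ((p - 1) * N)) := by
    rw [pow_mul]; exact hassoc.pow_pow
  obtain ⟨a, -, ha⟩ := (dvd_prime_pow hπ _).1
    ((Dvd.intro _ hxy : x ∣ _).trans hassocN.dvd)
  obtain ⟨b, -, hb⟩ := (dvd_prime_pow hπ _).1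
    ((Dvd.intro_left _ hxy : y ∣ _).trans hassocN.dvd)
  have hfin : ∀ w : 𝓞 F, (∀ φ : F →+* ℂ, ‖φ (algebraMap (𝓞 F) F w)‖ = 1) →
      IsOfFinOrder (algebraMap (𝓞 F) F w) := by
    intro w hw
    obtain ⟨k, hk, hk1⟩ := Embeddings.pow_eq_one_of_norm_eq_one F ℂ w.isIntegral_coe hw
    exact isOfFinOrder_iff_pow_eq_one.2 ⟨k, hk, hk1⟩
  set X : F := algebraMap (𝓞 F) F x with hX
  set Y : F := algebraMap (𝓞 F) F y with hY
  have hX0 : X ≠ 0 := by rwa [hX, Ne, RingOfIntegers.coe_eq_zero_iff]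
  have hY0 : Y ≠ 0 := by rwa [hY, Ne, RingOfIntegers.coe_eq_zero_iff]
  have hquot : IsOfFinOrder (X / Y) := by
    rcases le_total a b with hab | hab
    · obtain ⟨w, hw⟩ := (ha.dvd.trans (pow_dvd_pow _ hab)).trans hb.symm.dvd
      have h1 : IsOfFinOrder (algebraMap (𝓞 F) F w) := hfin w fun φ => by
        have := hnorm φ
        rw [hY, hw, map_mul, map_mul, norm_mul] at this
        exact mul_left_cancel₀ (hφ0 φ x hx0) (by rw [this, mul_one])
      have h2 : X / Y = (algebraMap (𝓞 F) F w)⁻¹ := by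
        rw [hY, hw, map_mul, ← hX, div_mul_eq_div_div, div_self hX0, one_div]
      obtain ⟨k, hk, hk1⟩ := isOfFinOrder_iff_pow_eq_one.1 h1
      exact isOfFinOrder_iff_pow_eq_one.2 ⟨k, hk, by rw [h2, inv_pow, hk1, inv_one]⟩
    · obtain ⟨w, hw⟩ := (hb.dvd.trans (pow_dvd_pow _ hab)).trans ha.symm.dvd
      have h1 : IsOfFinOrder (algebraMap (𝓞 F) F w) := hfin w fun φ => by
        have := hnorm φ
        rw [hX, hw, map_mul, map_mul, norm_mul] at this
        exact mul_left_cancel₀ (hφ0 φ y hy0) (by rw [← this, mul_one])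
      have h2 : X / Y = algebraMap (𝓞 F) F w := by
        rw [hX, hw, map_mul, ← hY, mul_div_cancel_left₀ _ hY0]
      rwa [h2]
  -- the Gauss sum is a square root of `p` in `F`
  set g : F := ∑ j ∈ Finset.range p, (eta p (j : ZMod p) : F) * ζ ^ j with hg
  have hφg : φ₀ g = ((Real.sqrt p : ℝ) : ℂ) := by
    rw [← gauss_sum_eq_sqrt hp4, sum_zmod_eq_sum_range, hg, map_sum]
    refine Finset.sum_congr rfl fun j _ => ?_
    rw [stdAddChar_natCast, ← hζφ]
    simp
  have hg2 : g ^ 2 = (p : F) := by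
    apply φ₀.injective
    rw [map_pow, hφg, ← Complex.ofReal_pow, Real.sq_sqrt (Nat.cast_nonneg p)]
    simp
  have hp0 : (p : F) ≠ 0 := by exact_mod_cast hp.ne_zero
  have hg0 : g ≠ 0 := fun h0 => hp0 (by rw [← hg2, h0]; simp)
  have hXY : X * Y = g ^ N * g ^ N := by
    rw [← mul_pow, ← sq, hg2, hX, hY, ← map_mul, hxy]
    simp
  -- `(X / g ^ N) ^ 2 = X / Y`
  have hu : IsOfFinOrder (X / g ^ N) := by
    have h1 : (X / g ^ N) ^ 2 = X / Y := by
      rw [div_pow, sq (g ^ N), ← hXY, sq, mul_div_mul_left _ _ hX0]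
    exact IsOfFinOrder.of_pow (h1 ▸ hquot) two_ne_zero
  have hpodd : Odd p := by rw [Nat.odd_iff]; lia
  obtain ⟨r, hr⟩ := hζ.exists_neg_pow_of_isOfFinOrder hpodd hu
  refine ⟨(-1) ^ r, r, neg_one_pow_eq_or ℤ r, ?_⟩
  have h3 : X = (-ζ) ^ r * g ^ N := by
    rw [← hr, div_mul_cancel₀ _ (pow_ne_zero N hg0)]
  rw [← hφx, h3, map_mul, map_pow, map_pow, map_neg, hζφ, hφg, stdAddChar_natCast, neg_pow]
  push_cast
  ring

/-- An element of `ℤ[ζ_p]` of absolute value `√p ^ N` is equal to `√p ^ N` up to sign and a `p`-th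
root of unity. -/
theorem eq_sign_mul_sqrt_pow (hp4 : p % 4 = 1) (n : ZMod p → ℤ) (N : ℕ)
    (h : ‖∑ c, (n c : ℂ) * ZMod.stdAddChar c‖ ^ 2 = (p : ℝ) ^ N) :
    ∃ (ε : ℤ) (d : ZMod p), (ε = 1 ∨ ε = -1) ∧
      ∑ c, (n c : ℂ) * ZMod.stdAddChar c
        = (ε : ℂ) * ((Real.sqrt p : ℝ) : ℂ) ^ N * ZMod.stdAddChar d := by
  have : IsCyclotomicExtension {p} ℚ (CyclotomicField p ℚ) :=
    CyclotomicField.isCyclotomicExtension p ℚ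
  exact eq_sign_mul_sqrt_pow_of_cyclotomic (CyclotomicField p ℚ) hp4 n N h

/-- The non-trivial `p`-th roots of unity are conjugate. Galois conjugation of elements of `ℤ[ζ_p]`
is expressed through polynomials that represent them. -/
lemma aeval_stdAddChar_eq_zero {F : ℤ[X]} (h : aeval (ZMod.stdAddChar (1 : ZMod p)) F = 0)
    {z : ZMod p} (hz : z ≠ 0) : aeval (ZMod.stdAddChar z) F = 0 := by
  obtain ⟨Q, rfl⟩ := cyclotomic_dvd_of_aeval_eq_zero h
  have hval : IsPrimitiveRoot (ZMod.stdAddChar z) p := by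
    have h1 : ZMod.stdAddChar z = ZMod.stdAddChar (1 : ZMod p) ^ z.val := by
      rw [← stdAddChar_natCast, ZMod.natCast_zmod_val]
    rw [h1]
    refine stdAddChar_isPrimitiveRoot.pow_of_coprime _ ?_
    refine (Nat.Coprime.symm ((Nat.Prime.coprime_iff_not_dvd Fact.out).2 fun hd => hz ?_))
    rw [← ZMod.natCast_eq_zero_iff, ZMod.natCast_zmod_val] at hd
    exact hd
  have h2 : aeval (ZMod.stdAddChar z) (cyclotomic p ℤ) = 0 := by
    rw [aeval_def, eval₂_eq_eval_map, map_cyclotomic]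
    exact hval.isRoot_cyclotomic (NeZero.pos p)
  rw [map_mul, h2, zero_mul]

lemma stdAddChar_pow_val (z c : ZMod p) :
    ZMod.stdAddChar z ^ c.val = ZMod.stdAddChar (z * c) := by
  rw [← AddChar.map_nsmul_eq_pow, nsmul_eq_mul, ZMod.natCast_zmod_val, mul_comm]

/-- Galois conjugation of a character sum whose value is `± √p ^ N ζ ^ d`; the conjugate of `√p`
is `η(z) √p`. -/
lemma sum_stdAddChar_mul_of_eq (hp4 : p % 4 = 1) {ι : Type*} [Fintype ι] {F : ι → ZMod p}
    {ε : ℤ} {N : ℕ} {d : ZMod p}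
    (h : ∑ x, ZMod.stdAddChar (F x) = (ε : ℂ) * ((Real.sqrt p : ℝ) : ℂ) ^ N * ZMod.stdAddChar d)
    {z : ZMod p} (hz : z ≠ 0) :
    ∑ x, ZMod.stdAddChar (z * F x) =
      (ε : ℂ) * (eta p z * ((Real.sqrt p : ℝ) : ℂ)) ^ N * ZMod.stdAddChar (z * d) := by
  set G : ℤ[X] := ∑ c : ZMod p, C (eta p c) * X ^ c.val with hG
  set P : ℤ[X] := ∑ x, X ^ (F x).val - C ε * G ^ N * X ^ d.val with hP
  have hGev : ∀ w : ZMod p, aeval (ZMod.stdAddChar w) G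
      = (eta p w : ℂ) * ((Real.sqrt p : ℝ) : ℂ) := by
    intro w
    rw [← gauss_sum_mul hp4, hG, map_sum]
    refine Finset.sum_congr rfl fun c _ => ?_
    rw [map_mul, map_pow, aeval_X, stdAddChar_pow_val, mul_comm w c]
    simp
  have hPev : ∀ w : ZMod p, aeval (ZMod.stdAddChar w) P = ∑ x, ZMod.stdAddChar (w * F x) -
      (ε : ℂ) * (eta p w * ((Real.sqrt p : ℝ) : ℂ)) ^ N * ZMod.stdAddChar (w * d) := by
    intro w
    rw [hP, map_sub, map_mul, map_mul, map_pow, hGev, map_sum]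
    simp [stdAddChar_pow_val]
  have h1 : aeval (ZMod.stdAddChar (1 : ZMod p)) P = 0 := by
    rw [hPev]
    simp only [one_mul, eta_one, Int.cast_one, h, sub_self]
  have h2 := aeval_stdAddChar_eq_zero h1 hz
  rw [hPev] at h2
  exact sub_eq_zero.1 h2

lemma sum_stdAddChar_mul_of_eq_zero (hp4 : p % 4 = 1) {ι : Type*} [Fintype ι] {F : ι → ZMod p}
    (h : ∑ x, ZMod.stdAddChar (F x) = 0) {z : ZMod p} (hz : z ≠ 0) :
    ∑ x, ZMod.stdAddChar (z * F x) = 0 := by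
  have := sum_stdAddChar_mul_of_eq hp4 (ε := 0) (N := 0) (d := 0) (F := F) (by simpa using h) hz
  simpa using this

end CyclotomicIntegers

/-! ### Walsh transforms of weakly regular plateaued functions -/

section Walsh

variable {K : Type*} [Field K] [Fintype K] {p m s : ℕ} [Fact p.Prime] [Algebra (ZMod p) K]

lemma walsh_eq_sum (f : K → ZMod p) (β : K) : ∃ n : ZMod p → ℤ,
    walsh p f β = ∑ c, (n c : ℂ) * ZMod.stdAddChar c := by
  classical
  refine ⟨fun c => ((Finset.univ.filter fun x : K =>
    f x - Algebra.trace (ZMod p) K (β * x) = c).card : ℤ), ?_⟩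
  rw [walsh, ← Finset.sum_fiberwise_of_maps_to (s := Finset.univ) (t := Finset.univ)
    (g := fun x : K => f x - Algebra.trace (ZMod p) K (β * x)) (fun _ _ => Finset.mem_univ _)]
  refine Finset.sum_congr rfl fun c _ => ?_
  rw [Finset.sum_congr rfl (g := fun _ => ZMod.stdAddChar c)
    fun x hx => by rw [(Finset.mem_filter.1 hx).2]]
  simp

lemma IsPlateaued.walsh_eq_zero {f : K → ZMod p} (hf : IsPlateaued p m s f) {β : K}
    (hβ : β ∉ walshSupport p m s f) : walsh p f β = 0 := by
  rcases hf.2 β with h | h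
  · simpa using h
  · exact absurd h hβ

lemma walsh_ne_zero {f : K → ZMod p} {β : K} (hβ : β ∈ walshSupport p m s f) :
    walsh p f β ≠ 0 := by
  intro h
  have h1 : ‖walsh p f β‖ ^ 2 = (p : ℝ) ^ (m + s) := hβ
  rw [h] at h1
  have : (p : ℝ) ≠ 0 := by exact_mod_cast (Fact.out (p := p.Prime)).ne_zero
  exact pow_ne_zero (m + s) this (by rw [← h1]; simp)

/-- Of the unknown unit `u` in the definition of weak regularity, a single non-zero Walsh value
shows that it is a sign times a `p`-th root of unity, which is absorbed in the dual function. -/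
theorem exists_isSignDual (hp4 : p % 4 = 1) {f : K → ZMod p}
    (hf : IsWeaklyRegularPlateaued p m s f) : ∃ ε fd, IsSignDual p m s f ε fd := by
  classical
  obtain ⟨hpl, u, r, -, -, hur⟩ := hf
  by_cases hS : ∃ β₀, β₀ ∈ walshSupport p m s f
  · obtain ⟨β₀, hβ₀⟩ := hS
    obtain ⟨n, hn⟩ := walsh_eq_sum f β₀
    obtain ⟨ε, d, hε, hd⟩ := eq_sign_mul_sqrt_pow hp4 n (m + s) (by rw [← hn]; exact hβ₀)
    refine ⟨ε, fun β => if β ∈ walshSupport p m s f then r β + d - r β₀ else 0, hε, ?_, ?_⟩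
    · intro β hβ
      have h1 := (hur β).resolve_left (walsh_ne_zero hβ)
      have h2 := (hur β₀).resolve_left (walsh_ne_zero hβ₀)
      rw [hn, hd] at h2
      have h3 : (ZMod.stdAddChar (r β₀) : ℂ) ≠ 0 := (AddChar.val_isUnit _ _).ne_zero
      beta_reduce
      rw [if_pos hβ, AddChar.map_sub_eq_div, AddChar.map_add_eq_mul, h1]
      field_simp
      linear_combination (-ZMod.stdAddChar (r β)) * h2
    · intro β hβ
      exact if_neg hβ
  -- if the Walsh support is empty, every sign will do
  · exact ⟨1, 0, Or.inl rfl, fun β hβ => absurd ⟨β, hβ⟩ hS, fun _ _ => rfl⟩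

end Walsh

/-! ### The distribution of the dual values -/

section DualCounts

variable {K : Type*} [Field K] [Fintype K] {p m s : ℕ} [Fact p.Prime] [Algebra (ZMod p) K]

lemma sum_stdAddChar_mul (b : ZMod p) :
    ∑ z : ZMod p, (ZMod.stdAddChar (z * b) : ℂ) = if b = 0 then (p : ℂ) else 0 := by
  rw [AddChar.sum_mulShift b (ZMod.isPrimitive_stdAddChar p)]
  split_ifs <;> simp

lemma sum_stdAddChar_trace_mul (hK : Fintype.card K = p ^ m) [DecidableEq K] (b : K) :
    ∑ β : K, (ZMod.stdAddChar (Algebra.trace (ZMod p) K (β * b)) : ℂ)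
      = if b = 0 then (p : ℂ) ^ m else 0 := by
  set χ : AddChar K ℂ :=
    (ZMod.stdAddChar (N := p)).compAddMonoidHom (Algebra.trace (ZMod p) K).toAddMonoidHom with hχ
  have hχa : ∀ x, χ x = ZMod.stdAddChar (Algebra.trace (ZMod p) K x) := fun _ => rfl
  have hne : χ ≠ 1 := by
    obtain ⟨x, hx⟩ := Algebra.trace_surjective (ZMod p) K 1
    intro h
    have h1 : χ x = 1 := by rw [h, AddChar.one_apply]
    rw [hχa, hx, ← AddChar.map_zero_eq_one (ZMod.stdAddChar (N := p))] at h1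
    exact one_ne_zero (ZMod.injective_stdAddChar h1)
  have := AddChar.sum_mulShift b (AddChar.IsPrimitive.of_ne_one hne)
  simp only [hχa] at this
  rw [this, hK]
  split_ifs <;> simp

lemma sum_walsh (hK : Fintype.card K = p ^ m) (f : K → ZMod p) :
    ∑ β, walsh p f β = (p : ℂ) ^ m * ZMod.stdAddChar (f 0) := by
  classical
  simp only [walsh]
  rw [Finset.sum_comm, Finset.sum_eq_single (0 : K)]
  · simp only [mul_zero, map_zero, sub_zero, Finset.sum_const, Finset.card_univ, hK, nsmul_eq_mul]
    push_cast; ring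
  · intro x _ hx
    simp only [sub_eq_add_neg, AddChar.map_add_eq_mul, ← map_neg (Algebra.trace (ZMod p) K),
      ← mul_neg]
    rw [← Finset.mul_sum, sum_stdAddChar_trace_mul hK, if_neg (neg_ne_zero.2 hx), mul_zero]
  · simp

/-- Parseval's identity. -/
lemma sum_norm_sq_walsh (hK : Fintype.card K = p ^ m) (f : K → ZMod p) :
    ∑ β, ‖walsh p f β‖ ^ 2 = (p : ℝ) ^ (2 * m) := by
  classical
  have h : ∑ β, walsh p f β * (starRingEnd ℂ) (walsh p f β) = (p : ℂ) ^ (2 * m) := by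
    have h1 : ∀ β, walsh p f β * (starRingEnd ℂ) (walsh p f β) = ∑ x : K, ∑ y : K,
        ZMod.stdAddChar (f x - f y) *
          ZMod.stdAddChar (Algebra.trace (ZMod p) K (β * (y - x))) := by
      intro β
      rw [walsh, map_sum, Finset.sum_mul_sum]
      refine Finset.sum_congr rfl fun x _ => Finset.sum_congr rfl fun y _ => ?_
      rw [← AddChar.map_neg_eq_conj, ← AddChar.map_add_eq_mul, ← AddChar.map_add_eq_mul,
        mul_sub, map_sub]
      congr 1; ring
    simp only [h1]
    rw [Finset.sum_comm]
    have h2 : ∀ x : K, ∑ β : K, ∑ y : K, (ZMod.stdAddChar (f x - f y) : ℂ) *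
        ZMod.stdAddChar (Algebra.trace (ZMod p) K (β * (y - x))) = (p : ℂ) ^ m := by
      intro x
      rw [Finset.sum_comm, Finset.sum_eq_single x]
      · rw [← Finset.mul_sum, sum_stdAddChar_trace_mul hK]
        simp
      · intro y _ hy
        rw [← Finset.mul_sum, sum_stdAddChar_trace_mul hK, if_neg (sub_ne_zero.2 hy), mul_zero]
      · simp
    simp only [h2, Finset.sum_const, Finset.card_univ, hK, nsmul_eq_mul]
    push_cast; ring
  simp only [Complex.mul_conj, Complex.normSq_eq_norm_sq] at h
  exact_mod_cast h

open scoped Classical in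
/-- The Walsh support as a `Finset`. -/
noncomputable def supportFinset (p m s : ℕ) [Fact p.Prime] [Algebra (ZMod p) K]
    (f : K → ZMod p) : Finset K :=
  Finset.univ.filter (· ∈ walshSupport p m s f)

lemma mem_supportFinset {f : K → ZMod p} {β : K} :
    β ∈ supportFinset p m s f ↔ β ∈ walshSupport p m s f := by
  simp [supportFinset]

/-- The size of the Walsh support, from Parseval's identity. -/
lemma IsPlateaued.card_support (hK : Fintype.card K = p ^ m) {f : K → ZMod p}
    (hf : IsPlateaued p m s f) : (supportFinset p m s f).card = p ^ (m - s) := by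
  have hp0 : (p : ℝ) ≠ 0 := by exact_mod_cast (Fact.out (p := p.Prime)).ne_zero
  have h1 := sum_norm_sq_walsh hK f
  have h2 : ∑ β, ‖walsh p f β‖ ^ 2 = ∑ β ∈ supportFinset p m s f, (p : ℝ) ^ (m + s) := by
    rw [supportFinset, Finset.sum_filter]
    refine Finset.sum_congr rfl fun β _ => ?_
    split_ifs with hβ
    · exact hβ
    · rw [hf.walsh_eq_zero hβ]; simp
  have h3 : (p : ℝ) ^ (2 * m) = (p : ℝ) ^ (m - s) * (p : ℝ) ^ (m + s) := by
    rw [← pow_add]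
    congr 1; have := hf.1; lia
  rw [h2, Finset.sum_const, nsmul_eq_mul, h3] at h1
  exact_mod_cast mul_right_cancel₀ (pow_ne_zero _ hp0) h1

lemma dualCount_eq_card [DecidableEq (ZMod p)] (f fd : K → ZMod p) (c : ZMod p) :
    dualCount p m s f fd c = ((supportFinset p m s f).filter fun β => fd β = c).card := by
  classical
  rw [dualCount, ← Set.ncard_coe_finset]
  congr 1
  ext β
  simp [mem_supportFinset]

/-- A sum over the Walsh support that depends on the dual function only. -/
lemma sum_support_eq {M : Type*} [AddCommMonoid M] (f fd : K → ZMod p) (G : ZMod p → M) :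
    ∑ β ∈ supportFinset p m s f, G (fd β) = ∑ c, dualCount p m s f fd c • G c := by
  rw [← Finset.sum_fiberwise_of_maps_to (s := supportFinset p m s f) (t := Finset.univ)
    (g := fd) (fun _ _ => Finset.mem_univ _)]
  refine Finset.sum_congr rfl fun c _ => ?_
  rw [dualCount_eq_card, ← Finset.sum_const]
  exact Finset.sum_congr rfl fun x hx => by rw [(Finset.mem_filter.1 hx).2]

lemma IsPlateaued.sum_dualCount (hK : Fintype.card K = p ^ m) {f : K → ZMod p}
    (hf : IsPlateaued p m s f) (fd : K → ZMod p) :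
    ∑ c, dualCount p m s f fd c = p ^ (m - s) := by
  have := sum_support_eq (p := p) (m := m) (s := s) f fd (fun _ => (1 : ℕ))
  simpa [hf.card_support hK] using this.symm

lemma sqrt_p_ne_zero : ((Real.sqrt p : ℝ) : ℂ) ≠ 0 := by
  have hp : (0 : ℝ) < p := by exact_mod_cast (Fact.out (p := p.Prime)).pos
  exact_mod_cast (Real.sqrt_pos.2 hp).ne'

lemma sqrt_p_sq {p : ℕ} : ((Real.sqrt p : ℝ) : ℂ) ^ 2 = p := by
  rw [← Complex.ofReal_pow, Real.sq_sqrt (Nat.cast_nonneg p), Complex.ofReal_natCast]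

/-- The values of the dual function form a sum of roots of unity equal to `ε √p ^ (m - s)`: this is
the inversion formula at `0`. -/
lemma sum_dualCount_mul_stdAddChar (hK : Fintype.card K = p ^ m) {f fd : K → ZMod p} {ε : ℤ}
    (hf : IsPlateaued p m s f) (hf0 : f 0 = 0) (hd : IsSignDual p m s f ε fd) :
    ∑ c, (dualCount p m s f fd c : ℂ) * ZMod.stdAddChar c
      = ε * ((Real.sqrt p : ℝ) : ℂ) ^ (m - s) := by
  have h1 := sum_support_eq (p := p) (m := m) (s := s) f fd (fun c => (ZMod.stdAddChar c : ℂ))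
  simp only [nsmul_eq_mul] at h1
  rw [← h1]
  have h2 : ∑ β, walsh p f β = ∑ β ∈ supportFinset p m s f,
      (ε : ℂ) * ((Real.sqrt p : ℝ) : ℂ) ^ (m + s) * ZMod.stdAddChar (fd β) := by
    rw [supportFinset, Finset.sum_filter]
    refine Finset.sum_congr rfl fun β _ => ?_
    split_ifs with hβ
    · exact hd.2.1 β hβ
    · exact hf.walsh_eq_zero hβ
  rw [sum_walsh hK, hf0, AddChar.map_zero_eq_one, mul_one, ← Finset.mul_sum] at h2
  have h3 : (p : ℂ) ^ m
      = ((Real.sqrt p : ℝ) : ℂ) ^ (m + s) * ((Real.sqrt p : ℝ) : ℂ) ^ (m - s) := by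
    rw [← sqrt_p_sq, ← pow_mul, ← pow_add]
    congr 1; have := hf.1; lia
  have hε : (ε : ℂ) * ε = 1 := by rcases hd.1 with h | h <;> simp [h]
  rw [h3] at h2
  apply mul_left_cancel₀ (pow_ne_zero (m + s) (sqrt_p_ne_zero (p := p)))
  linear_combination (-(ε : ℂ)) * h2 -
    (((Real.sqrt p : ℝ) : ℂ) ^ (m + s) * ∑ β ∈ supportFinset p m s f, ZMod.stdAddChar (fd β)) * hε

/-- For `m - s` even, `√p ^ (m - s)` is an integer, and comparison of coefficients in the inversion
formula shows that all non-zero values are taken equally often. -/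
lemma dualCount_of_even (hK : Fintype.card K = p ^ m) {f fd : K → ZMod p} {ε : ℤ}
    (hf : IsPlateaued p m s f) (hf0 : f 0 = 0) (hd : IsSignDual p m s f ε fd)
    {j : ℕ} (hj : m - s = 2 * j) {c : ZMod p} (hc : c ≠ 0) :
    (dualCount p m s f fd c : ℤ) = dualCount p m s f fd 0 - ε * p ^ j := by
  have h1 := sum_dualCount_mul_stdAddChar hK hf hf0 hd
  rw [hj, pow_mul, sqrt_p_sq] at h1
  have h2 : ∑ c : ZMod p, (((dualCount p m s f fd c : ℤ) -
      (if c = 0 then ε * p ^ j else 0) : ℤ) : ℂ) * ZMod.stdAddChar c = 0 := by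
    push_cast
    simp only [sub_mul, Finset.sum_sub_distrib, h1, ite_mul, zero_mul]
    simp
  have h3 := coeff_eq_of_sum_eq_zero h2 c
  rw [if_neg hc, if_pos rfl] at h3
  linarith

/-- For `m - s` odd, `√p ^ (m - s)` is an integer times the quadratic Gauss sum, and one compares
coefficients in the inversion formula. -/
lemma dualCount_of_odd (hp4 : p % 4 = 1) (hK : Fintype.card K = p ^ m) {f fd : K → ZMod p} {ε : ℤ}
    (hf : IsPlateaued p m s f) (hf0 : f 0 = 0) (hd : IsSignDual p m s f ε fd)
    {j : ℕ} (hj : m - s = 2 * j + 1) (c : ZMod p) :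
    (dualCount p m s f fd c : ℤ) = dualCount p m s f fd 0 + ε * p ^ j * eta p c := by
  have h1 := sum_dualCount_mul_stdAddChar hK hf hf0 hd
  rw [hj, pow_succ, pow_mul, sqrt_p_sq, ← gauss_sum_eq_sqrt hp4] at h1
  have h2 : ∑ c : ZMod p, (((dualCount p m s f fd c : ℤ) -
      ε * p ^ j * eta p c : ℤ) : ℂ) * ZMod.stdAddChar c = 0 := by
    push_cast
    simp only [sub_mul, Finset.sum_sub_distrib, h1, mul_assoc, ← Finset.mul_sum]
    ring
  have h3 := coeff_eq_of_sum_eq_zero h2 c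
  rw [eta_zero] at h3
  linarith

/-- The number of zeros of the dual function, for `m - s` even. -/
lemma dualCount_zero_of_even (hK : Fintype.card K = p ^ m) {f fd : K → ZMod p} {ε : ℤ}
    (hf : IsPlateaued p m s f) (hf0 : f 0 = 0) (hd : IsSignDual p m s f ε fd)
    {j : ℕ} (hj : m - s = 2 * j) :
    (p : ℤ) * dualCount p m s f fd 0 = p ^ (2 * j) + (p - 1) * (ε * p ^ j) := by
  have h := hf.sum_dualCount hK fd
  rw [← Finset.add_sum_erase _ _ (Finset.mem_univ (0 : ZMod p)), hj] at h
  have h2 : ((∑ c ∈ Finset.univ.erase (0 : ZMod p), dualCount p m s f fd c : ℕ) : ℤ)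
      = (p - 1) * (dualCount p m s f fd 0 - ε * p ^ j) := by
    push_cast
    rw [Finset.sum_congr rfl (g := fun _ => (dualCount p m s f fd 0 - ε * p ^ j : ℤ))
      fun c hc => dualCount_of_even hK hf hf0 hd hj (Finset.ne_of_mem_erase hc)]
    rw [Finset.sum_const, Finset.card_erase_of_mem (Finset.mem_univ _), Finset.card_univ,
      ZMod.card, nsmul_eq_mul, Nat.cast_sub (Fact.out (p := p.Prime)).one_le]
    simp
  have h3 := congrArg (Nat.cast : ℕ → ℤ) h
  rw [Nat.cast_add, h2] at h3
  push_cast at h3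
  linear_combination h3

/-- The number of zeros of the dual function, for `m - s` odd. -/
lemma dualCount_zero_of_odd (hp4 : p % 4 = 1) (hK : Fintype.card K = p ^ m) {f fd : K → ZMod p}
    {ε : ℤ} (hf : IsPlateaued p m s f) (hf0 : f 0 = 0) (hd : IsSignDual p m s f ε fd)
    {j : ℕ} (hj : m - s = 2 * j + 1) : dualCount p m s f fd 0 = p ^ (2 * j) := by
  have h := congrArg (Nat.cast : ℕ → ℤ) (hf.sum_dualCount hK fd)
  push_cast at h
  rw [Finset.sum_congr rfl fun c _ => dualCount_of_odd hp4 hK hf hf0 hd hj c] at h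
  simp only [Finset.sum_add_distrib, ← Finset.mul_sum, sum_eta hp4, hj] at h
  simp only [Finset.sum_const, Finset.card_univ, ZMod.card, mul_zero, add_zero, nsmul_eq_mul,
    pow_succ (p : ℤ) (2 * j)] at h
  have hp0 : (p : ℤ) ≠ 0 := by exact_mod_cast (Fact.out (p := p.Prime)).ne_zero
  rw [mul_comm _ (p : ℤ)] at h
  exact_mod_cast mul_left_cancel₀ hp0 h

/-- The closed form of the numbers of values of the dual function. -/
theorem dualCount_eq_formula (hp4 : p % 4 = 1) (hK : Fintype.card K = p ^ m) {f fd : K → ZMod p}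
    {ε : ℤ} (hf : IsPlateaued p m s f) (hf0 : f 0 = 0) (hd : IsSignDual p m s f ε fd)
    (c : ZMod p) :
    (dualCount p m s f fd c : ℝ) = dualCountFormula p ((m : ℤ) - s) ε c := by
  have hp0 : (p : ℝ) ≠ 0 := by exact_mod_cast (Fact.out (p := p.Prime)).ne_zero
  have hr2 : Real.sqrt p ^ (2 : ℤ) = (p : ℝ) := by
    rw [zpow_ofNat, Real.sq_sqrt (Nat.cast_nonneg p)]
  have hk : ((m : ℤ) - s) = ((m - s : ℕ) : ℤ) := by rw [Nat.cast_sub hf.1]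
  rw [hk, dualCountFormula]
  rcases Nat.even_or_odd' (m - s) with ⟨j, hj | hj⟩
  · have he : Even (((m - s : ℕ) : ℤ)) := by rw [hj]; simp
    have e1 : (p : ℝ) ^ (((m - s : ℕ) : ℤ) - 1) = (p : ℝ) ^ (2 * j) / p := by
      rw [zpow_sub₀ hp0, zpow_natCast, zpow_one, hj]
    have e2 : Real.sqrt p ^ (((m - s : ℕ) : ℤ) - 2) = (p : ℝ) ^ j / p := by
      rw [show ((m - s : ℕ) : ℤ) - 2 = 2 * ((j : ℤ) - 1) by rw [hj]; push_cast; ring, zpow_mul, hr2,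
        zpow_sub₀ hp0, zpow_natCast, zpow_one]
    have h0 := dualCount_zero_of_even hK hf hf0 hd hj
    have h0' : (p : ℝ) * dualCount p m s f fd 0 = p ^ (2 * j) + (p - 1) * (ε * p ^ j) := by
      exact_mod_cast h0
    rw [if_pos he, e1, e2]
    split_ifs with hc
    · subst hc
      field_simp
      linear_combination h0'
    · have h1 := dualCount_of_even hK hf hf0 hd hj hc
      have h1' : (dualCount p m s f fd c : ℝ) = dualCount p m s f fd 0 - ε * p ^ j := by
        exact_mod_cast h1
      rw [h1']
      field_simp
      linear_combination h0'
  · have ho : ¬ Even (((m - s : ℕ) : ℤ)) := by rw [hj, Int.not_even_iff_odd]; simp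
    have e1 : (p : ℝ) ^ (((m - s : ℕ) : ℤ) - 1) = (p : ℝ) ^ (2 * j) := by
      rw [show ((m - s : ℕ) : ℤ) - 1 = ((2 * j : ℕ) : ℤ) by rw [hj]; push_cast; ring, zpow_natCast]
    have e2 : Real.sqrt p ^ (((m - s : ℕ) : ℤ) - 1) = (p : ℝ) ^ j := by
      rw [show ((m - s : ℕ) : ℤ) - 1 = 2 * (j : ℤ) by rw [hj]; push_cast; ring, zpow_mul, hr2,
        zpow_natCast]
    have h0 := dualCount_zero_of_odd hp4 hK hf hf0 hd hj
    rw [if_neg ho, e1, e2]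
    split_ifs with hc
    · subst hc
      rw [h0]; push_cast; ring
    · have h1 := dualCount_of_odd hp4 hK hf hf0 hd hj c
      rw [h0] at h1
      have h1' : (dualCount p m s f fd c : ℝ) = ((p ^ (2 * j) : ℕ) : ℝ) + ε * p ^ j * eta p c := by
        exact_mod_cast h1
      rw [h1']; push_cast; ring

lemma IsHomogeneous.even {K : Type*} [Field K] [Algebra (ZMod p) K] {f : K → ZMod p}
    (hf : IsHomogeneous p f) (x : K) : f (-x) = f x := by
  obtain ⟨-, h, -, h2, -, hz⟩ := hf
  have := hz (-1) x (neg_ne_zero.2 one_ne_zero)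
  rwa [neg_smul, one_smul, (even_iff_two_dvd.2 h2).neg_one_pow, one_mul] at this

lemma walsh_neg {f : K → ZMod p} (hf : ∀ x, f (-x) = f x) (β : K) :
    walsh p f (-β) = walsh p f β := by
  rw [walsh, walsh]
  refine Fintype.sum_equiv (Equiv.neg K) _ _ fun x => ?_
  rw [Equiv.neg_apply, hf, mul_neg, neg_mul]

lemma even_card_of_neg_mem {K : Type*} [Field K] [Algebra (ZMod p) K] (hp4 : p % 4 = 1)
    {A : Finset K} (h : ∀ x ∈ A, -x ∈ A) (h0 : (0 : K) ∉ A) : Even A.card := by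
  have : CharP K p := charP_of_injective_algebraMap (algebraMap (ZMod p) K).injective p
  have h2 : ringChar K ≠ 2 := by
    rw [ringChar.eq K p]; lia
  have h1 : ∑ x ∈ A, (1 : ZMod 2) = 0 := by
    refine Finset.sum_involution (fun x _ => -x) (fun _ _ => by decide) ?_ h (fun _ _ => neg_neg _)
    intro x hx _ hne
    exact h0 ((Ring.eq_self_iff_eq_zero_of_char_ne_two h2).1 hne ▸ hx)
  rw [Finset.sum_const, nsmul_one, ZMod.natCast_eq_zero_iff] at h1
  exact even_iff_two_dvd.2 h1

/-- The Walsh support is closed under negation and has odd cardinality. So it contains `0`; in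
particular a homogeneous plateaued function is never balanced. -/
lemma zero_mem_walshSupport (hp4 : p % 4 = 1) (hK : Fintype.card K = p ^ m) {f : K → ZMod p}
    (hf : IsPlateaued p m s f) (hev : ∀ x, f (-x) = f x) : (0 : K) ∈ walshSupport p m s f := by
  by_contra h0
  have h1 : Even (supportFinset p m s f).card := by
    refine even_card_of_neg_mem hp4 (fun x hx => ?_) (fun h => h0 (mem_supportFinset.1 h))
    rw [mem_supportFinset] at hx ⊢
    have : ‖walsh p f x‖ ^ 2 = (p : ℝ) ^ (m + s) := hx
    rwa [← walsh_neg hev] at this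
  rw [hf.card_support hK] at h1
  have hpodd : Odd p := by rw [Nat.odd_iff]; lia
  exact (Nat.not_even_iff_odd.2 (hpodd.pow (n := m - s))) h1

lemma odd_dualCount_zero (hp4 : p % 4 = 1) (hK : Fintype.card K = p ^ m) {f fd : K → ZMod p}
    {ε : ℤ} (hf : IsPlateaued p m s f) (hf0 : f 0 = 0) (hd : IsSignDual p m s f ε fd) :
    Odd (dualCount p m s f fd 0) := by
  have hpodd : Odd (p : ℤ) := by rw [Int.odd_iff]; lia
  rcases Nat.even_or_odd' (m - s) with ⟨j, hj | hj⟩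
  · have h := dualCount_zero_of_even hK hf hf0 hd hj
    have h1 : Odd ((p : ℤ) * dualCount p m s f fd 0) := by
      rw [h]
      exact (hpodd.pow).add_even ((hpodd.sub_odd odd_one).mul_right _)
    exact_mod_cast (Int.odd_mul.1 h1).2
  · rw [dualCount_zero_of_odd hp4 hK hf hf0 hd hj]
    exact_mod_cast hpodd.pow (n := 2 * j)

/-- The dual function vanishes at `0`: a non-zero value would be taken an odd number of times
there, and `0` an even number of times. -/
lemma dual_zero_eq_zero (hp4 : p % 4 = 1) (hK : Fintype.card K = p ^ m) {f fd : K → ZMod p}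
    {ε : ℤ} (hf : IsPlateaued p m s f) (hf0 : f 0 = 0) (hev : ∀ x, f (-x) = f x)
    (hd : IsSignDual p m s f ε fd) : fd 0 = 0 := by
  by_contra h0
  have hneg : ∀ β ∈ walshSupport p m s f, -β ∈ walshSupport p m s f ∧ fd (-β) = fd β := by
    intro β hβ
    have h1 : -β ∈ walshSupport p m s f := by
      have : ‖walsh p f β‖ ^ 2 = (p : ℝ) ^ (m + s) := hβ
      rwa [← walsh_neg hev] at this
    refine ⟨h1, ?_⟩
    have h2 := hd.2.1 β hβ
    rw [← walsh_neg hev, hd.2.1 _ h1] at h2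
    have hε : (ε : ℂ) ≠ 0 := by rcases hd.1 with h | h <;> simp [h]
    exact ZMod.injective_stdAddChar
      (mul_left_cancel₀ (mul_ne_zero hε (pow_ne_zero _ sqrt_p_ne_zero)) h2)
  have h1 : Even (dualCount p m s f fd 0) := by
    rw [dualCount_eq_card]
    refine even_card_of_neg_mem hp4 (fun x hx => ?_) (fun h => h0 (Finset.mem_filter.1 h).2)
    rw [Finset.mem_filter, mem_supportFinset] at hx ⊢
    exact ⟨(hneg x hx.1).1, (hneg x hx.1).2.trans hx.2⟩
  exact (Nat.not_even_iff_odd.2 (odd_dualCount_zero hp4 hK hf hf0 hd)) h1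

end DualCounts

/-! ### Weights of codewords -/

section Weights

variable {K : Type*} [Field K] [Fintype K] {p m s t : ℕ} [Fact p.Prime] [Algebra (ZMod p) K]

/-- What the weights of the codewords depend on: `f` is an even `s`-plateaued function with
`f 0 = 0`, sign `ε` and dual function `fd`, its Walsh support is stable under `𝔽_p^*`, and `fd` is
homogeneous of degree `l` on it. -/
structure HasDual (p m s : ℕ) [Fact p.Prime] [Algebra (ZMod p) K] (f : K → ZMod p) (ε : ℤ)
    (fd : K → ZMod p) (l : ℕ) : Prop where
  plateaued : IsPlateaued p m s f
  map_zero : f 0 = 0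
  even : ∀ x, f (-x) = f x
  signDual : IsSignDual p m s f ε fd
  smul_mem : ∀ z : ZMod p, z ≠ 0 → ∀ β ∈ walshSupport p m s f, z • β ∈ walshSupport p m s f
  pos : 0 < l
  dual_smul : ∀ z : ZMod p, z ≠ 0 → ∀ β ∈ walshSupport p m s f, fd (z • β) = z ^ l * fd β

/-- The Walsh support of a homogeneous function is stable under `𝔽_p^*`: the Walsh values at `β`
and at `z β` vanish together, because `z = v ^ (h - 1)` for some `v`, and the substitution
`x ↦ v x` turns the one sum into a Galois conjugate of the other. -/
lemma smul_mem_walshSupport {f : K → ZMod p} (hf : IsPlateaued p m s f)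
    (hh : IsHomogeneous p f) {z : ZMod p} (hz : z ≠ 0) {β : K} (hβ : β ∈ walshSupport p m s f) :
    z • β ∈ walshSupport p m s f := by
  by_contra hn
  have h0 := hf.walsh_eq_zero hn
  obtain ⟨-, h, hpos, -, hg, hfz⟩ := hh
  obtain ⟨v, hv0, hv⟩ : ∃ v : ZMod p, v ≠ 0 ∧ v ^ (h - 1) = z := by
    have hc : (Nat.card (ZMod p)ˣ).Coprime (h - 1) := by
      rw [Nat.card_eq_fintype_card, ZMod.card_units]
      exact Nat.Coprime.symm hg
    obtain ⟨w, hw⟩ := (powCoprime hc).surjective (Units.mk0 z hz)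
    refine ⟨w, w.ne_zero, ?_⟩
    have := congrArg Units.val hw
    simpa [powCoprime] using this
  refine walsh_ne_zero hβ ?_
  have hvh : v ^ h ≠ 0 := pow_ne_zero _ hv0
  have h1 : ∑ x : K, (ZMod.stdAddChar (v ^ h * (f x - Algebra.trace (ZMod p) K (β * x))) : ℂ)
      = 0 := by
    rw [← h0, walsh]
    refine Fintype.sum_equiv (MulAction.toPerm (Units.mk0 v hv0) : K ≃ K) _ _ fun x => ?_
    have e1 : (MulAction.toPerm (Units.mk0 v hv0) : K ≃ K) x = v • x := rfl
    rw [e1, hfz v x hv0, smul_mul_smul_comm, map_smul, ← hv, ← pow_succ,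
      Nat.sub_add_cancel hpos, smul_eq_mul, mul_sub]
  -- conjugate back by the inverse of `v ^ h`
  have h2 : ∀ P : Polynomial ℤ, Polynomial.aeval (ZMod.stdAddChar (v ^ h)) P = 0 →
      Polynomial.aeval (ZMod.stdAddChar (1 : ZMod p)) P = 0 := by
    intro P hP
    have h3 : Polynomial.aeval (ZMod.stdAddChar (1 : ZMod p))
        (Polynomial.expand ℤ (v ^ h).val P) = 0 := by
      rw [Polynomial.expand_aeval, stdAddChar_pow_val, one_mul, hP]
    have h4 := aeval_stdAddChar_eq_zero h3 (inv_ne_zero hvh)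
    rwa [Polynomial.expand_aeval, stdAddChar_pow_val, inv_mul_cancel₀ hvh] at h4
  have h5 := h2 (∑ x : K, Polynomial.X ^ (f x - Algebra.trace (ZMod p) K (β * x)).val) (by
    rw [map_sum, ← h1]
    refine Finset.sum_congr rfl fun x _ => ?_
    rw [map_pow, Polynomial.aeval_X, stdAddChar_pow_val])
  rw [map_sum] at h5
  rw [walsh, ← h5]
  refine Finset.sum_congr rfl fun x _ => ?_
  rw [map_pow, Polynomial.aeval_X, stdAddChar_pow_val, one_mul]

lemma HasDual.of_homogeneous {f : K → ZMod p}
    (hf : IsWeaklyRegularPlateaued p m s f) (hh : IsHomogeneous p f) {ε : ℤ} {fd : K → ZMod p}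
    (hd : IsSignDual p m s f ε fd) {l : ℕ} (hl : IsIndex p m s f fd l) :
    HasDual p m s f ε fd l where
  plateaued := hf.1
  map_zero := hh.1
  even := hh.even
  signDual := hd
  smul_mem _ hz _ hβ := smul_mem_walshSupport hf.1 hh hz hβ
  pos := hl.1
  dual_smul := hl.2.2.2

variable {f g : K → ZMod p} {εf εg : ℤ} {fd gd : K → ZMod p} {k l : ℕ}

lemma HasDual.smul_mem_iff (hf : HasDual p m s f εf fd k) {z : ZMod p} (hz : z ≠ 0) {β : K} :
    z • β ∈ walshSupport p m s f ↔ β ∈ walshSupport p m s f := by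
  refine ⟨fun h => ?_, hf.smul_mem z hz β⟩
  have := hf.smul_mem z⁻¹ (inv_ne_zero hz) _ h
  rwa [inv_smul_smul₀ hz] at this

/-- The sum `∑_c η(c ^ k u + c ^ l v)`, on which the weight of a codeword depends. -/
noncomputable def pairSum (p : ℕ) [Fact p.Prime] (k l : ℕ) (u v : ZMod p) : ℤ :=
  ∑ c : ZMod p, eta p (c ^ k * u + c ^ l * v)

/-- The Galois conjugate by `z` of the Walsh value of `f` at `β`. -/
noncomputable def conjWalsh (p : ℕ) [Fact p.Prime] [Algebra (ZMod p) K] (f : K → ZMod p)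
    (z : ZMod p) (β : K) : ℂ :=
  ∑ x : K, ZMod.stdAddChar (z * (f x - Algebra.trace (ZMod p) K (β * x)))

lemma HasDual.conjWalsh_eq (hp4 : p % 4 = 1) (hf : HasDual p m s f εf fd k) {z : ZMod p}
    (hz : z ≠ 0) {β : K} (hβ : β ∈ walshSupport p m s f) :
    conjWalsh p f z β
      = (εf : ℂ) * (eta p z * ((Real.sqrt p : ℝ) : ℂ)) ^ (m + s) * ZMod.stdAddChar (z * fd β) :=
  sum_stdAddChar_mul_of_eq hp4 (hf.signDual.2.1 β hβ) hz

lemma HasDual.conjWalsh_eq_zero (hp4 : p % 4 = 1) (hf : HasDual p m s f εf fd k) {z : ZMod p}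
    (hz : z ≠ 0) {β : K} (hβ : β ∉ walshSupport p m s f) : conjWalsh p f z β = 0 :=
  sum_stdAddChar_mul_of_eq_zero hp4 (hf.plateaued.walsh_eq_zero hβ) hz

/-- As `s + t` is odd, the sum over all conjugates is a quadratic Gauss sum. -/
lemma sum_conjWalsh_mul (hp4 : p % 4 = 1) (hodd : Odd (s + t)) (hf : HasDual p m s f εf fd k)
    (hg : HasDual p m t g εg gd l) {a b : K} (ha : a ∈ walshSupport p m s f)
    (hb : b ∈ walshSupport p m t g) :
    ∑ z ∈ Finset.univ.erase (0 : ZMod p), conjWalsh p f z a * conjWalsh p g z b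
      = (εf * εg * eta p (fd a + gd b) : ℤ) * ((Real.sqrt p : ℝ) : ℂ) ^ (2 * m + s + t + 1) := by
  have h1 : ∀ z ∈ Finset.univ.erase (0 : ZMod p), conjWalsh p f z a * conjWalsh p g z b
      = (εf * εg : ℂ) * ((Real.sqrt p : ℝ) : ℂ) ^ (2 * m + s + t) *
        ((eta p z : ℂ) * ZMod.stdAddChar (z * (fd a + gd b))) := by
    intro z hz
    have hz := Finset.ne_of_mem_erase hz
    rw [hf.conjWalsh_eq hp4 hz ha, hg.conjWalsh_eq hp4 hz hb, mul_add, AddChar.map_add_eq_mul]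
    have h2 : (eta p z : ℂ) ^ (m + s + (m + t)) = eta p z := by
      have h3 : eta p z ^ (m + s + (m + t)) = eta p z := by
        obtain ⟨j, hj⟩ := hodd
        rw [show m + s + (m + t) = 2 * (m + j) + 1 by lia, pow_succ, pow_mul, eta_sq hz, one_pow,
          one_mul]
      exact_mod_cast h3
    rw [mul_pow, mul_pow]
    calc _ = (εf * εg : ℂ) * ((Real.sqrt p : ℝ) : ℂ) ^ (2 * m + s + t) *
        ((eta p z : ℂ) ^ (m + s + (m + t)) *
          (ZMod.stdAddChar (z * fd a) * ZMod.stdAddChar (z * gd b))) := by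
          rw [show 2 * m + s + t = (m + s) + (m + t) by lia, pow_add, pow_add]; ring
      _ = _ := by rw [h2]
  rw [Finset.sum_congr rfl h1, ← Finset.mul_sum]
  have h4 := gauss_sum_mul hp4 (fd a + gd b)
  rw [← Finset.add_sum_erase _ _ (Finset.mem_univ (0 : ZMod p)), eta_zero, Int.cast_zero, zero_mul,
    zero_add] at h4
  rw [h4, pow_succ]
  push_cast; ring

lemma sum_conjWalsh_mul_eq_zero (hp4 : p % 4 = 1) (hf : HasDual p m s f εf fd k)
    (hg : HasDual p m t g εg gd l) {a b : K}
    (hab : ¬ (a ∈ walshSupport p m s f ∧ b ∈ walshSupport p m t g)) :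
    ∑ z ∈ Finset.univ.erase (0 : ZMod p), conjWalsh p f z a * conjWalsh p g z b = 0 := by
  refine Finset.sum_eq_zero fun z hz => ?_
  have hz := Finset.ne_of_mem_erase hz
  rw [not_and_or] at hab
  rcases hab with h | h
  · rw [hf.conjWalsh_eq_zero hp4 hz h, zero_mul]
  · rw [hg.conjWalsh_eq_zero hp4 hz h, mul_zero]

lemma HasDual.zero_mem (hp4 : p % 4 = 1) (hK : Fintype.card K = p ^ m)
    (hf : HasDual p m s f εf fd k) : (0 : K) ∈ walshSupport p m s f :=
  zero_mem_walshSupport hp4 hK hf.plateaued hf.even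

lemma HasDual.dual_zero (hp4 : p % 4 = 1) (hK : Fintype.card K = p ^ m)
    (hf : HasDual p m s f εf fd k) : fd 0 = 0 :=
  dual_zero_eq_zero hp4 hK hf.plateaued hf.map_zero hf.even hf.signDual

lemma sum_conjWalsh_mul_zero (hp4 : p % 4 = 1) (hK : Fintype.card K = p ^ m) (hodd : Odd (s + t))
    (hf : HasDual p m s f εf fd k) (hg : HasDual p m t g εg gd l) :
    ∑ z ∈ Finset.univ.erase (0 : ZMod p), conjWalsh p f z 0 * conjWalsh p g z 0 = 0 := by
  rw [sum_conjWalsh_mul hp4 hodd hf hg (hf.zero_mem hp4 hK) (hg.zero_mem hp4 hK),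
    hf.dual_zero hp4 hK, hg.dual_zero hp4 hK, add_zero, eta_zero]
  simp

lemma indicator_eq_sum (e : ZMod p) :
    (p : ℂ) * (if e = 0 then 1 else 0) = ∑ z : ZMod p, ZMod.stdAddChar (z * e) := by
  rw [sum_stdAddChar_mul]; split_ifs <;> simp

open scoped Classical in
/-- The number of zeros of `f x + g y` on `K × K`. -/
lemma card_zeros (hp4 : p % 4 = 1) (hK : Fintype.card K = p ^ m) (hodd : Odd (s + t))
    (hf : HasDual p m s f εf fd k) (hg : HasDual p m t g εg gd l) :
    p * (Finset.univ.filter fun xy : K × K => f xy.1 + g xy.2 = 0).card = p ^ (2 * m) := by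
  have h : (p : ℂ) * (Finset.univ.filter fun xy : K × K => f xy.1 + g xy.2 = 0).card
      = (p : ℂ) ^ (2 * m) := by
    rw [Finset.card_filter]
    push_cast
    rw [Finset.mul_sum]
    simp only [indicator_eq_sum]
    rw [Finset.sum_comm, ← Finset.add_sum_erase _ _ (Finset.mem_univ (0 : ZMod p))]
    have h1 : ∀ z : ZMod p, ∑ xy : K × K, (ZMod.stdAddChar (z * (f xy.1 + g xy.2)) : ℂ)
        = conjWalsh p f z 0 * conjWalsh p g z 0 := by
      intro z
      rw [conjWalsh, conjWalsh, Finset.sum_mul_sum, Fintype.sum_prod_type]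
      simp only [zero_mul, map_zero, sub_zero, mul_add, AddChar.map_add_eq_mul]
    rw [Finset.sum_congr rfl fun z _ => h1 z, sum_conjWalsh_mul_zero hp4 hK hodd hf hg]
    simp [hK]
    ring
  exact_mod_cast h

open scoped Classical in
/-- The number of zeros of `f x + g y` on the hyperplane `Tr (a x + b y) = 0`. -/
lemma card_zeros_hyperplane (hK : Fintype.card K = p ^ m) {a b : K}
    (hab : (a, b) ≠ (0, 0)) :
    (p : ℂ) ^ 2 * (Finset.univ.filter fun xy : K × K => f xy.1 + g xy.2 = 0 ∧
        Algebra.trace (ZMod p) K (a * xy.1 + b * xy.2) = 0).card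
      = (p : ℂ) ^ (2 * m) + ∑ c : ZMod p, ∑ z ∈ Finset.univ.erase (0 : ZMod p),
          conjWalsh p f z (c • a) * conjWalsh p g z (c • b) := by
  rw [Finset.card_filter]
  push_cast
  rw [Finset.mul_sum]
  have h1 : ∀ xy : K × K, (p : ℂ) ^ 2 * (if f xy.1 + g xy.2 = 0 ∧
        Algebra.trace (ZMod p) K (a * xy.1 + b * xy.2) = 0 then 1 else 0)
      = ∑ z : ZMod p, ∑ w : ZMod p, ZMod.stdAddChar (z * (f xy.1 + g xy.2)) *
          ZMod.stdAddChar (w * Algebra.trace (ZMod p) K (a * xy.1 + b * xy.2)) := by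
    intro xy
    rw [← Finset.sum_mul_sum, ← indicator_eq_sum, ← indicator_eq_sum]
    split_ifs with h h1 h2 <;> simp_all
    ring
  simp only [h1]
  rw [Finset.sum_comm, ← Finset.add_sum_erase _ _ (Finset.mem_univ (0 : ZMod p))]
  congr 1
  · simp only [zero_mul, AddChar.map_zero_eq_one, one_mul]
    rw [Finset.sum_comm, Finset.sum_eq_single (0 : ZMod p)]
    · simp [hK]
      ring
    · intro w _ hw
      have h2 : ∀ xy : K × K,
          (ZMod.stdAddChar (w * Algebra.trace (ZMod p) K (a * xy.1 + b * xy.2)) : ℂ)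
          = ZMod.stdAddChar (Algebra.trace (ZMod p) K (xy.1 * (w • a))) *
            ZMod.stdAddChar (Algebra.trace (ZMod p) K (xy.2 * (w • b))) := by
        intro xy
        rw [← AddChar.map_add_eq_mul, ← map_add, ← smul_eq_mul, ← map_smul]
        congr 2
        rw [smul_add, mul_smul_comm, mul_smul_comm, mul_comm a, mul_comm b]
      simp only [h2]
      rw [Fintype.sum_prod_type]
      dsimp only
      rw [← Finset.sum_mul_sum, sum_stdAddChar_trace_mul hK,
        sum_stdAddChar_trace_mul hK]
      by_cases ha : a = 0
      · have hb : b ≠ 0 := fun hb => hab (by rw [ha, hb])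
        rw [if_neg (smul_ne_zero hw hb), mul_zero]
      · rw [if_neg (smul_ne_zero hw ha), zero_mul]
    · simp
  · rw [Finset.sum_comm (s := (Finset.univ : Finset (ZMod p)))
      (t := Finset.univ.erase (0 : ZMod p))]
    refine Finset.sum_congr rfl fun z hz => ?_
    have hz := Finset.ne_of_mem_erase hz
    rw [Finset.sum_comm]
    -- the substitution `w = - z c`
    refine Fintype.sum_equiv ((Equiv.mulLeft₀ (-z)⁻¹ (inv_ne_zero (neg_ne_zero.2 hz)))) _ _
      fun w => ?_
    rw [conjWalsh, conjWalsh, Finset.sum_mul_sum, Fintype.sum_prod_type]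
    refine Finset.sum_congr rfl fun x _ => Finset.sum_congr rfl fun y _ => ?_
    rw [← AddChar.map_add_eq_mul, ← AddChar.map_add_eq_mul]
    congr 1
    simp only [Equiv.mulLeft₀_apply, smul_mul_assoc, map_smul, map_add, smul_eq_mul]
    field_simp
    ring

open scoped Classical in
lemma card_definingSet_add_one {K : Type*} [Field K] [Fintype K] {f g : K → ZMod p}
    (hf0 : f 0 = 0) (hg0 : g 0 = 0) :
    (definingSet p f g).card + 1
      = (Finset.univ.filter fun xy : K × K => f xy.1 + g xy.2 = 0).card := by
  have h : definingSet p f g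
      = (Finset.univ.filter fun xy : K × K => f xy.1 + g xy.2 = 0).erase (0, 0) := by
    ext xy
    simp [definingSet]
  rw [h, Finset.card_erase_add_one]
  simp [hf0, hg0]

open scoped Classical in
/-- The zeros of `f x + g y` are split by the hyperplane of the codeword; the point `(0, 0)`, which
is missing from the defining set, lies on the hyperplane. -/
lemma hammingNorm_codewordMap (f g : K → ZMod p) (a b : K) :
    hammingNorm (codewordMap p (definingSet p f g) (a, b)) +
      (Finset.univ.filter fun xy : K × K => f xy.1 + g xy.2 = 0 ∧
        Algebra.trace (ZMod p) K (a * xy.1 + b * xy.2) = 0).card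
      = (Finset.univ.filter fun xy : K × K => f xy.1 + g xy.2 = 0).card := by
  have h1 : hammingNorm (codewordMap p (definingSet p f g) (a, b))
      = (Finset.univ.filter fun xy : K × K => f xy.1 + g xy.2 = 0 ∧
        ¬ Algebra.trace (ZMod p) K (a * xy.1 + b * xy.2) = 0).card := by
    refine Finset.card_bij (fun d _ => d.1) ?_ ?_ ?_
    · rintro ⟨d, hd⟩ hd'
      rw [Finset.mem_filter] at hd'
      simp only [definingSet, Finset.mem_filter] at hd
      exact Finset.mem_filter.2 ⟨Finset.mem_univ _, hd.2.2, hd'.2⟩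
    · intro d _ d' _ h
      exact Subtype.ext h
    · intro xy hxy
      rw [Finset.mem_filter] at hxy
      refine ⟨⟨xy, ?_⟩, Finset.mem_filter.2 ⟨Finset.mem_univ _, hxy.2.2⟩, rfl⟩
      refine Finset.mem_filter.2 ⟨Finset.mem_univ _, fun h0 => hxy.2.2 ?_, hxy.2.1⟩
      rw [h0]; simp
  rw [h1, ← Finset.filter_filter, ← Finset.filter_filter, add_comm,
    Finset.card_filter_add_card_filter_not]

/-- The length of the code. -/
lemma card_definingSet (hp4 : p % 4 = 1) (hm : 2 ≤ m) (hK : Fintype.card K = p ^ m)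
    (hodd : Odd (s + t)) (hf : HasDual p m s f εf fd k) (hg : HasDual p m t g εg gd l) :
    (definingSet p f g).card = p ^ (2 * m - 1) - 1 := by
  classical
  have h1 := card_zeros hp4 hK hodd hf hg
  rw [← card_definingSet_add_one hf.map_zero hg.map_zero] at h1
  have h2 : p ^ (2 * m) = p * p ^ (2 * m - 1) := by
    rw [← pow_succ']; congr 1; lia
  rw [h2] at h1
  have := Nat.eq_of_mul_eq_mul_left (NeZero.pos p) h1
  lia

/-- The sums over the multiples of a point of the Walsh supports. -/
lemma sum_smul_of_mem (hp4 : p % 4 = 1) (hK : Fintype.card K = p ^ m) (hodd : Odd (s + t))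
    (hf : HasDual p m s f εf fd k) (hg : HasDual p m t g εg gd l) {a b : K}
    (ha : a ∈ walshSupport p m s f) (hb : b ∈ walshSupport p m t g) :
    ∑ c : ZMod p, ∑ z ∈ Finset.univ.erase (0 : ZMod p),
        conjWalsh p f z (c • a) * conjWalsh p g z (c • b)
      = (εf * εg * pairSum p k l (fd a) (gd b) : ℤ) *
          ((Real.sqrt p : ℝ) : ℂ) ^ (2 * m + s + t + 1) := by
  have h : ∀ c : ZMod p, ∑ z ∈ Finset.univ.erase (0 : ZMod p),
        conjWalsh p f z (c • a) * conjWalsh p g z (c • b)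
      = (εf * εg * eta p (c ^ k * fd a + c ^ l * gd b) : ℤ) *
          ((Real.sqrt p : ℝ) : ℂ) ^ (2 * m + s + t + 1) := by
    intro c
    by_cases hc : c = 0
    · rw [hc, zero_smul, zero_smul, sum_conjWalsh_mul_zero hp4 hK hodd hf hg,
        zero_pow hf.pos.ne', zero_pow hg.pos.ne']
      simp [eta_zero]
    · rw [sum_conjWalsh_mul hp4 hodd hf hg (hf.smul_mem c hc a ha) (hg.smul_mem c hc b hb),
        hf.dual_smul c hc a ha, hg.dual_smul c hc b hb]
  rw [Finset.sum_congr rfl fun c _ => h c, ← Finset.sum_mul, pairSum, Finset.mul_sum]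
  push_cast
  rfl

lemma sum_smul_of_not_mem (hp4 : p % 4 = 1) (hK : Fintype.card K = p ^ m) (hodd : Odd (s + t))
    (hf : HasDual p m s f εf fd k) (hg : HasDual p m t g εg gd l) {a b : K}
    (hab : ¬ (a ∈ walshSupport p m s f ∧ b ∈ walshSupport p m t g)) :
    ∑ c : ZMod p, ∑ z ∈ Finset.univ.erase (0 : ZMod p),
        conjWalsh p f z (c • a) * conjWalsh p g z (c • b) = 0 := by
  refine Finset.sum_eq_zero fun c _ => ?_
  by_cases hc : c = 0
  · rw [hc, zero_smul, zero_smul, sum_conjWalsh_mul_zero hp4 hK hodd hf hg]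
  · exact sum_conjWalsh_mul_eq_zero hp4 hf hg (by rwa [hf.smul_mem_iff hc, hg.smul_mem_iff hc])

/-- The weight of a codeword in terms of the conjugates of Walsh values. -/
lemma hammingNorm_mul_sq (hp4 : p % 4 = 1) (hK : Fintype.card K = p ^ m) (hodd : Odd (s + t))
    (hf : HasDual p m s f εf fd k) (hg : HasDual p m t g εg gd l) {a b : K}
    (hab : (a, b) ≠ (0, 0)) :
    (p : ℂ) ^ 2 * hammingNorm (codewordMap p (definingSet p f g) (a, b))
      = (p - 1) * (p : ℂ) ^ (2 * m) - ∑ c : ZMod p, ∑ z ∈ Finset.univ.erase (0 : ZMod p),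
          conjWalsh p f z (c • a) * conjWalsh p g z (c • b) := by
  classical
  have h1 := congrArg (Nat.cast : ℕ → ℂ) (card_zeros hp4 hK hodd hf hg)
  have h2 := card_zeros_hyperplane (f := f) (g := g) hK hab
  have h3 := congrArg (Nat.cast : ℕ → ℂ)
    (hammingNorm_codewordMap f g a b)
  push_cast at h1 h3
  linear_combination (p : ℂ) ^ 2 * h3 + (p : ℂ) * h1 - h2

lemma mainWeight_eq : (p : ℝ) ^ 2 * mainWeight p m = (p - 1) * (p : ℝ) ^ (2 * m) := by
  have hp0 : (p : ℝ) ≠ 0 := by exact_mod_cast (Fact.out (p := p.Prime)).ne_zero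
  have : (p : ℝ) ^ (2 * (m : ℤ) - 2) = (p : ℝ) ^ (2 * m) / p ^ 2 := by
    rw [zpow_sub₀ hp0]; norm_cast
  rw [mainWeight, this]
  field_simp

lemma dev_eq : (p : ℝ) ^ 2 * dev p m s t = Real.sqrt p ^ (2 * m + s + t + 1) := by
  have hr0 : Real.sqrt p ≠ 0 := by exact_mod_cast sqrt_p_ne_zero (p := p)
  have hp : (p : ℝ) = Real.sqrt p ^ 2 := (Real.sq_sqrt (Nat.cast_nonneg p)).symm
  have : (p : ℝ) ^ 2 = Real.sqrt p ^ (4 : ℤ) := by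
    conv_lhs => rw [hp]
    rw [← pow_mul]; norm_cast
  rw [dev, this, ← zpow_add₀ hr0, ← zpow_natCast]
  congr 1; push_cast; ring

/-- The weight of a non-zero codeword that belongs to a point of the Walsh supports. -/
lemma hammingNorm_of_mem (hp4 : p % 4 = 1) (hK : Fintype.card K = p ^ m) (hodd : Odd (s + t))
    (hf : HasDual p m s f εf fd k) (hg : HasDual p m t g εg gd l) {a b : K}
    (hab : (a, b) ≠ (0, 0)) (ha : a ∈ walshSupport p m s f) (hb : b ∈ walshSupport p m t g) :
    (hammingNorm (codewordMap p (definingSet p f g) (a, b)) : ℝ)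
      = mainWeight p m - (εf * εg : ℤ) * dev p m s t * pairSum p k l (fd a) (gd b) := by
  have h := hammingNorm_mul_sq hp4 hK hodd hf hg hab
  rw [sum_smul_of_mem hp4 hK hodd hf hg ha hb] at h
  have h1 : (p : ℝ) ^ 2 * hammingNorm (codewordMap p (definingSet p f g) (a, b))
      = (p - 1) * (p : ℝ) ^ (2 * m) - (εf * εg * pairSum p k l (fd a) (gd b) : ℤ) *
          Real.sqrt p ^ (2 * m + s + t + 1) := by exact_mod_cast h
  have hp0 : (p : ℝ) ^ 2 ≠ 0 := by exact_mod_cast pow_ne_zero 2 (NeZero.ne p)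
  apply mul_left_cancel₀ hp0
  rw [h1, ← mainWeight_eq, ← dev_eq]
  push_cast; ring

/-- All other non-zero points give codewords of the main weight. -/
lemma hammingNorm_of_not_mem (hp4 : p % 4 = 1) (hK : Fintype.card K = p ^ m) (hodd : Odd (s + t))
    (hf : HasDual p m s f εf fd k) (hg : HasDual p m t g εg gd l) {a b : K}
    (hab : (a, b) ≠ (0, 0))
    (hS : ¬ (a ∈ walshSupport p m s f ∧ b ∈ walshSupport p m t g)) :
    (hammingNorm (codewordMap p (definingSet p f g) (a, b)) : ℝ) = mainWeight p m := by
  have h := hammingNorm_mul_sq hp4 hK hodd hf hg hab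
  rw [sum_smul_of_not_mem hp4 hK hodd hf hg hS, sub_zero] at h
  have h1 : (p : ℝ) ^ 2 * hammingNorm (codewordMap p (definingSet p f g) (a, b))
      = (p - 1) * (p : ℝ) ^ (2 * m) := by exact_mod_cast h
  have hp0 : (p : ℝ) ^ 2 ≠ 0 := by exact_mod_cast pow_ne_zero 2 (NeZero.ne p)
  apply mul_left_cancel₀ hp0
  rw [h1, ← mainWeight_eq]

end Weights

/-! ### Quadratic character sums -/

section QuadraticSums

variable {p : ℕ} [Fact p.Prime]

lemma eta_trichotomy (a : ZMod p) : eta p a = 0 ∨ eta p a = 1 ∨ eta p a = -1 := by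
  by_cases ha : a = 0
  · exact Or.inl (by rw [ha, eta_zero])
  · exact Or.inr (quadraticChar_dichotomy ha)

lemma squares_eq : squares p = {c | eta p c = 1} := by
  ext c
  simp only [squares, Set.mem_ofPred_eq]
  by_cases hc : c = 0
  · simp [hc, eta_zero]
  · rw [eta, quadraticChar_one_iff_isSquare hc]
    simp [hc]

lemma nonSquares_eq : nonSquares p = {c | eta p c = -1} := by
  ext c
  simp only [nonSquares, Set.mem_ofPred_eq, eta, quadraticChar_neg_one_iff_not_isSquare]

lemma exists_eta_eq_neg_one (hp4 : p % 4 = 1) : ∃ j : ZMod p, eta p j = -1 := by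
  obtain ⟨n, hpn, -⟩ := exists_half hp4
  exact quadraticChar_exists_neg_one (ringChar_zmod_ne_two hpn)

lemma two_ne_zero_zmod (hp4 : p % 4 = 1) : (2 : ZMod p) ≠ 0 := by
  intro h
  have h2 : ((2 : ℕ) : ZMod p) = 0 := by exact_mod_cast h
  rw [ZMod.natCast_eq_zero_iff] at h2
  have := Nat.le_of_dvd two_pos h2
  have := five_le hp4
  lia

lemma eta_inv (a : ZMod p) : eta p a⁻¹ = eta p a := by
  by_cases ha : a = 0
  · simp [ha]
  · have h1 : eta p a⁻¹ * eta p a = 1 := by rw [← eta_mul, inv_mul_cancel₀ ha, eta_one]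
    have h2 := eta_sq ha
    calc eta p a⁻¹ = eta p a⁻¹ * eta p a * eta p a := by rw [mul_assoc, ← sq, h2, mul_one]
      _ = eta p a := by rw [h1, one_mul]

lemma eta_sq_mul {c : ZMod p} (hc : c ≠ 0) (u : ZMod p) : eta p (c ^ 2 * u) = eta p u := by
  rw [eta_mul, sq, eta_mul, ← sq, eta_sq hc, one_mul]

lemma eta_cast (hp4 : p % 4 = 1) (c : ZMod p) : ((eta p c : ℤ) : ZMod p) = c ^ ((p - 1) / 2) := by
  obtain ⟨n, hpn, -⟩ := exists_half hp4
  have := quadraticChar_eq_pow_of_char_ne_two' (ringChar_zmod_ne_two hpn) c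
  rw [ZMod.card] at this
  rw [eta, this]
  congr 1; lia

lemma sum_erase_zero (F : ZMod p → ℤ) (h : F 0 = 0) :
    ∑ c ∈ Finset.univ.erase (0 : ZMod p), F c = ∑ c, F c := by
  rw [← Finset.add_sum_erase _ F (Finset.mem_univ (0 : ZMod p)), h, zero_add]

lemma card_erase_zero : ((Finset.univ.erase (0 : ZMod p)).card : ℤ) = p - 1 := by
  rw [Finset.card_erase_of_mem (Finset.mem_univ _), Finset.card_univ, ZMod.card,
    Nat.cast_sub (Fact.out (p := p.Prime)).one_le, Nat.cast_one]

/-- Each `c` has `1 + η c` square roots. -/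
lemma sum_sq_comp (hp4 : p % 4 = 1) (F : ZMod p → ℤ) :
    ∑ x, F (x ^ 2) = ∑ c, (1 + eta p c) * F c := by
  classical
  obtain ⟨n, hpn, -⟩ := exists_half hp4
  rw [← Finset.sum_fiberwise_of_maps_to (s := Finset.univ) (t := Finset.univ)
    (g := fun x : ZMod p => x ^ 2) (fun _ _ => Finset.mem_univ _)]
  refine Finset.sum_congr rfl fun c _ => ?_
  rw [Finset.sum_congr rfl (g := fun _ => F c) fun x hx => by rw [(Finset.mem_filter.1 hx).2],
    Finset.sum_const, nsmul_eq_mul]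
  have := quadraticChar_card_sqrts (ringChar_zmod_ne_two hpn) c
  congr 1
  rw [eta, add_comm, ← this]
  congr 2
  ext x; simp

/-- The Jacobsthal-type sum of `η (c (c + a))`, by the substitution `c ↦ 1 + a / c`. -/
lemma sum_eta_mul_eta_add (hp4 : p % 4 = 1) {a : ZMod p} (ha : a ≠ 0) :
    ∑ c, eta p c * eta p (c + a) = -1 := by
  have h1 : ∀ c : ZMod p,
      eta p c * eta p (c + a) = eta p (1 + a * c⁻¹) - if c = 0 then 1 else 0 := by
    intro c
    by_cases hc : c = 0
    · simp [hc, eta_zero, eta_one]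
    · rw [if_neg hc, sub_zero, ← eta_mul, ← eta_sq_mul hc (1 + a * c⁻¹)]
      congr 1
      field_simp
  have h2 : ∑ c : ZMod p, eta p (1 + a * c⁻¹) = ∑ c, eta p c :=
    Fintype.sum_equiv (((Equiv.inv (ZMod p)).trans (Equiv.mulLeft₀ a ha)).trans (Equiv.addLeft 1))
      _ _ fun c => rfl
  rw [Finset.sum_congr rfl fun c _ => h1 c, Finset.sum_sub_distrib, h2, sum_eta hp4]
  simp

lemma sum_eta_add (hp4 : p % 4 = 1) (a : ZMod p) : ∑ c, eta p (c + a) = 0 := by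
  rw [← sum_eta hp4]
  exact Fintype.sum_equiv (Equiv.addRight a) _ _ fun c => rfl

lemma sum_eta_sq_add (hp4 : p % 4 = 1) {a : ZMod p} (ha : a ≠ 0) :
    ∑ x, eta p (x ^ 2 + a) = -1 := by
  rw [sum_sq_comp hp4 fun c => eta p (c + a)]
  simp only [add_mul, one_mul, Finset.sum_add_distrib, sum_eta_add hp4, sum_eta_mul_eta_add hp4 ha]
  norm_num

/-! ### The weight sums for the three indices -/

lemma half_pos (hp4 : p % 4 = 1) : (p - 1) / 2 ≠ 0 := by
  have := five_le hp4
  lia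

lemma pairSum_half_half (hp4 : p % 4 = 1) (u v : ZMod p) :
    pairSum p ((p - 1) / 2) ((p - 1) / 2) u v = (p - 1) * eta p (u + v) := by
  rw [pairSum, ← sum_erase_zero _ (by simp [half_pos hp4, eta_zero]), ← card_erase_zero,
    ← nsmul_eq_mul, ← Finset.sum_const]
  refine Finset.sum_congr rfl fun c hc => ?_
  rw [← mul_add, ← eta_cast hp4]
  rcases quadraticChar_dichotomy (Finset.ne_of_mem_erase hc) with h | h
  · rw [eta.eq_1 p c, h]; simp
  · rw [eta.eq_1 p c, h]
    simp only [Int.cast_neg, Int.cast_one, neg_mul, one_mul]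
    rw [eta_neg hp4]

lemma sum_one_add_eta_erase (hp4 : p % 4 = 1) (δ : ℤ) :
    ∑ c ∈ Finset.univ.erase (0 : ZMod p), (1 + δ * eta p c) = p - 1 := by
  rw [Finset.sum_add_distrib, ← Finset.mul_sum, sum_erase_zero _ eta_zero, sum_eta hp4,
    Finset.sum_const, nsmul_eq_mul, card_erase_zero]
  ring

/-- By Euler's criterion `c ^ ((p - 1) / 2) = η c`, so the left side is one of two values according
to the class of `c`. -/
lemma two_mul_eta_add_pow (hp4 : p % 4 = 1) {c : ZMod p} (hc : c ≠ 0) (w v : ZMod p) :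
    2 * eta p (w + c ^ ((p - 1) / 2) * v)
      = (1 + eta p c) * eta p (w + v) + (1 - eta p c) * eta p (w - v) := by
  rw [← eta_cast hp4]
  rcases quadraticChar_dichotomy hc with h | h
  · rw [eta.eq_1 p c, h]; simp
  · rw [eta.eq_1 p c, h]
    simp only [Int.cast_neg, Int.cast_one, neg_mul, one_mul, ← sub_eq_add_neg]
    ring

lemma two_mul_pairSum_full_half (hp4 : p % 4 = 1) (u v : ZMod p) :
    2 * pairSum p (p - 1) ((p - 1) / 2) u v = (p - 1) * (eta p (u + v) + eta p (u - v)) := by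
  have h5 := five_le hp4
  rw [pairSum, ← sum_erase_zero _ (by
    simp [half_pos hp4, eta_zero, show p - 1 ≠ 0 by lia]), Finset.mul_sum]
  have h1 : ∀ c ∈ Finset.univ.erase (0 : ZMod p),
      2 * eta p (c ^ (p - 1) * u + c ^ ((p - 1) / 2) * v)
      = (1 + 1 * eta p c) * eta p (u + v) + (1 + (-1) * eta p c) * eta p (u - v) := by
    intro c hc
    have hc := Finset.ne_of_mem_erase hc
    rw [ZMod.pow_card_sub_one_eq_one hc, one_mul, two_mul_eta_add_pow hp4 hc]
    ring
  rw [Finset.sum_congr rfl h1, Finset.sum_add_distrib, ← Finset.sum_mul, ← Finset.sum_mul,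
    sum_one_add_eta_erase hp4, sum_one_add_eta_erase hp4]
  ring

lemma pairSum_two_half_zero_right (u : ZMod p) :
    pairSum p 2 ((p - 1) / 2) u 0 = (p - 1) * eta p u := by
  rw [pairSum, ← sum_erase_zero _ (by simp [eta_zero]), ← card_erase_zero,
    ← nsmul_eq_mul, ← Finset.sum_const]
  refine Finset.sum_congr rfl fun c hc => ?_
  rw [mul_zero, add_zero, eta_sq_mul (Finset.ne_of_mem_erase hc)]

lemma pairSum_two_half_zero_left (hp4 : p % 4 = 1) (v : ZMod p) :
    pairSum p 2 ((p - 1) / 2) 0 v = (p - 1) * eta p v := by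
  have h := pairSum_half_half hp4 0 v
  rw [zero_add] at h
  rw [← h]
  simp [pairSum]

/-- A square root `i` of `-1` is a square exactly if `p ≡ 1 mod 8`. -/
lemma exists_sqrt_neg_one (hp4 : p % 4 = 1) : ∃ i : ZMod p, i ^ 2 = -1 ∧ i ≠ 0 ∧
    (p % 8 = 1 → eta p i = 1) ∧ (p % 8 = 5 → eta p i = -1) := by
  obtain ⟨i, hi⟩ := (ZMod.exists_sq_eq_neg_one_iff (p := p)).2 (by lia)
  have hi2 : i ^ 2 = -1 := by rw [sq, ← hi]
  have hi0 : i ≠ 0 := by rintro rfl; simp at hi2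
  have hcast := eta_cast hp4 i
  rw [show (p - 1) / 2 = 2 * ((p - 1) / 4) by lia, pow_mul, hi2] at hcast
  have hne : (1 : ZMod p) ≠ -1 := fun h => two_ne_zero_zmod hp4 (by linear_combination h)
  refine ⟨i, hi2, hi0, fun h8 => ?_, fun h8 => ?_⟩
  · rcases quadraticChar_dichotomy hi0 with h | h
    · exact h
    · exfalso
      rw [eta, h, Even.neg_one_pow (by rw [Nat.even_iff]; lia)] at hcast
      rw [Int.cast_neg, Int.cast_one] at hcast
      exact hne hcast.symm
  · rcases quadraticChar_dichotomy hi0 with h | h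
    · exfalso
      rw [eta, h, Odd.neg_one_pow (by rw [Nat.odd_iff]; lia)] at hcast
      exact hne (by rw [← hcast]; simp)
    · exact h

/-- The substitution `c ↦ i c` with `i ^ 2 = -1` turns the contribution of the non-squares `c` into
one of the same shape as that of the squares. -/
lemma two_mul_pairSum_two_half (hp4 : p % 4 = 1) {i : ZMod p} (hi : i ^ 2 = -1) (hi0 : i ≠ 0)
    (u v : ZMod p) :
    2 * pairSum p 2 ((p - 1) / 2) u v =
      ∑ c ∈ Finset.univ.erase (0 : ZMod p),
        (2 + (1 - eta p i) * eta p c) * eta p (c ^ 2 * u + v) := by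
  rw [pairSum, ← sum_erase_zero _ (by simp [half_pos hp4, eta_zero]), Finset.mul_sum]
  have h1 : ∀ c ∈ Finset.univ.erase (0 : ZMod p),
      2 * eta p (c ^ 2 * u + c ^ ((p - 1) / 2) * v)
      = (1 + eta p c) * eta p (c ^ 2 * u + v) + (1 - eta p c) * eta p (c ^ 2 * u - v) :=
    fun c hc => two_mul_eta_add_pow hp4 (Finset.ne_of_mem_erase hc) _ _
  have h2 : ∑ c ∈ Finset.univ.erase (0 : ZMod p), (1 - eta p c) * eta p (c ^ 2 * u - v)
      = ∑ c ∈ Finset.univ.erase (0 : ZMod p), (1 - eta p i * eta p c) * eta p (c ^ 2 * u + v) := by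
    symm
    refine Finset.sum_equiv (Equiv.mulLeft₀ i hi0) (by simp [hi0]) fun c _ => ?_
    rw [Equiv.mulLeft₀_apply, ← eta_mul, mul_pow, hi, ← eta_neg hp4 (c ^ 2 * u + v)]
    congr 2; ring
  rw [Finset.sum_congr rfl h1, Finset.sum_add_distrib, h2, ← Finset.sum_add_distrib]
  exact Finset.sum_congr rfl fun c _ => by ring

lemma pairSum_two_half_of_mod_eight_eq_one (hp4 : p % 4 = 1) (h8 : p % 8 = 1) {u v : ZMod p}
    (hu : u ≠ 0) (hv : v ≠ 0) : pairSum p 2 ((p - 1) / 2) u v = -eta p u - eta p v := by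
  obtain ⟨i, hi, hi0, hi1, -⟩ := exists_sqrt_neg_one hp4
  have h := two_mul_pairSum_two_half hp4 hi hi0 u v
  rw [hi1 h8] at h
  simp only [sub_self, zero_mul, add_zero, ← Finset.mul_sum] at h
  have h1 := Int.eq_of_mul_eq_mul_left two_ne_zero h
  have h2 : ∑ c : ZMod p, eta p (c ^ 2 * u + v) = - eta p u := by
    have h3 : ∀ c : ZMod p, eta p (c ^ 2 * u + v) = eta p u * eta p (c ^ 2 + v * u⁻¹) := by
      intro c
      rw [← eta_mul]
      congr 1; field_simp
    rw [Finset.sum_congr rfl fun c _ => h3 c, ← Finset.mul_sum,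
      sum_eta_sq_add hp4 (mul_ne_zero hv (inv_ne_zero hu))]
    ring
  rw [← Finset.add_sum_erase _ _ (Finset.mem_univ (0 : ZMod p)), ← h1] at h2
  simp only [ne_eq, OfNat.ofNat_ne_zero, not_false_eq_true, zero_pow, zero_mul, zero_add] at h2
  linarith

lemma pairSum_two_half_of_mod_eight_eq_five (hp4 : p % 4 = 1) (h8 : p % 8 = 5) {u v : ZMod p}
    (hu : u ≠ 0) : pairSum p 2 ((p - 1) / 2) u v
      = eta p u * (companionSum p 4 (v / u) - eta p (v / u)) := by
  obtain ⟨i, hi, hi0, -, hi5⟩ := exists_sqrt_neg_one hp4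
  have h := two_mul_pairSum_two_half hp4 hi hi0 u v
  rw [hi5 h8] at h
  have h1 : pairSum p 2 ((p - 1) / 2) u v =
      ∑ c ∈ Finset.univ.erase (0 : ZMod p), (1 + eta p c) * eta p (c ^ 2 * u + v) := by
    refine Int.eq_of_mul_eq_mul_left two_ne_zero (h.trans ?_)
    rw [Finset.mul_sum]
    exact Finset.sum_congr rfl fun c _ => by ring
  have h2 := sum_sq_comp hp4 fun c => eta p (c ^ 2 * u + v)
  rw [← Finset.add_sum_erase _ (fun c => (1 + eta p c) * eta p (c ^ 2 * u + v))
    (Finset.mem_univ (0 : ZMod p)), ← h1] at h2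
  simp only [ne_eq, OfNat.ofNat_ne_zero, not_false_eq_true, zero_pow, zero_mul, zero_add, eta_zero,
    add_zero, one_mul] at h2
  have hmul : ∀ w : ZMod p, eta p u * eta p (w + v / u) = eta p (w * u + v) := by
    intro w
    rw [← eta_mul]
    congr 1; field_simp
  have h3 : eta p u * companionSum p 4 (v / u) = ∑ x : ZMod p, eta p ((x ^ 2) ^ 2 * u + v) := by
    rw [companionSum, Finset.mul_sum]
    refine Finset.sum_congr rfl fun x _ => ?_
    rw [hmul, ← pow_mul]
  have h4 := hmul 0
  rw [zero_mul, zero_add, zero_add] at h4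
  rw [mul_sub, h3, h4, h2]
  ring

/-! ### Sums over the squares and over the non-squares -/

/-- Away from `0`, twice the indicator of `{c | η c = σ}` is `1 + σ η`. -/
lemma two_mul_sum_filter_eta {σ : ℤ} (hσ : σ = 1 ∨ σ = -1) (F : ZMod p → ℤ) :
    2 * ∑ c ∈ Finset.univ.filter (fun c : ZMod p => eta p c = σ), F c
      = ∑ c ∈ Finset.univ.erase 0, (1 + σ * eta p c) * F c := by
  have hσ0 : σ ≠ 0 := by rcases hσ with h | h <;> simp [h]
  rw [Finset.mul_sum, Finset.sum_filter]
  rw [← sum_erase_zero _ (by rw [eta_zero, if_neg hσ0.symm])]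
  refine Finset.sum_congr rfl fun c hc => ?_
  rcases quadraticChar_dichotomy (Finset.ne_of_mem_erase hc) with h | h <;>
    rcases hσ with rfl | rfl <;> simp [eta, h]

lemma two_mul_card_filter_eta (hp4 : p % 4 = 1) {σ : ℤ} (hσ : σ = 1 ∨ σ = -1) :
    2 * ((Finset.univ.filter (fun c : ZMod p => eta p c = σ)).card : ℤ) = p - 1 := by
  have := two_mul_sum_filter_eta (p := p) hσ (fun _ => 1)
  simp only [Finset.sum_const, nsmul_eq_mul, mul_one, sum_one_add_eta_erase hp4] at this
  exact this

lemma card_filter_eta (hp4 : p % 4 = 1) {σ : ℤ} (hσ : σ = 1 ∨ σ = -1) :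
    (Finset.univ.filter (fun c : ZMod p => eta p c = σ)).card = (p - 1) / 2 := by
  have := two_mul_card_filter_eta hp4 hσ
  have := five_le hp4
  lia

lemma sum_filter_eta_eq_one_add (hp4 : p % 4 = 1) :
    ∑ d ∈ Finset.univ.filter (fun c : ZMod p => eta p c = 1), eta p (1 + d) = -1 := by
  have h1 := two_mul_sum_filter_eta (p := p) (Or.inl rfl) (fun d => eta p (1 + d))
  have h2 := sum_sq_comp hp4 fun c => eta p (1 + c)
  rw [← Finset.add_sum_erase _ (fun c => (1 + eta p c) * eta p (1 + c))
    (Finset.mem_univ (0 : ZMod p))] at h2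
  simp only [add_comm (1 : ZMod p), sum_eta_sq_add hp4 (one_ne_zero (α := ZMod p))] at h2
  simp only [one_mul, add_comm (1 : ZMod p)] at h1
  simp only [eta_zero, zero_add, eta_one, add_zero, one_mul] at h2
  simp only [add_comm (1 : ZMod p)]
  linarith

/-- The sum of `η (a + b)` over `a` and `b` in a fixed class modulo squares. -/
lemma sum_filter_eta_eta_add (hp4 : p % 4 = 1) {σ : ℤ} (hσ : σ = 1 ∨ σ = -1) :
    2 * ∑ a ∈ Finset.univ.filter (fun c : ZMod p => eta p c = σ),
      ∑ b ∈ Finset.univ.filter (fun c : ZMod p => eta p c = σ), eta p (a + b)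
      = -σ * (p - 1) := by
  have hσ2 : σ * σ = 1 := by rcases hσ with h | h <;> simp [h]
  have hσ0 : σ ≠ 0 := by rcases hσ with h | h <;> simp [h]
  have h1 : ∀ a ∈ Finset.univ.filter (fun c : ZMod p => eta p c = σ),
      ∑ b ∈ Finset.univ.filter (fun c : ZMod p => eta p c = σ), eta p (a + b) = -σ := by
    intro a ha
    have ha := (Finset.mem_filter.1 ha).2
    have ha0 : a ≠ 0 := by rintro rfl; rw [eta_zero] at ha; exact hσ0 ha.symm
    rw [← mul_neg_one σ, ← sum_filter_eta_eq_one_add hp4, Finset.mul_sum]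
    symm
    refine Finset.sum_equiv (Equiv.mulLeft₀ a ha0) (fun d => ?_) fun d _ => ?_
    · simp only [Finset.mem_filter, Finset.mem_univ, true_and, Equiv.mulLeft₀_apply, eta_mul, ha]
      refine ⟨fun h => by rw [h, mul_one], fun h => mul_left_cancel₀ hσ0 (by rw [h, mul_one])⟩
    · rw [Equiv.mulLeft₀_apply, ← ha, ← eta_mul]
      congr 1; ring
  rw [Finset.sum_congr rfl h1, Finset.sum_const, nsmul_eq_mul, ← mul_assoc,
    two_mul_card_filter_eta hp4 hσ]
  ring

open scoped Classical in
/-- The substitution `a = u + v`, `b = u - v`. -/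
lemma sum_filter_predB (hp4 : p % 4 = 1) {σ : ℤ} (F : ZMod p → ℤ) :
    ∑ q ∈ Finset.univ.filter (fun q : ZMod p × ZMod p => predB p {c | eta p c = σ} q.1 q.2), F q.1
      = ∑ a ∈ Finset.univ.filter (fun c : ZMod p => eta p c = σ),
        ∑ b ∈ Finset.univ.filter (fun c : ZMod p => eta p c = σ), F ((a + b) / 2) := by
  have h2 := two_ne_zero_zmod hp4
  rw [← Finset.sum_product']
  refine Finset.sum_bij' (fun q _ => (q.1 + q.2, q.1 - q.2))
    (fun q _ => ((q.1 + q.2) / 2, (q.1 - q.2) / 2)) ?_ ?_ ?_ ?_ ?_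
  · intro q hq
    have := (Finset.mem_filter.1 hq).2
    simpa [predB] using this
  · intro q hq
    simp only [Finset.mem_product, Finset.mem_filter, Finset.mem_univ, true_and] at hq
    refine Finset.mem_filter.2 ⟨Finset.mem_univ _, ?_, ?_⟩
    · rw [Set.mem_ofPred_eq, ← hq.1]; congr 1; field_simp; ring
    · rw [Set.mem_ofPred_eq, ← hq.2]; congr 1; field_simp; ring
  · intro q _; ext <;> simp <;> field_simp <;> ring
  · intro q _; ext <;> simp <;> field_simp <;> ring
  · intro q _
    congr 1; simp only; field_simp; ring

end QuadraticSums

/-! ### Numbers of pairs of dual values -/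

section PairCounts

variable {K : Type*} [Field K] [Fintype K] {p m s t : ℕ} [Fact p.Prime] [Algebra (ZMod p) K]
variable {f g fd gd : K → ZMod p} {εf εg ε : ℤ}

/-- A sum over pairs of points of the Walsh supports that depends on the dual values only. -/
lemma sum_support_prod_eq {M : Type*} [AddCommMonoid M] (f g fd gd : K → ZMod p)
    (G : ZMod p × ZMod p → M) :
    ∑ ab ∈ supportFinset p m s f ×ˢ supportFinset p m t g, G (fd ab.1, gd ab.2)
      = ∑ q : ZMod p × ZMod p,
          (dualCount p m s f fd q.1 * dualCount p m t g gd q.2) • G q := by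
  rw [Finset.sum_product, Fintype.sum_prod_type,
    sum_support_eq f fd fun u => ∑ b ∈ supportFinset p m t g, G (u, gd b)]
  refine Finset.sum_congr rfl fun u _ => ?_
  rw [sum_support_eq g gd fun v => G (u, v), Finset.smul_sum]
  exact Finset.sum_congr rfl fun v _ => by rw [mul_smul]

open scoped Classical in
lemma pairCount_eq_sum (f g fd gd : K → ZMod p) (P : ZMod p → ZMod p → Prop) :
    pairCount p m s t f g fd gd P = ∑ q ∈ Finset.univ.filter fun q : ZMod p × ZMod p => P q.1 q.2,
      dualCount p m s f fd q.1 * dualCount p m t g gd q.2 := by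
  have h := sum_support_prod_eq (m := m) (s := s) (t := t) f g fd gd
    fun q => if P q.1 q.2 then 1 else 0
  simp only [smul_eq_mul, mul_ite, mul_one, mul_zero, ← Finset.sum_filter] at h
  rw [← h, ← Finset.card_eq_sum_ones, pairCount, ← Set.ncard_coe_finset]
  congr 1
  ext ab
  simp [mem_supportFinset, and_assoc]

lemma pairCount_congr {P Q : ZMod p → ZMod p → Prop} (h : ∀ u v, P u v ↔ Q u v) :
    pairCount p m s t f g fd gd P = pairCount p m s t f g fd gd Q := by
  have : P = Q := by
    funext u v
    exact propext (h u v)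
  rw [this]

lemma pairCount_swap {P Q : ZMod p → ZMod p → Prop} (h : ∀ u v, P u v ↔ Q v u) :
    pairCount p m s t f g fd gd P = pairCount p m t s g f gd fd Q := by
  classical
  rw [pairCount_eq_sum, pairCount_eq_sum]
  refine Finset.sum_equiv (Equiv.prodComm _ _) (fun q => ?_) fun q _ => ?_
  · simp [h]
  · rw [mul_comm]; rfl

/-- The number of points where the dual function takes a value depends on the quadratic character
of that value only. -/
lemma dualCount_congr (hp4 : p % 4 = 1) (hK : Fintype.card K = p ^ m)
    (hf : IsPlateaued p m s f) (hf0 : f 0 = 0) (hd : IsSignDual p m s f ε fd) {c d : ZMod p}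
    (h : eta p c = eta p d) : dualCount p m s f fd c = dualCount p m s f fd d := by
  zify
  rcases Nat.even_or_odd' (m - s) with ⟨j, hj | hj⟩
  · by_cases hc : c = 0
    · rw [hc, eta_zero, eq_comm, eta_eq_zero_iff] at h
      rw [hc, h]
    · have hd0 : d ≠ 0 := by
        rintro rfl
        rw [eta_zero, eta_eq_zero_iff] at h
        exact hc h
      rw [dualCount_of_even hK hf hf0 hd hj hc, dualCount_of_even hK hf hf0 hd hj hd0]
  · rw [dualCount_of_odd hp4 hK hf hf0 hd hj c, dualCount_of_odd hp4 hK hf hf0 hd hj d, h]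

lemma pairCount_predE12 (hp4 : p % 4 = 1) (hK : Fintype.card K = p ^ m)
    (hf : IsPlateaued p m s f) (hf0 : f 0 = 0) (hdf : IsSignDual p m s f εf fd)
    (hg : IsPlateaued p m t g) (hg0 : g 0 = 0) (hdg : IsSignDual p m t g εg gd)
    {σ : ℤ} (hσ : σ = 1 ∨ σ = -1) {i : ZMod p} (hi : eta p i = σ) :
    pairCount p m s t f g fd gd (predE12 p {c | eta p c = σ})
      = (p - 1) * (dualCount p m s f fd i * dualCount p m t g gd i) := by
  classical
  have h1 : ∀ q ∈ Finset.univ.filter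
      (fun q : ZMod p × ZMod p => predE12 p {c | eta p c = σ} q.1 q.2),
      dualCount p m s f fd q.1 * dualCount p m t g gd q.2
        = dualCount p m s f fd i * dualCount p m t g gd i := by
    intro q hq
    obtain ⟨h1, h2⟩ := (Finset.mem_filter.1 hq).2
    rw [Set.mem_ofPred_eq] at h1
    have h3 : eta p q.2 = σ := by
      rcases h2 with h2 | h2
      · rw [h2, h1]
      · rw [h2, eta_neg hp4, h1]
    rw [dualCount_congr hp4 hK hf hf0 hdf (h1.trans hi.symm),
      dualCount_congr hp4 hK hg hg0 hdg (h3.trans hi.symm)]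
  have hcard : (Finset.univ.filter
      (fun q : ZMod p × ZMod p => predE12 p {c | eta p c = σ} q.1 q.2)).card = p - 1 := by
    rw [Finset.card_filter, Fintype.sum_prod_type]
    have h2 : ∀ u : ZMod p, (∑ v : ZMod p, if predE12 p {c | eta p c = σ} u v then 1 else 0)
        = if eta p u = σ then 2 else 0 := by
      intro u
      split_ifs with hu
      · have hu0 : u ≠ -u := by
          intro h
          have h3 : u = 0 := by
            have : (2 : ZMod p) * u = 0 := by linear_combination h
            exact (mul_eq_zero.1 this).resolve_left (two_ne_zero_zmod hp4)
          rw [h3, eta_zero] at hu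
          rcases hσ with h | h <;> simp [h] at hu
        rw [← Finset.card_filter, ← Finset.card_pair hu0]
        congr 1
        ext v
        simp [predE12, hu]
      · refine Finset.sum_eq_zero fun v _ => if_neg fun h => hu h.1
    rw [Finset.sum_congr rfl fun u _ => h2 u, ← Finset.sum_filter, Finset.sum_const,
      card_filter_eta hp4 hσ, smul_eq_mul]
    lia
  rw [pairCount_eq_sum, Finset.sum_congr rfl h1, Finset.sum_const, hcard, smul_eq_mul]

lemma pairCount_predE34 (hp4 : p % 4 = 1) (hK : Fintype.card K = p ^ m)
    (hf : IsPlateaued p m s f) (hf0 : f 0 = 0) (hdf : IsSignDual p m s f εf fd)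
    (hg : IsPlateaued p m t g) (hg0 : g 0 = 0) (hdg : IsSignDual p m t g εg gd)
    {σ : ℤ} (hσ : σ = 1 ∨ σ = -1) {i : ZMod p} (hi : eta p i = σ) :
    pairCount p m s t f g fd gd (predE34 p {c | eta p c = σ})
      = (p - 1) / 2 * (dualCount p m s f fd 0 * dualCount p m t g gd i
          + dualCount p m s f fd i * dualCount p m t g gd 0) := by
  classical
  have hσ0 : (0 : ℤ) ≠ σ := by rcases hσ with h | h <;> simp [h]
  rw [pairCount_eq_sum, Finset.sum_filter, Fintype.sum_prod_type]
  have h1 : ∀ u v : ZMod p, (if predE34 p {c | eta p c = σ} u v then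
        dualCount p m s f fd u * dualCount p m t g gd v else 0)
      = (if u = 0 then (if eta p v = σ then
          dualCount p m s f fd 0 * dualCount p m t g gd i else 0) else 0)
        + (if v = 0 then (if eta p u = σ then
          dualCount p m s f fd i * dualCount p m t g gd 0 else 0) else 0) := by
    intro u v
    simp only [predE34, Set.mem_ofPred_eq]
    by_cases hu : u = 0
    · subst hu
      by_cases hv : v = 0
      · subst hv; simp [eta_zero, hσ0]
      · by_cases hvσ : eta p v = σ
        · simp [hv, hvσ, dualCount_congr hp4 hK hg hg0 hdg (hvσ.trans hi.symm)]
        · simp [hv, hvσ]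
    · by_cases hv : v = 0
      · by_cases huσ : eta p u = σ
        · simp [hu, hv, huσ, dualCount_congr hp4 hK hf hf0 hdf (huσ.trans hi.symm)]
        · simp [hu, hv, huσ]
      · simp [hu, hv]
  simp only [h1, Finset.sum_add_distrib]
  rw [Finset.sum_comm (f := fun u v : ZMod p => if u = 0 then (if eta p v = σ then
          dualCount p m s f fd 0 * dualCount p m t g gd i else 0) else 0)]
  simp only [Finset.sum_ite_eq', Finset.mem_univ, if_true, ← Finset.sum_filter, Finset.sum_const,
    card_filter_eta hp4 hσ, smul_eq_mul]
  ring

lemma dualCount_cast_of_odd (hp4 : p % 4 = 1) (hK : Fintype.card K = p ^ m)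
    (hf : IsPlateaued p m s f) (hf0 : f 0 = 0) (hd : IsSignDual p m s f ε fd)
    {j : ℕ} (hj : m - s = 2 * j + 1) (u : ZMod p) :
    (dualCount p m s f fd u : ℝ) = (p : ℝ) ^ (2 * j) + ε * p ^ j * eta p u := by
  have h1 := dualCount_of_odd hp4 hK hf hf0 hd hj u
  rw [dualCount_zero_of_odd hp4 hK hf hf0 hd hj] at h1
  exact_mod_cast h1

lemma dualCount_cast_of_even (hK : Fintype.card K = p ^ m)
    (hf : IsPlateaued p m s f) (hf0 : f 0 = 0) (hd : IsSignDual p m s f ε fd)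
    {i : ℕ} (hi : m - s = 2 * i) (v : ZMod p) :
    (dualCount p m s f fd v : ℝ) = ((p : ℝ) ^ (2 * i) - ε * p ^ i) / p
      + if v = 0 then (ε : ℝ) * p ^ i else 0 := by
  have hp0 : (p : ℝ) ≠ 0 := by exact_mod_cast (Fact.out (p := p.Prime)).ne_zero
  have h0 : (p : ℝ) * dualCount p m s f fd 0 = p ^ (2 * i) + (p - 1) * (ε * p ^ i) := by
    exact_mod_cast dualCount_zero_of_even hK hf hf0 hd hi
  split_ifs with hv
  · subst hv
    field_simp
    linear_combination h0
  · have h1 : (dualCount p m s f fd v : ℝ) = dualCount p m s f fd 0 - ε * p ^ i := by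
      exact_mod_cast dualCount_of_even hK hf hf0 hd hi hv
    rw [h1]
    field_simp
    linear_combination h0

/-- When the Walsh support has at least `p ^ 2` elements, all values are taken. -/
lemma dualCount_ne_zero (hp4 : p % 4 = 1) (hK : Fintype.card K = p ^ m)
    (hf : IsPlateaued p m s f) (hf0 : f 0 = 0) (hd : IsSignDual p m s f ε fd)
    (hs : s + 2 ≤ m) (c : ZMod p) : dualCount p m s f fd c ≠ 0 := by
  have hp1 : (1 : ℝ) < p := by exact_mod_cast (Fact.out (p := p.Prime)).one_lt
  have hp0 : (0 : ℝ) < p := zero_lt_one.trans hp1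
  rw [← Nat.pos_iff_ne_zero, ← Nat.cast_pos (α := ℝ)]
  rcases Nat.even_or_odd' (m - s) with ⟨j, hj | hj⟩
  · rw [dualCount_cast_of_even hK hf hf0 hd hj, pow_mul']
    have h1 : (p : ℝ) ≤ p ^ j := le_self_pow₀ hp1.le (by lia)
    have h2 : 0 < (p : ℝ) ^ j := pow_pos hp0 j
    have h3 : 0 < (((p : ℝ) ^ j) ^ 2 - ε * p ^ j) / p + if c = 0 then (ε : ℝ) * p ^ j else 0 := by
      have : (((p : ℝ) ^ j) ^ 2 - ε * p ^ j) / p + (if c = 0 then (ε : ℝ) * p ^ j else 0)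
          = p ^ j / p * (p ^ j - ε + if c = 0 then (ε : ℝ) * p else 0) := by
        split_ifs
        · field_simp
        · field_simp
          ring
      rw [this]
      refine mul_pos (div_pos h2 hp0) ?_
      rcases hd.1 with h | h <;> split_ifs <;> rw [h] <;> push_cast <;> linarith
    exact h3
  · rw [dualCount_cast_of_odd hp4 hK hf hf0 hd hj, pow_mul']
    have h1 : 1 < (p : ℝ) ^ j := one_lt_pow₀ hp1 (by lia)
    have h2 : ((p : ℝ) ^ j) ^ 2 + ε * p ^ j * eta p c = p ^ j * (p ^ j + ε * eta p c) := by ring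
    rw [h2]
    refine mul_pos (zero_lt_one.trans h1) ?_
    rcases hd.1 with h | h <;> rcases eta_trichotomy c with h' | h' | h' <;> rw [h, h'] <;>
      push_cast <;> linarith

lemma exists_half_dims (hs : s ≤ m) (hodd : Odd ((m : ℤ) - s)) (hst : Odd (s + t)) :
    ∃ j i, m - s = 2 * j + 1 ∧ m - t = 2 * i := by
  obtain ⟨a, ha⟩ := hodd
  obtain ⟨b, hb⟩ := hst
  exact ⟨a.toNat, (m - t) / 2, by lia, by lia⟩

lemma sqrt_zpow_two_mul {p : ℕ} (n : ℤ) : Real.sqrt p ^ (2 * n) = (p : ℝ) ^ n := by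
  rw [zpow_mul, zpow_ofNat, Real.sq_sqrt (Nat.cast_nonneg p)]

/-- The dual values of `f` and `g` add up to values that are distributed like those of the dual
function of a plateaued function on `K × K`, with sign `ε_f ε_g`. -/
lemma pairCount_eta_add_of_odd (hp4 : p % 4 = 1) (hK : Fintype.card K = p ^ m)
    (hf : IsPlateaued p m s f) (hf0 : f 0 = 0) (hdf : IsSignDual p m s f εf fd)
    (hg : IsPlateaued p m t g) (hg0 : g 0 = 0) (hdg : IsSignDual p m t g εg gd)
    (hodd : Odd ((m : ℤ) - s)) (hst : Odd (s + t)) {σ : ℤ} (hσ : σ = 1 ∨ σ = -1) :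
    (pairCount p m s t f g fd gd (fun u v => eta p (u + v) = σ) : ℝ)
      = ((p : ℝ) - 1) / 2 * ((Real.sqrt p ^ (2 * (m : ℤ) - s - t - 1)) ^ 2 +
          σ * (εf * εg) * Real.sqrt p ^ (2 * (m : ℤ) - s - t - 1)) := by
  classical
  have hp0 : (p : ℝ) ≠ 0 := by exact_mod_cast (Fact.out (p := p.Prime)).ne_zero
  obtain ⟨j, i, hj, hi⟩ := exists_half_dims hf.1 hodd hst
  have hms := hf.1
  have hmt := hg.1
  have e : Real.sqrt p ^ (2 * (m : ℤ) - s - t - 1) = (p : ℝ) ^ j * p ^ i := by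
    rw [show 2 * (m : ℤ) - s - t - 1 = 2 * ((j : ℤ) + i) by lia, sqrt_zpow_two_mul,
      zpow_add₀ hp0, zpow_natCast, zpow_natCast]
  rw [e, pairCount_eq_sum]
  push_cast
  simp only [dualCount_cast_of_odd hp4 hK hf hf0 hdf hj, dualCount_cast_of_even hK hg hg0 hdg hi]
  set R := Finset.univ.filter (fun c : ZMod p => eta p c = σ) with hR
  have hcard : (R.card : ℝ) = ((p : ℝ) - 1) / 2 := by
    have : 2 * (R.card : ℝ) = p - 1 := by exact_mod_cast two_mul_card_filter_eta hp4 hσ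
    linarith
  have hsum : ∀ F : ZMod p → ZMod p → ℝ,
      ∑ q ∈ Finset.univ.filter (fun q : ZMod p × ZMod p => eta p (q.1 + q.2) = σ), F q.1 q.2
        = ∑ a ∈ R, ∑ u, F u (a - u) := by
    intro F
    rw [← Finset.sum_product']
    refine Finset.sum_bij' (fun q _ => (q.1 + q.2, q.1)) (fun q _ => (q.2, q.1 - q.2))
      ?_ ?_ ?_ ?_ ?_
    · intro q hq; simpa [hR] using hq
    · intro q hq; simpa [hR] using hq
    · intro q _; simp
    · intro q _; simp
    · intro q _; simp
  refine (Finset.sum_congr (by ext q; simp) fun _ _ => rfl).trans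
    ((hsum fun u v => ((p : ℝ) ^ (2 * j) + εf * p ^ j * eta p u) *
    (((p : ℝ) ^ (2 * i) - εg * p ^ i) / p + if v = 0 then (εg : ℝ) * p ^ i else 0)).trans ?_)
  have hη : ∑ u : ZMod p, (eta p u : ℝ) = 0 := by exact_mod_cast sum_eta hp4
  have hinner : ∀ a ∈ R, ∑ u : ZMod p, ((p : ℝ) ^ (2 * j) + εf * p ^ j * eta p u) *
      (((p : ℝ) ^ (2 * i) - εg * p ^ i) / p + if a - u = 0 then (εg : ℝ) * p ^ i else 0)
      = ((p : ℝ) ^ j * p ^ i) ^ 2 + σ * (εf * εg) * (p ^ j * p ^ i) := by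
    intro a ha
    simp only [mul_add, Finset.sum_add_distrib, ← Finset.sum_mul, sub_eq_zero, mul_ite, mul_zero,
      Finset.sum_ite_eq, Finset.mem_univ, if_true, ← Finset.mul_sum, hη, Finset.sum_const,
      Finset.card_univ, ZMod.card, nsmul_eq_mul, (Finset.mem_filter.1 ha).2]
    field_simp
    ring
  rw [Finset.sum_congr rfl hinner, Finset.sum_const, nsmul_eq_mul, hcard]

lemma pairCount_eta_add (hp4 : p % 4 = 1) (hK : Fintype.card K = p ^ m)
    (hf : IsPlateaued p m s f) (hf0 : f 0 = 0) (hdf : IsSignDual p m s f εf fd)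
    (hg : IsPlateaued p m t g) (hg0 : g 0 = 0) (hdg : IsSignDual p m t g εg gd)
    (hst : Odd (s + t)) {σ : ℤ} (hσ : σ = 1 ∨ σ = -1) :
    (pairCount p m s t f g fd gd (fun u v => eta p (u + v) = σ) : ℝ)
      = ((p : ℝ) - 1) / 2 * ((Real.sqrt p ^ (2 * (m : ℤ) - s - t - 1)) ^ 2 +
          σ * (εf * εg) * Real.sqrt p ^ (2 * (m : ℤ) - s - t - 1)) := by
  rcases Int.even_or_odd ((m : ℤ) - s) with he | ho
  · have ho : Odd ((m : ℤ) - t) := by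
      obtain ⟨a, ha⟩ := hst
      obtain ⟨b, hb⟩ := he
      exact ⟨b + s - a - 1, by lia⟩
    rw [pairCount_swap (Q := fun u v => eta p (u + v) = σ) (fun u v => by rw [add_comm]),
      pairCount_eta_add_of_odd hp4 hK hg hg0 hdg hf hf0 hdf ho (by rwa [add_comm]) hσ,
      show 2 * (m : ℤ) - t - s - 1 = 2 * (m : ℤ) - s - t - 1 by ring]
    ring
  · exact pairCount_eta_add_of_odd hp4 hK hf hf0 hdf hg hg0 hdg ho hst hσ

open scoped Classical in
/-- The sum over the pairs counted by `B`, for weights of the shape that the numbers of dual values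
have: affine in `η u` for the function with odd codimension, and constant but for the value at `0`
for the other. -/
lemma sum_predB (hp4 : p % 4 = 1) {σ : ℤ} (hσ : σ = 1 ∨ σ = -1) (A B N C : ℝ) :
    ∑ q ∈ Finset.univ.filter (fun q : ZMod p × ZMod p => predB p {c | eta p c = σ} q.1 q.2),
      (A + B * eta p q.1) * (N + if q.2 = 0 then C else 0)
      = (((p : ℝ) - 1) / 2) ^ 2 * A * N - σ * eta p 2 * (((p : ℝ) - 1) / 2) * B * N
        + ((p : ℝ) - 1) / 2 * A * C + σ * (((p : ℝ) - 1) / 2) * B * C := by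
  set Z := Finset.univ.filter fun q : ZMod p × ZMod p => predB p {c | eta p c = σ} q.1 q.2 with hZ
  set R := Finset.univ.filter (fun c : ZMod p => eta p c = σ) with hR
  have hcard : (R.card : ℝ) = ((p : ℝ) - 1) / 2 := by
    have : 2 * (R.card : ℝ) = p - 1 := by exact_mod_cast two_mul_card_filter_eta hp4 hσ
    linarith
  have h1 : ∑ q ∈ Z, (1 : ℝ) = (((p : ℝ) - 1) / 2) ^ 2 := by
    have h := congrArg (Int.cast : ℤ → ℝ) (sum_filter_predB hp4 (σ := σ) (fun _ => 1))
    push_cast at h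
    rw [← hZ, ← hR] at h
    rw [h, Finset.sum_const, Finset.sum_const, nsmul_eq_mul, nsmul_eq_mul, mul_one, hcard, sq]
  have h2 : ∑ q ∈ Z, (eta p q.1 : ℝ) = - σ * eta p 2 * (((p : ℝ) - 1) / 2) := by
    have h := congrArg (Int.cast : ℤ → ℝ) (sum_filter_predB hp4 (σ := σ) (eta p))
    simp only [div_eq_mul_inv, eta_mul, eta_inv, ← Finset.sum_mul] at h
    have h3 := congrArg (Int.cast : ℤ → ℝ) (sum_filter_eta_eta_add hp4 hσ)
    push_cast at h h3
    rw [h]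
    linear_combination (eta p 2 : ℝ) / 2 * h3
  have hsub : ∀ F : ZMod p → ℝ, ∑ q ∈ Z, (if q.2 = 0 then F q.1 else 0) = ∑ u ∈ R, F u := by
    intro F
    rw [hZ, hR, Finset.sum_filter, Finset.sum_filter, Fintype.sum_prod_type]
    refine Finset.sum_congr rfl fun u _ => ?_
    rw [Finset.sum_eq_single (0 : ZMod p)]
    · simp [predB]
    · intro v _ hv
      simp [hv]
    · simp
  have h3 := hsub fun _ => 1
  have h4 := hsub fun u => (eta p u : ℝ)
  have h5 : ∑ u ∈ R, (eta p u : ℝ) = σ * (((p : ℝ) - 1) / 2) := by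
    rw [Finset.sum_congr rfl (g := fun _ => (σ : ℝ)) fun u hu => by
      rw [(Finset.mem_filter.1 hu).2], Finset.sum_const, nsmul_eq_mul, hcard, mul_comm]
  rw [Finset.sum_const, nsmul_eq_mul, mul_one, hcard] at h3
  rw [h5] at h4
  have h6 : ∀ q : ZMod p × ZMod p, (A + B * eta p q.1) * (N + if q.2 = 0 then C else 0)
      = A * N * 1 + B * N * eta p q.1 + A * C * (if q.2 = 0 then 1 else 0)
        + B * C * (if q.2 = 0 then (eta p q.1 : ℝ) else 0) := by
    intro q
    split_ifs <;> ring
  rw [Finset.sum_congr rfl fun q _ => h6 q]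
  simp only [Finset.sum_add_distrib, ← Finset.mul_sum]
  rw [h1, h2, h3, h4]
  ring

/-- The closed form of `B_{S_q}` and `B_{N_sq}` when `m - s` is odd and `m - t` is even. -/
lemma pairCount_predB (hp4 : p % 4 = 1) (hK : Fintype.card K = p ^ m)
    (hf : IsPlateaued p m s f) (hf0 : f 0 = 0) (hdf : IsSignDual p m s f εf fd)
    (hg : IsPlateaued p m t g) (hg0 : g 0 = 0) (hdg : IsSignDual p m t g εg gd)
    (hodd : Odd ((m : ℤ) - s)) (hst : Odd (s + t)) {σ : ℤ} (hσ : σ = 1 ∨ σ = -1) :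
    (pairCount p m s t f g fd gd (predB p {c | eta p c = σ}) : ℝ)
      = bFormula p ((m : ℤ) - s) ((m : ℤ) - t) εf εg σ := by
  classical
  have hp0 : (p : ℝ) ≠ 0 := by exact_mod_cast (Fact.out (p := p.Prime)).ne_zero
  have hms := hf.1
  have hmt := hg.1
  obtain ⟨j, i, hj, hi⟩ := exists_half_dims hf.1 hodd hst
  have hF := dualCount_cast_of_odd hp4 hK hf hf0 hdf hj
  have hG := dualCount_cast_of_even hK hg hg0 hdg hi
  rw [pairCount_eq_sum]
  push_cast
  simp only [hF, hG]
  rw [sum_predB hp4 hσ]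
  have k1 : (m : ℤ) - s = 2 * j + 1 := by lia
  have k2 : (m : ℤ) - t = 2 * i := by lia
  have e1 : Real.sqrt p ^ ((m : ℤ) - s + ((m : ℤ) - t) - 3) = (p : ℝ) ^ j * p ^ i / p := by
    rw [show (m : ℤ) - s + ((m : ℤ) - t) - 3 = 2 * ((j : ℤ) + i - 1) by lia, sqrt_zpow_two_mul,
      zpow_sub₀ hp0, zpow_add₀ hp0, zpow_natCast, zpow_natCast, zpow_one]
  have e2 : Real.sqrt p ^ ((m : ℤ) - s + ((m : ℤ) - t) - 1) = (p : ℝ) ^ j * p ^ i := by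
    rw [show (m : ℤ) - s + ((m : ℤ) - t) - 1 = 2 * ((j : ℤ) + i) by lia, sqrt_zpow_two_mul,
      zpow_add₀ hp0, zpow_natCast, zpow_natCast]
  have e3 : Real.sqrt p ^ ((m : ℤ) - t) = (p : ℝ) ^ i := by
    rw [k2, sqrt_zpow_two_mul, zpow_natCast]
  have e4 : Real.sqrt p ^ ((m : ℤ) - s - 1) = (p : ℝ) ^ j := by
    rw [k1, show (2 * (j : ℤ) + 1 - 1) = 2 * (j : ℤ) by ring, sqrt_zpow_two_mul, zpow_natCast]
  rw [bFormula, e1, e2, e3, e4, pow_mul', pow_mul']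
  field_simp
  ring

end PairCounts

/-! ### The weight distribution in terms of the dual values -/

section Distribution

variable {K : Type*} [Field K] [Fintype K] {p m s t : ℕ} [Fact p.Prime] [Algebra (ZMod p) K]
variable {f g fd gd : K → ZMod p} {εf εg : ℤ} {k l : ℕ}

lemma pairSum_zero_zero : pairSum p k l 0 0 = 0 := by
  simp [pairSum, eta_zero]

lemma abs_pairSum_le (hk : 0 < k) (hl : 0 < l) (u v : ZMod p) : |pairSum p k l u v| ≤ p - 1 := by
  rw [pairSum, ← sum_erase_zero _ (by simp [hk.ne', hl.ne', eta_zero]), ← card_erase_zero]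
  refine (Finset.abs_sum_le_sum_abs _ _).trans ?_
  rw [← nsmul_one, ← Finset.sum_const]
  refine Finset.sum_le_sum fun c _ => ?_
  rcases eta_trichotomy (c ^ k * u + c ^ l * v) with h | h | h <;> simp [h]

lemma one_lt_cast : (1 : ℝ) < p := by exact_mod_cast (Fact.out (p := p.Prime)).one_lt

lemma dev_pos : 0 < dev p m s t :=
  zpow_pos (Real.sqrt_pos.2 (zero_lt_one.trans one_lt_cast)) _

lemma mainWeight_pos : 0 < mainWeight p m :=
  mul_pos (sub_pos.2 one_lt_cast) (zpow_pos (zero_lt_one.trans one_lt_cast) _)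

/-- This is where the bound on `s + t` is used. -/
lemma dev_lt (hst : s + t + 2 ≤ 2 * m) : ((p : ℝ) - 1) * dev p m s t < mainWeight p m := by
  have hp1 := one_lt_cast (p := p)
  have h1 : (p : ℝ) ^ 2 * (((p : ℝ) - 1) * dev p m s t) < (p : ℝ) ^ 2 * mainWeight p m := by
    rw [mainWeight_eq, mul_left_comm, dev_eq]
    refine mul_lt_mul_of_pos_left ?_ (sub_pos.2 hp1)
    have : (p : ℝ) ^ (2 * m) = Real.sqrt p ^ (4 * m) := by
      conv_lhs => rw [← Real.sq_sqrt (Nat.cast_nonneg p)]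
      rw [← pow_mul]; congr 1; ring
    rw [this]
    exact pow_lt_pow_right₀ (Real.lt_sqrt_of_sq_lt (by simpa using hp1)) (by lia)
  exact lt_of_mul_lt_mul_left h1 (by positivity)

lemma sign_mul (hε : εf = 1 ∨ εf = -1) (hε' : εg = 1 ∨ εg = -1) :
    εf * εg = 1 ∨ εf * εg = -1 := by
  rcases hε with rfl | rfl <;> rcases hε' with rfl | rfl <;> simp

/-- As `|∑_c η(c ^ k u + c ^ l v)| ≤ p - 1`, all non-zero points give non-zero codewords. -/
lemma hammingNorm_pos (hp4 : p % 4 = 1) (hK : Fintype.card K = p ^ m) (hodd : Odd (s + t))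
    (hst : s + t + 2 ≤ 2 * m)
    (hf : HasDual p m s f εf fd k) (hg : HasDual p m t g εg gd l) {ab : K × K} (hab : ab ≠ 0) :
    0 < (hammingNorm (codewordMap p (definingSet p f g) ab) : ℝ) := by
  obtain ⟨a, b⟩ := ab
  by_cases hS : a ∈ walshSupport p m s f ∧ b ∈ walshSupport p m t g
  · rw [hammingNorm_of_mem hp4 hK hodd hf hg hab hS.1 hS.2, sub_pos]
    refine lt_of_le_of_lt ?_ (dev_lt hst)
    have h1 : |(pairSum p k l (fd a) (gd b) : ℝ)| ≤ (p : ℝ) - 1 := by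
      exact_mod_cast abs_pairSum_le hf.pos hg.pos (fd a) (gd b)
    have h2 := dev_pos (p := p) (m := m) (s := s) (t := t)
    rw [mul_right_comm]
    refine mul_le_mul_of_nonneg_right ((le_abs_self _).trans ?_) h2.le
    rw [abs_mul]
    rcases sign_mul hf.signDual.1 hg.signDual.1 with h | h <;> rw [h] <;> simpa using h1
  · rw [hammingNorm_of_not_mem hp4 hK hodd hf hg hab hS]
    exact mainWeight_pos

lemma codewordMap_injective (hp4 : p % 4 = 1) (hK : Fintype.card K = p ^ m) (hodd : Odd (s + t))
    (hst : s + t + 2 ≤ 2 * m)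
    (hf : HasDual p m s f εf fd k) (hg : HasDual p m t g εg gd l) :
    Function.Injective (codewordMap p (definingSet p f g)) := by
  rw [injective_iff_map_eq_zero]
  intro ab h
  by_contra hab
  have := hammingNorm_pos hp4 hK hodd hst hf hg hab
  rw [h, hammingNorm_zero] at this
  simp at this

lemma hasParameters_code (hp4 : p % 4 = 1) (hm : 2 ≤ m) (hK : Fintype.card K = p ^ m)
    (hodd : Odd (s + t)) (hst : s + t + 2 ≤ 2 * m)
    (hf : HasDual p m s f εf fd k) (hg : HasDual p m t g εg gd l) :
    HasParameters (code p (definingSet p f g)) (p ^ (2 * m - 1) - 1) (2 * m) := by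
  refine ⟨?_, ?_⟩
  · rw [Fintype.card_coe, card_definingSet hp4 hm hK hodd hf hg]
  · rw [code, LinearMap.finrank_range_of_inj (codewordMap_injective hp4 hK hodd hst hf hg),
      Module.finrank_prod]
    have h : Module.finrank (ZMod p) K = m := by
      have h1 := Module.card_eq_pow_finrank (K := ZMod p) (V := K)
      rw [hK, ZMod.card] at h1
      exact (Nat.pow_right_injective (Fact.out (p := p.Prime)).two_le h1).symm
    rw [h]; ring

/-- If the encoding map is injective, its weights give the weight distribution. -/
lemma hasWeightDistribution_sum (D : Finset (K × K))
    (hinj : Function.Injective (codewordMap p D)) :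
    HasWeightDistribution (code p D)
      (∑ ab : K × K, Finsupp.single (hammingNorm (codewordMap p D ab) : ℝ) 1) := by
  classical
  intro x
  have h1 : {c : D → ZMod p | c ∈ code p D ∧ (hammingNorm c : ℝ) = x}
      = codewordMap p D '' {ab | (hammingNorm (codewordMap p D ab) : ℝ) = x} := by
    ext c
    simp only [code, LinearMap.mem_range, Set.mem_ofPred_eq, Set.mem_image]
    constructor
    · rintro ⟨⟨ab, rfl⟩, h⟩
      exact ⟨ab, h, rfl⟩
    · rintro ⟨ab, h, rfl⟩
      exact ⟨⟨ab, rfl⟩, h⟩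
  have h2 : {ab : K × K | (hammingNorm (codewordMap p D ab) : ℝ) = x}
      = ((Finset.univ.filter fun ab : K × K => (hammingNorm (codewordMap p D ab) : ℝ) = x :
        Finset (K × K)) : Set (K × K)) := by
    ext ab; simp
  rw [h1, Set.ncard_image_of_injective _ hinj, h2, Set.ncard_coe_finset, Finset.card_filter,
    Finsupp.finsetSum_apply]
  push_cast
  exact Finset.sum_congr rfl fun ab _ => by rw [Finsupp.single_apply]

/-- The weight of the codewords that belong to a pair of dual values. -/
noncomputable def pairWeight (p m s t : ℕ) [Fact p.Prime] (ε : ℤ) (k l : ℕ)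
    (q : ZMod p × ZMod p) : ℝ :=
  mainWeight p m - ε * dev p m s t * pairSum p k l q.1 q.2

/-- The weights of all codewords, grouped by the dual values. The point `(0, 0)` lies in the product
of the Walsh supports but does not follow the pattern; its codeword is zero. -/
lemma sum_single_hammingNorm (hp4 : p % 4 = 1) (hK : Fintype.card K = p ^ m) (hodd : Odd (s + t))
    (hf : HasDual p m s f εf fd k) (hg : HasDual p m t g εg gd l) :
    ∑ ab : K × K, Finsupp.single
        (hammingNorm (codewordMap p (definingSet p f g) ab) : ℝ) (1 : ℝ)
      = Finsupp.single 0 1 + Finsupp.single (mainWeight p m) ((p : ℝ) ^ (2 * m) - 1 -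
          ∑ q : ZMod p × ZMod p, (dualCount p m s f fd q.1 * dualCount p m t g gd q.2 : ℝ))
        + ∑ q : ZMod p × ZMod p, Finsupp.single (pairWeight p m s t (εf * εg) k l q)
            (dualCount p m s f fd q.1 * dualCount p m t g gd q.2 : ℝ) := by
  classical
  set W := mainWeight p m
  set S := supportFinset p m s f ×ˢ supportFinset p m t g with hS
  have h0S : (0 : K × K) ∈ S :=
    Finset.mem_product.2 ⟨mem_supportFinset.2 (hf.zero_mem hp4 hK),
      mem_supportFinset.2 (hg.zero_mem hp4 hK)⟩
  have hw0 : pairWeight p m s t (εf * εg) k l (fd 0, gd 0) = W := by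
    rw [pairWeight, hf.dual_zero hp4 hK, hg.dual_zero hp4 hK, pairSum_zero_zero]
    simp [W]
  -- every point, compared with the pattern
  have h1 : ∀ ab : K × K,
      Finsupp.single (hammingNorm (codewordMap p (definingSet p f g) ab) : ℝ) (1 : ℝ)
      = Finsupp.single W 1
        + (if ab ∈ S then Finsupp.single
            (pairWeight p m s t (εf * εg) k l (fd ab.1, gd ab.2)) 1 - Finsupp.single W 1 else 0)
        + (if ab = 0 then Finsupp.single 0 1 - Finsupp.single W 1 else 0) := by
    intro ab
    by_cases hab : ab = 0
    · subst hab
      rw [if_pos h0S, if_pos rfl, map_zero, hammingNorm_zero, Prod.fst_zero, Prod.snd_zero, hw0]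
      simp
    · rw [if_neg hab, add_zero]
      by_cases hab' : ab ∈ S
      · have h2 := Finset.mem_product.1 hab'
        rw [if_pos hab', add_sub_cancel, pairWeight, ← hammingNorm_of_mem hp4 hK hodd hf hg hab
          (mem_supportFinset.1 h2.1) (mem_supportFinset.1 h2.2)]
      · rw [if_neg hab', add_zero, hammingNorm_of_not_mem hp4 hK hodd hf hg (a := ab.1)
          (b := ab.2) hab]
        intro h2
        exact hab' (Finset.mem_product.2 ⟨mem_supportFinset.2 h2.1, mem_supportFinset.2 h2.2⟩)
  have hcardK : ((Finset.univ : Finset (K × K)).card : ℝ) = (p : ℝ) ^ (2 * m) := by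
    rw [Finset.card_univ, Fintype.card_prod, hK]
    push_cast
    ring
  have h2 := sum_support_prod_eq (m := m) (s := s) (t := t) f g fd gd fun q =>
    Finsupp.single (pairWeight p m s t (εf * εg) k l q) (1 : ℝ) - Finsupp.single W 1
  rw [Finset.sum_congr rfl fun ab _ => h1 ab, Finset.sum_add_distrib, Finset.sum_add_distrib,
    ← Finset.sum_filter, Finset.filter_mem_eq_inter, Finset.univ_inter, Finset.sum_ite_eq',
    if_pos (Finset.mem_univ _), Finset.sum_const, h2]
  simp only [smul_sub, Finset.sum_sub_distrib, Finsupp.smul_single, nsmul_eq_mul, mul_one, hcardK,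
    Nat.cast_mul, ← Finsupp.single_finsetSum, Finsupp.single_sub]
  abel

open scoped Classical in
/-- The weight distribution, when the pairs of dual values that satisfy `Q` are listed one by one,
and the others are grouped by the values `τ` of `∑_c η(c ^ k u + c ^ l v)`. -/
lemma hasWeightDistribution_code (hp4 : p % 4 = 1) (hK : Fintype.card K = p ^ m)
    (hodd : Odd (s + t)) (hst : s + t + 2 ≤ 2 * m)
    (hf : HasDual p m s f εf fd k) (hg : HasDual p m t g εg gd l)
    (V : Finset ℤ) (h0 : 0 ∉ V) (Q : ZMod p → ZMod p → Prop)
    (hV : ∀ u v, ¬ Q u v → pairSum p k l u v ∈ insert 0 V) :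
    HasWeightDistribution (code p (definingSet p f g))
      (Finsupp.single 0 1 + Finsupp.single (mainWeight p m) ((p : ℝ) ^ (2 * m) - 1
          - ∑ τ ∈ V, (pairCount p m s t f g fd gd
              (fun u v => ¬ Q u v ∧ pairSum p k l u v = τ) : ℝ)
          - ∑ q ∈ Finset.univ.filter (fun q : ZMod p × ZMod p => Q q.1 q.2),
              (dualCount p m s f fd q.1 * dualCount p m t g gd q.2 : ℝ))
        + ∑ τ ∈ V, Finsupp.single (mainWeight p m - (εf * εg : ℤ) * dev p m s t * τ)
            (pairCount p m s t f g fd gd (fun u v => ¬ Q u v ∧ pairSum p k l u v = τ) : ℝ)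
        + ∑ q ∈ Finset.univ.filter (fun q : ZMod p × ZMod p => Q q.1 q.2),
            Finsupp.single (pairWeight p m s t (εf * εg) k l q)
              (dualCount p m s f fd q.1 * dualCount p m t g gd q.2 : ℝ)) := by
  have h := hasWeightDistribution_sum _ (codewordMap_injective hp4 hK hodd hst hf hg)
  rw [sum_single_hammingNorm hp4 hK hodd hf hg] at h
  convert h using 1
  set n : ZMod p × ZMod p → ℝ := fun q =>
    (dualCount p m s f fd q.1 * dualCount p m t g gd q.2 : ℝ) with hn
  set A := Finset.univ.filter (fun q : ZMod p × ZMod p => Q q.1 q.2)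
  set B := Finset.univ.filter (fun q : ZMod p × ZMod p => ¬ Q q.1 q.2) with hB
  set M : ℤ → ℝ := fun τ => (pairCount p m s t f g fd gd
              (fun u v => ¬ Q u v ∧ pairSum p k l u v = τ) : ℝ) with hM
  have hmaps : ∀ q ∈ B, pairSum p k l q.1 q.2 ∈ insert 0 V := fun q hq =>
    hV _ _ (Finset.mem_filter.1 hq).2
  have hMeq : ∀ τ, M τ = ∑ q ∈ B with pairSum p k l q.1 q.2 = τ, n q := by
    intro τ
    rw [hM, hB, Finset.filter_filter]
    simp only [pairCount_eq_sum]
    push_cast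
    refine Finset.sum_congr ?_ fun _ _ => rfl
    ext q
    simp
  have h1 : ∑ q ∈ B, n q = M 0 + ∑ τ ∈ V, M τ := by
    rw [← Finset.sum_fiberwise_of_maps_to hmaps, Finset.sum_insert h0]
    simp only [hMeq]
  have h2 : ∑ q ∈ B, Finsupp.single (pairWeight p m s t (εf * εg) k l q) (n q)
      = Finsupp.single (mainWeight p m) (M 0) +
        ∑ τ ∈ V, Finsupp.single (mainWeight p m - (εf * εg : ℤ) * dev p m s t * τ) (M τ) := by
    have h3 : ∀ τ : ℤ, ∑ q ∈ B with pairSum p k l q.1 q.2 = τ,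
        Finsupp.single (pairWeight p m s t (εf * εg) k l q) (n q)
        = Finsupp.single (mainWeight p m - (εf * εg : ℤ) * dev p m s t * τ) (M τ) := by
      intro τ
      rw [hMeq, Finsupp.single_finsetSum]
      refine Finset.sum_congr rfl fun q hq => ?_
      rw [pairWeight, (Finset.mem_filter.1 hq).2]
    rw [← Finset.sum_fiberwise_of_maps_to hmaps, Finset.sum_insert h0]
    simp only [h3]
    simp
  have h4 : ∑ q, n q = ∑ q ∈ A, n q + (M 0 + ∑ τ ∈ V, M τ) := by
    rw [← h1, Finset.sum_filter_add_sum_filter_not]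
  have h5 : ∑ q, Finsupp.single (pairWeight p m s t (εf * εg) k l q) (n q)
      = ∑ q ∈ A, Finsupp.single (pairWeight p m s t (εf * εg) k l q) (n q)
        + (Finsupp.single (mainWeight p m) (M 0) +
        ∑ τ ∈ V, Finsupp.single (mainWeight p m - (εf * εg : ℤ) * dev p m s t * τ) (M τ)) := by
    rw [← h2, Finset.sum_filter_add_sum_filter_not]
  change _ = Finsupp.single 0 1 + Finsupp.single (mainWeight p m) ((p : ℝ) ^ (2 * m) - 1 -
    ∑ q, n q) + ∑ q, Finsupp.single (pairWeight p m s t (εf * εg) k l q) (n q)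
  rw [h4, h5]
  simp only [Finsupp.single_sub, Finsupp.single_add]
  abel

/-- The number of weights: there is one for each value of `∑_c η(c ^ k u + c ^ l v)`; the value `0`
always occurs, as the weight of the points outside of the product of the Walsh supports. -/
lemma isWeightCode_code (hp4 : p % 4 = 1) (hK : Fintype.card K = p ^ m)
    (hodd : Odd (s + t)) (hst : s + t + 2 ≤ 2 * m)
    (hf : HasDual p m s f εf fd k) (hg : HasDual p m t g εg gd l)
    (V : Finset ℤ) (h0 : 0 ∉ V) (hV : ∀ u v, pairSum p k l u v ∈ insert 0 V)
    (hne : ∀ τ ∈ V, pairCount p m s t f g fd gd (fun u v => pairSum p k l u v = τ) ≠ 0) :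
    IsWeightCode (code p (definingSet p f g)) (V.card + 1) := by
  classical
  have hp := Fact.out (p := p.Prime)
  set w : ℤ → ℝ := fun τ => mainWeight p m - (εf * εg : ℤ) * dev p m s t * τ with hw
  have hwinj : Function.Injective w := by
    intro a b hab
    have h1 : ((εf * εg : ℤ) : ℝ) * dev p m s t ≠ 0 := by
      refine mul_ne_zero ?_ dev_pos.ne'
      rcases sign_mul hf.signDual.1 hg.signDual.1 with h | h <;> rw [h] <;> simp
    exact_mod_cast mul_left_cancel₀ h1 (sub_right_injective hab)
  have hcount : ∀ n : ℕ, weightCount (code p (definingSet p f g)) n ≠ 0 ↔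
      ∃ ab, hammingNorm (codewordMap p (definingSet p f g) ab) = n := by
    intro n
    rw [weightCount, Ne, Set.ncard_eq_zero (Set.toFinite _), ← Ne, ← Set.nonempty_iff_ne_empty]
    constructor
    · rintro ⟨c, ⟨ab, rfl⟩, h⟩
      exact ⟨ab, h⟩
    · rintro ⟨ab, h⟩
      exact ⟨_, ⟨ab, rfl⟩, h⟩
  have hset : (Nat.cast : ℕ → ℝ) '' {n : ℕ | 1 ≤ n ∧ n ≤ Fintype.card (definingSet p f g) ∧
      weightCount (code p (definingSet p f g)) n ≠ 0} = ((insert 0 V).image w : Finset ℝ) := by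
    ext x
    simp only [Set.mem_image, Set.mem_ofPred_eq, hcount, Finset.coe_image, Finset.mem_coe]
    constructor
    · rintro ⟨n, ⟨hn1, -, ⟨a, b⟩, rfl⟩, rfl⟩
      have hab : (a, b) ≠ (0, 0) := by
        intro h
        have h' : (a, b) = (0 : K × K) := h
        rw [h', map_zero, hammingNorm_zero] at hn1
        exact absurd hn1 (by norm_num)
      by_cases hS : a ∈ walshSupport p m s f ∧ b ∈ walshSupport p m t g
      · exact ⟨_, hV _ _, (hammingNorm_of_mem hp4 hK hodd hf hg hab hS.1 hS.2).symm⟩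
      · refine ⟨0, Finset.mem_insert_self _ _, ?_⟩
        rw [hammingNorm_of_not_mem hp4 hK hodd hf hg hab hS, hw]
        simp
    · rintro ⟨τ, hτ, rfl⟩
      obtain ⟨ab, hab, hwt⟩ : ∃ ab : K × K, ab ≠ 0 ∧
          (hammingNorm (codewordMap p (definingSet p f g) ab) : ℝ) = w τ := by
        rcases Finset.mem_insert.1 hτ with rfl | hτ
        · obtain ⟨ab, -, hab⟩ : ∃ ab ∈ (Finset.univ : Finset (K × K)),
              ab ∉ supportFinset p m s f ×ˢ supportFinset p m t g := by
            refine Finset.exists_mem_notMem_of_card_lt_card ?_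
            rw [Finset.card_product, hf.plateaued.card_support hK, hg.plateaued.card_support hK,
              Finset.card_univ, Fintype.card_prod, hK, ← pow_add, ← pow_add]
            refine Nat.pow_lt_pow_right hp.one_lt ?_
            have := hf.plateaued.1
            have := hg.plateaued.1
            obtain ⟨j, hj⟩ := hodd
            lia
          rw [Finset.mem_product, mem_supportFinset, mem_supportFinset] at hab
          have hab0 : ab ≠ 0 := by
            rintro rfl
            exact hab ⟨hf.zero_mem hp4 hK, hg.zero_mem hp4 hK⟩
          refine ⟨ab, hab0, ?_⟩
          rw [hammingNorm_of_not_mem hp4 hK hodd hf hg (a := ab.1) (b := ab.2) hab0 hab, hw]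
          simp
        · have h1 := hne τ hτ
          rw [pairCount, Ne, Set.ncard_eq_zero (Set.toFinite _), ← Ne,
            ← Set.nonempty_iff_ne_empty] at h1
          obtain ⟨⟨a, b⟩, ha, hb, hab⟩ := h1
          have hab0 : (a, b) ≠ (0, 0) := by
            intro h
            rw [Prod.mk.injEq] at h
            rw [h.1, h.2, hf.dual_zero hp4 hK, hg.dual_zero hp4 hK, pairSum_zero_zero] at hab
            exact h0 (hab ▸ hτ)
          exact ⟨(a, b), hab0, by rw [hammingNorm_of_mem hp4 hK hodd hf hg hab0 ha hb, hab]⟩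
      refine ⟨_, ⟨?_, hammingNorm_le_card_fintype, ab, rfl⟩, hwt⟩
      exact_mod_cast hammingNorm_pos hp4 hK hodd hst hf hg hab
  rw [IsWeightCode, ← Set.ncard_image_of_injective _ (Nat.cast_injective (R := ℝ)), hset,
    Set.ncard_coe_finset, Finset.card_image_of_injective _ hwinj, Finset.card_insert_of_notMem h0]

end Distribution

/-! ### The four tables -/

section Tables

variable {K : Type*} [Field K] [Fintype K] {p m s t : ℕ} [Fact p.Prime] [Algebra (ZMod p) K]
variable {f g fd gd : K → ZMod p} {εf εg : ℤ} {k l : ℕ}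

lemma pairCount_ne_zero (hp4 : p % 4 = 1) (hK : Fintype.card K = p ^ m)
    (hf : HasDual p m s f εf fd k) (hg : HasDual p m t g εg gd l) (hs : s + 2 ≤ m)
    (ht : t + 2 ≤ m) {P : ZMod p → ZMod p → Prop} {u v : ZMod p} (h : P u v) :
    pairCount p m s t f g fd gd P ≠ 0 := by
  classical
  rw [pairCount_eq_sum]
  intro h0
  rw [Finset.sum_eq_zero_iff] at h0
  rcases mul_eq_zero.1 (h0 (u, v) (Finset.mem_filter.2 ⟨Finset.mem_univ _, h⟩)) with h1 | h1
  · exact dualCount_ne_zero hp4 hK hf.plateaued hf.map_zero hf.signDual hs u h1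
  · exact dualCount_ne_zero hp4 hK hg.plateaued hg.map_zero hg.signDual ht v h1

open scoped Classical in
/-- The weight distribution when all dual values are grouped. -/
lemma hasWeightDistribution_code_of_values (hp4 : p % 4 = 1) (hK : Fintype.card K = p ^ m)
    (hodd : Odd (s + t)) (hst : s + t + 2 ≤ 2 * m)
    (hf : HasDual p m s f εf fd k) (hg : HasDual p m t g εg gd l)
    (V : Finset ℤ) (h0 : 0 ∉ V) (hV : ∀ u v, pairSum p k l u v ∈ insert 0 V) :
    HasWeightDistribution (code p (definingSet p f g))
      (Finsupp.single 0 1 + Finsupp.single (mainWeight p m) ((p : ℝ) ^ (2 * m) - 1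
          - ∑ τ ∈ V, (pairCount p m s t f g fd gd (fun u v => pairSum p k l u v = τ) : ℝ))
        + ∑ τ ∈ V, Finsupp.single (mainWeight p m - (εf * εg : ℤ) * dev p m s t * τ)
            (pairCount p m s t f g fd gd (fun u v => pairSum p k l u v = τ) : ℝ)) := by
  have h := hasWeightDistribution_code hp4 hK hodd hst hf hg V h0 (fun _ _ => False)
    fun u v _ => hV u v
  simpa using h

lemma zpow_two_mul_natCast (p m : ℕ) : (p : ℝ) ^ (2 * (m : ℤ)) = (p : ℝ) ^ (2 * m) := by
  rw [← zpow_natCast]; push_cast; rfl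

/-- The values of the weight sum when both indices are `(p - 1) / 2`. -/
lemma pairSum_half_half_eq_iff (hp4 : p % 4 = 1) (σ : ℤ) (u v : ZMod p) :
    pairSum p ((p - 1) / 2) ((p - 1) / 2) u v = σ * (p - 1) ↔ eta p (u + v) = σ := by
  have h5 := five_le hp4
  rw [pairSum_half_half hp4, mul_comm]
  exact mul_left_inj' (by lia)

lemma values_half_half (hp4 : p % 4 = 1) (u v : ZMod p) :
    pairSum p ((p - 1) / 2) ((p - 1) / 2) u v
      ∈ insert 0 ({1 * ((p : ℤ) - 1), -1 * ((p : ℤ) - 1)} : Finset ℤ) := by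
  rw [pairSum_half_half hp4]
  rcases eta_trichotomy (u + v) with h | h | h <;> rw [h] <;> simp

/-- Both dual functions scale by `η c`, so the character sum is `(p - 1) η (u + v)`. -/
theorem table1_correct (hp4 : p % 4 = 1) (hK : Fintype.card K = p ^ m)
    (hodd : Odd (s + t)) (hst : s + t + 2 ≤ 2 * m)
    (hf : HasDual p m s f εf fd ((p - 1) / 2)) (hg : HasDual p m t g εg gd ((p - 1) / 2)) :
    IsWeightCode (code p (definingSet p f g)) 3 ∧
      HasWeightDistribution (code p (definingSet p f g)) (table1 p m s t) := by
  have h5 := five_le hp4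
  have hp1 := one_lt_cast (p := p)
  set a : ℤ := 1 * ((p : ℤ) - 1) with ha
  set b : ℤ := -1 * ((p : ℤ) - 1) with hb
  have h0 : (0 : ℤ) ∉ ({a, b} : Finset ℤ) := by
    simp only [Finset.mem_insert, Finset.mem_singleton]; lia
  have hab : a ≠ b := by lia
  have hcount : ∀ σ : ℤ, σ = 1 ∨ σ = -1 →
      (pairCount p m s t f g fd gd
        (fun u v => pairSum p ((p - 1) / 2) ((p - 1) / 2) u v = σ * (p - 1)) : ℝ)
      = ((p : ℝ) - 1) / 2 * ((Real.sqrt p ^ (2 * (m : ℤ) - s - t - 1)) ^ 2 +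
          σ * (εf * εg) * Real.sqrt p ^ (2 * (m : ℤ) - s - t - 1)) := by
    intro σ hσ
    rw [pairCount_congr (pairSum_half_half_eq_iff hp4 σ)]
    exact pairCount_eta_add hp4 hK hf.plateaued hf.map_zero hf.signDual hg.plateaued hg.map_zero
      hg.signDual hodd hσ
  set X := Real.sqrt p ^ (2 * (m : ℤ) - s - t - 1) with hX
  have hX1 : 1 < X := one_lt_zpow₀ (Real.lt_sqrt_of_sq_lt (by simpa using hp1)) (by lia)
  have hX2 : (p : ℝ) ^ (2 * (m : ℤ) - s - t - 1) = X ^ 2 := by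
    rw [← sqrt_zpow_two_mul, mul_comm, zpow_mul, zpow_ofNat]
  have hca := hcount 1 (Or.inl rfl)
  have hcb := hcount (-1) (Or.inr rfl)
  push_cast at hca hcb
  have hε := sign_mul hf.signDual.1 hg.signDual.1
  refine ⟨?_, ?_⟩
  · have h := isWeightCode_code hp4 hK hodd hst hf hg {a, b} h0 (values_half_half hp4) ?_
    · rwa [Finset.card_pair hab] at h
    · intro τ hτ
      have hXX : X < X ^ 2 := by nlinarith
      rcases Finset.mem_insert.1 hτ with rfl | hτ
      · rw [← Nat.cast_ne_zero (R := ℝ), hca]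
        refine (mul_pos (by linarith) ?_).ne'
        rcases hε with h | h <;>
          rw [one_mul, show (εf * εg : ℝ) = ((εf * εg : ℤ) : ℝ) by push_cast; rfl, h] <;>
          push_cast <;> linarith
      · rw [Finset.mem_singleton.1 hτ, ← Nat.cast_ne_zero (R := ℝ), hcb]
        refine (mul_pos (by linarith) ?_).ne'
        rcases hε with h | h <;>
          rw [show (εf * εg : ℝ) = ((εf * εg : ℤ) : ℝ) by push_cast; rfl, h] <;>
          push_cast <;> linarith
  · have h := hasWeightDistribution_code_of_values hp4 hK hodd hst hf hg {a, b} h0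
      (values_half_half hp4)
    rw [Finset.sum_pair hab, Finset.sum_pair hab] at h
    convert h using 1
    rw [table1, hX2, ← hX, hca, hcb, ha, hb, zpow_two_mul_natCast]
    have e : (p : ℝ) ^ (2 * m) - (p - 1) * X ^ 2 - 1
        = (p : ℝ) ^ (2 * m) - 1 - ((p - 1) / 2 * (X ^ 2 + 1 * (εf * εg) * X) +
          (p - 1) / 2 * (X ^ 2 + -1 * (εf * εg) * X)) := by ring
    rw [← e]
    have hε' : (εf * εg : ℝ) = ((εf * εg : ℤ) : ℝ) := by push_cast; rfl
    rcases hε with h' | h' <;> rw [hε', h']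
    · rw [add_assoc _ (Finsupp.single _ _) (Finsupp.single _ _)]
      congr 3 <;> push_cast <;> ring
    · rw [add_assoc _ (Finsupp.single _ _) (Finsupp.single _ _), add_comm (Finsupp.single
        (mainWeight p m - (p - 1) * dev p m s t) _)]
      congr 3 <;> push_cast <;> ring

/-- When the indices are `p - 1` and `(p - 1) / 2`, the pairs of `E_1` and `E_2` are those where one
of `η (u + v)` and `η (u - v)` vanishes. -/
lemma pairSum_full_half_eq_iff_predE12 (hp4 : p % 4 = 1) {σ : ℤ} (hσ : σ = 1 ∨ σ = -1)
    (u v : ZMod p) :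
    pairSum p (p - 1) ((p - 1) / 2) u v = σ * eta p 2 * (((p - 1) / 2 : ℕ) : ℤ) ↔
      predE12 p {c | eta p c = σ} u v := by
  have h5 := five_le hp4
  have h2 := two_mul_pairSum_full_half hp4 u v
  have hp2 : 2 * (((p - 1) / 2 : ℕ) : ℤ) = p - 1 := by lia
  have hη2 : eta p 2 ^ 2 = 1 := eta_sq (two_ne_zero_zmod hp4)
  have hη2' : eta p 2 = 1 ∨ eta p 2 = -1 := quadraticChar_dichotomy (two_ne_zero_zmod hp4)
  have key : pairSum p (p - 1) ((p - 1) / 2) u v = σ * eta p 2 * (((p - 1) / 2 : ℕ) : ℤ) ↔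
      eta p (u + v) + eta p (u - v) = σ * eta p 2 := by
    constructor
    · intro h
      have : ((p : ℤ) - 1) * (eta p (u + v) + eta p (u - v)) = (p - 1) * (σ * eta p 2) := by
        rw [← h2, h, ← hp2]; ring
      exact mul_left_cancel₀ (by lia) this
    · intro h
      rw [h, ← hp2, mul_assoc] at h2
      have := Int.eq_of_mul_eq_mul_left two_ne_zero h2
      rw [this, mul_comm]
  rw [key]
  have hdbl : ∀ w : ZMod p, eta p (w + w) = eta p 2 * eta p w := fun w => by
    rw [← two_mul, eta_mul]
  constructor
  · intro h
    have hcase : (eta p (u + v) = 0 ∧ eta p (u - v) = σ * eta p 2) ∨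
        (eta p (u - v) = 0 ∧ eta p (u + v) = σ * eta p 2) := by
      rcases eta_trichotomy (u + v) with h1 | h1 | h1 <;>
        rcases eta_trichotomy (u - v) with h3 | h3 | h3 <;>
        rcases hσ with rfl | rfl <;> rcases hη2' with h4 | h4 <;>
        rw [h1, h3, h4] at h ⊢ <;> simp_all
    have hcancel : ∀ w, eta p 2 * eta p w = σ * eta p 2 → eta p w = σ := by
      intro w hw
      calc eta p w = eta p 2 ^ 2 * eta p w := by rw [hη2, one_mul]
        _ = eta p 2 * (eta p 2 * eta p w) := by ring
        _ = σ * eta p 2 ^ 2 := by rw [hw]; ring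
        _ = σ := by rw [hη2, mul_one]
    rcases hcase with ⟨h1, h3⟩ | ⟨h1, h3⟩
    · rw [eta_eq_zero_iff] at h1
      have hv : v = -u := by linear_combination h1
      rw [hv, sub_neg_eq_add, hdbl] at h3
      exact ⟨hcancel u h3, Or.inr hv⟩
    · rw [eta_eq_zero_iff] at h1
      have hv : v = u := by linear_combination -h1
      rw [hv, hdbl] at h3
      exact ⟨hcancel u h3, Or.inl hv⟩
  · rintro ⟨hu, rfl | rfl⟩
    · rw [Set.mem_ofPred_eq] at hu
      rw [sub_self, eta_zero, hdbl, hu]; ring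
    · rw [Set.mem_ofPred_eq] at hu
      rw [add_neg_cancel, eta_zero, sub_neg_eq_add, hdbl, hu]; ring

lemma pairSum_full_half_eq_iff_predB (hp4 : p % 4 = 1) {σ : ℤ} (hσ : σ = 1 ∨ σ = -1)
    (u v : ZMod p) :
    pairSum p (p - 1) ((p - 1) / 2) u v = σ * ((p : ℤ) - 1) ↔
      predB p {c | eta p c = σ} u v := by
  have h5 := five_le hp4
  have h2 := two_mul_pairSum_full_half hp4 u v
  have key : pairSum p (p - 1) ((p - 1) / 2) u v = σ * ((p : ℤ) - 1) ↔
      eta p (u + v) + eta p (u - v) = 2 * σ := by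
    constructor
    · intro h
      have : ((p : ℤ) - 1) * (eta p (u + v) + eta p (u - v)) = (p - 1) * (2 * σ) := by
        rw [← h2, h]; ring
      exact mul_left_cancel₀ (by lia) this
    · intro h
      rw [h] at h2
      exact Int.eq_of_mul_eq_mul_left two_ne_zero (by rw [h2]; ring)
  rw [key, predB, Set.mem_ofPred_eq, Set.mem_ofPred_eq]
  rcases eta_trichotomy (u + v) with h1 | h1 | h1 <;>
    rcases eta_trichotomy (u - v) with h3 | h3 | h3 <;>
    rcases hσ with rfl | rfl <;> rw [h1, h3] <;> norm_num

/-- The character sum is `(p - 1) / 2 * (η (u + v) + η (u - v))`: the `E` count the pairs where one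
summand vanishes, the `B` those where both summands are equal and non-zero. -/
theorem table2_correct (hp4 : p % 4 = 1) (hK : Fintype.card K = p ^ m)
    (hodd : Odd (s + t)) (hst : s + t + 2 ≤ 2 * m)
    (hf : HasDual p m s f εf fd (p - 1)) (hg : HasDual p m t g εg gd ((p - 1) / 2)) :
    (s + 2 ≤ m → t + 2 ≤ m → IsWeightCode (code p (definingSet p f g)) 5) ∧
      HasWeightDistribution (code p (definingSet p f g))
        (table2 p m s t (εf * εg)
          (pairCount p m s t f g fd gd (predE12 p (squares p)))
          (pairCount p m s t f g fd gd (predE12 p (nonSquares p)))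
          (pairCount p m s t f g fd gd (predB p (squares p)))
          (pairCount p m s t f g fd gd (predB p (nonSquares p)))) := by
  have h5 := five_le hp4
  rw [squares_eq, nonSquares_eq]
  have hη2 : eta p 2 = 1 ∨ eta p 2 = -1 :=
    quadraticChar_dichotomy (two_ne_zero_zmod hp4)
  have hE1 := pairSum_full_half_eq_iff_predE12 hp4 (σ := 1) (Or.inl rfl)
  have hE2 := pairSum_full_half_eq_iff_predE12 hp4 (σ := -1) (Or.inr rfl)
  have hB1 := pairSum_full_half_eq_iff_predB hp4 (σ := 1) (Or.inl rfl)
  have hB2 := pairSum_full_half_eq_iff_predB hp4 (σ := -1) (Or.inr rfl)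
  have hhalf : 2 * (((p - 1) / 2 : ℕ) : ℤ) = p - 1 := by lia
  have hhalfR : ((((p - 1) / 2 : ℕ) : ℤ) : ℝ) = ((p : ℝ) - 1) / 2 := by
    have : 2 * ((((p - 1) / 2 : ℕ) : ℤ) : ℝ) = (p : ℝ) - 1 := by exact_mod_cast hhalf
    linarith
  set a : ℤ := 1 * eta p 2 * (((p - 1) / 2 : ℕ) : ℤ) with ha
  set b : ℤ := -1 * eta p 2 * (((p - 1) / 2 : ℕ) : ℤ) with hb
  set c : ℤ := 1 * ((p : ℤ) - 1) with hc
  set d : ℤ := -1 * ((p : ℤ) - 1) with hd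
  have hab : a ∉ ({b, c, d} : Finset ℤ) := by
    simp only [Finset.mem_insert, Finset.mem_singleton]
    rcases hη2 with h | h <;> rw [ha, hb, h] <;> lia
  have hbc : b ∉ ({c, d} : Finset ℤ) := by
    simp only [Finset.mem_insert, Finset.mem_singleton]
    rcases hη2 with h | h <;> rw [hb, h] <;> lia
  have hcd : c ∉ ({d} : Finset ℤ) := by
    simp only [Finset.mem_singleton]; lia
  have h0 : (0 : ℤ) ∉ ({a, b, c, d} : Finset ℤ) := by
    simp only [Finset.mem_insert, Finset.mem_singleton]
    rcases hη2 with h | h <;> rw [ha, hb, h] <;> lia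
  have hV : ∀ u v : ZMod p, pairSum p (p - 1) ((p - 1) / 2) u v
      ∈ insert 0 ({a, b, c, d} : Finset ℤ) := by
    intro u v
    have h2 := two_mul_pairSum_full_half hp4 u v
    simp only [Finset.mem_insert, Finset.mem_singleton]
    rw [ha, hb]
    rcases eta_trichotomy (u + v) with h1 | h1 | h1 <;>
      rcases eta_trichotomy (u - v) with h3 | h3 | h3 <;>
      rcases hη2 with h4 | h4 <;> rw [h1, h3] at h2 <;> rw [h4] <;> lia
  refine ⟨fun hs ht => ?_, ?_⟩
  · have h := isWeightCode_code hp4 hK hodd hst hf hg {a, b, c, d} h0 hV ?_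
    · rwa [Finset.card_insert_of_notMem hab, Finset.card_insert_of_notMem hbc,
        Finset.card_insert_of_notMem hcd, Finset.card_singleton] at h
    · obtain ⟨j, hj⟩ := exists_eta_eq_neg_one hp4
      intro τ hτ
      simp only [Finset.mem_insert, Finset.mem_singleton] at hτ
      rcases hτ with rfl | rfl | rfl | rfl
      · exact pairCount_ne_zero hp4 hK hf hg hs ht ((hE1 1 1).2 ⟨eta_one, Or.inl rfl⟩)
      · exact pairCount_ne_zero hp4 hK hf hg hs ht ((hE2 j j).2 ⟨hj, Or.inl rfl⟩)
      · exact pairCount_ne_zero hp4 hK hf hg hs ht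
          ((hB1 1 0).2 (by simp [predB, eta_one]))
      · exact pairCount_ne_zero hp4 hK hf hg hs ht
          ((hB2 j 0).2 (by simp [predB, hj]))
  · have h := hasWeightDistribution_code_of_values hp4 hK hodd hst hf hg {a, b, c, d} h0 hV
    rw [Finset.sum_insert hab, Finset.sum_insert hbc, Finset.sum_insert hcd, Finset.sum_singleton,
      Finset.sum_insert hab, Finset.sum_insert hbc, Finset.sum_insert hcd, Finset.sum_singleton,
      pairCount_congr hE1, pairCount_congr hE2, pairCount_congr hB1, pairCount_congr hB2] at h
    have ea : (εf * εg : ℤ) * dev p m s t * a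
        = (p - 1) / 2 * (εf * εg : ℤ) * eta p 2 * dev p m s t := by
      rw [show (a : ℝ) = eta p 2 * ((p - 1) / 2) by rw [ha, one_mul, Int.cast_mul, hhalfR]]; ring
    have eb : (εf * εg : ℤ) * dev p m s t * b
        = -((p - 1) / 2 * (εf * εg : ℤ) * eta p 2 * dev p m s t) := by
      rw [show (b : ℝ) = -(eta p 2 * ((p - 1) / 2)) by
        rw [hb, neg_one_mul, neg_mul, Int.cast_neg, Int.cast_mul, hhalfR]]
      ring
    have ec : (εf * εg : ℤ) * dev p m s t * c = (p - 1) * (εf * εg : ℤ) * dev p m s t := by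
      rw [hc]; push_cast; ring
    have ed : (εf * εg : ℤ) * dev p m s t * d = -((p - 1) * (εf * εg : ℤ) * dev p m s t) := by
      rw [hd]; push_cast; ring
    rw [ea, eb, ec, ed, sub_neg_eq_add, sub_neg_eq_add] at h
    convert h using 1
    rw [table2, zpow_two_mul_natCast]
    simp only [← add_assoc, ← sub_sub]

lemma pairSum_two_half_eq_iff_predE34 (hp4 : p % 4 = 1) {σ : ℤ} (hσ : σ = 1 ∨ σ = -1)
    {u v : ZMod p} (huv : u = 0 ∨ v = 0) :
    pairSum p 2 ((p - 1) / 2) u v = σ * ((p : ℤ) - 1) ↔ predE34 p {c | eta p c = σ} u v := by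
  have h5 := five_le hp4
  have hσ0 : (0 : ℤ) ≠ σ := by rcases hσ with h | h <;> simp [h]
  have hcancel : ∀ w : ZMod p, ((p : ℤ) - 1) * eta p w = σ * (p - 1) ↔ eta p w = σ := fun w => by
    rw [mul_comm]
    exact mul_left_inj' (by lia)
  simp only [predE34, Set.mem_ofPred_eq]
  rcases huv with rfl | rfl
  · rw [pairSum_two_half_zero_left hp4, hcancel]
    simp [eta_zero, hσ0]
  · rw [pairSum_two_half_zero_right, hcancel]
    simp [eta_zero, hσ0]

/-- The number of pairs of dual values in one and the same class modulo squares. -/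
lemma pairCount_eta_eq_eta_eq (hp4 : p % 4 = 1) (hK : Fintype.card K = p ^ m)
    (hf : HasDual p m s f εf fd k) (hg : HasDual p m t g εg gd l) {σ : ℤ} (hσ : σ = 1 ∨ σ = -1)
    {i : ZMod p} (hi : eta p i = σ) :
    (pairCount p m s t f g fd gd (fun u v => eta p u = σ ∧ eta p v = σ) : ℝ)
      = ((p : ℝ) - 1) ^ 2 / 4 * (dualCount p m s f fd i * dualCount p m t g gd i) := by
  set S := Finset.univ.filter fun c : ZMod p => eta p c = σ with hS
  have hcard : (S.card : ℝ) = ((p : ℝ) - 1) / 2 := by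
    have : 2 * (S.card : ℝ) = p - 1 := by exact_mod_cast two_mul_card_filter_eta hp4 hσ
    linarith
  have h1 : pairCount p m s t f g fd gd (fun u v => eta p u = σ ∧ eta p v = σ)
      = ∑ q ∈ S ×ˢ S, dualCount p m s f fd q.1 * dualCount p m t g gd q.2 := by
    rw [pairCount_eq_sum]
    exact Finset.sum_congr (by ext q; simp [hS]) fun _ _ => rfl
  rw [h1, Finset.sum_congr rfl
    (g := fun _ => dualCount p m s f fd i * dualCount p m t g gd i), Finset.sum_const,
    Finset.card_product, smul_eq_mul]
  · push_cast
    rw [hcard]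
    ring
  · intro q hq
    rw [Finset.mem_product, hS, Finset.mem_filter, Finset.mem_filter] at hq
    rw [dualCount_congr hp4 hK hf.plateaued hf.map_zero hf.signDual (hq.1.2.trans hi.symm),
      dualCount_congr hp4 hK hg.plateaued hg.map_zero hg.signDual (hq.2.2.trans hi.symm)]

/-- The character sum is `-η u - η v` for non-zero `u` and `v`, and `p - 1` times the character of
the other value if one of them vanishes. -/
theorem table3_correct (hp4 : p % 4 = 1) (h8 : p % 8 = 1) (hK : Fintype.card K = p ^ m)
    (hodd : Odd (s + t)) (hst : s + t + 2 ≤ 2 * m)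
    (hf : HasDual p m s f εf fd 2) (hg : HasDual p m t g εg gd ((p - 1) / 2)) :
    (s + 2 ≤ m → t + 2 ≤ m → IsWeightCode (code p (definingSet p f g)) 5) ∧
      ∀ i ∈ squares p, ∀ j ∈ nonSquares p,
        HasWeightDistribution (code p (definingSet p f g))
          (table3 p m s t (εf * εg)
            (pairCount p m s t f g fd gd (predE34 p (squares p)))
            (pairCount p m s t f g fd gd (predE34 p (nonSquares p)))
            (dualCount p m s f fd i * dualCount p m t g gd i)
            (dualCount p m s f fd j * dualCount p m t g gd j)) := by
  have h5 := five_le hp4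
  have h17 : 17 ≤ p := by
    have h9 : p ≠ 9 := by rintro rfl; exact absurd (Fact.out (p := Nat.Prime 9)) (by norm_num)
    lia
  rw [squares_eq, nonSquares_eq]
  set a : ℤ := 1 * ((p : ℤ) - 1) with ha
  set b : ℤ := -1 * ((p : ℤ) - 1) with hb
  have hcases : ∀ u v : ZMod p, (u = 0 ∨ v = 0) ∨ (u ≠ 0 ∧ v ≠ 0) := by
    intro u v; tauto
  have hE : ∀ σ : ℤ, σ = 1 ∨ σ = -1 → ∀ u v : ZMod p,
      pairSum p 2 ((p - 1) / 2) u v = σ * ((p : ℤ) - 1) ↔ predE34 p {c | eta p c = σ} u v := by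
    intro σ hσ u v
    rcases hcases u v with huv | ⟨hu, hv⟩
    · exact pairSum_two_half_eq_iff_predE34 hp4 hσ huv
    · rw [pairSum_two_half_of_mod_eight_eq_one hp4 h8 hu hv]
      refine iff_of_false (fun h => ?_) (by simp [predE34, hu, hv])
      rcases quadraticChar_dichotomy hu with h1 | h1 <;>
        rcases quadraticChar_dichotomy hv with h2 | h2 <;>
        rw [eta, eta, h1, h2] at h <;> rcases hσ with rfl | rfl <;> lia
  have hS : ∀ σ : ℤ, σ = 1 ∨ σ = -1 → ∀ u v : ZMod p,
      pairSum p 2 ((p - 1) / 2) u v = -2 * σ ↔ (eta p u = σ ∧ eta p v = σ) := by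
    intro σ hσ u v
    rcases hcases u v with huv | ⟨hu, hv⟩
    · have hσ0 : (0 : ℤ) ≠ σ := by rcases hσ with h | h <;> simp [h]
      refine iff_of_false (fun h => ?_) ?_
      · rcases huv with rfl | rfl
        · rw [pairSum_two_half_zero_left hp4] at h
          rcases eta_trichotomy v with h1 | h1 | h1 <;> rw [h1] at h <;>
            rcases hσ with rfl | rfl <;> lia
        · rw [pairSum_two_half_zero_right] at h
          rcases eta_trichotomy u with h1 | h1 | h1 <;> rw [h1] at h <;>
            rcases hσ with rfl | rfl <;> lia
      · rcases huv with rfl | rfl <;> simp [eta_zero, hσ0]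
    · rw [pairSum_two_half_of_mod_eight_eq_one hp4 h8 hu hv]
      rcases quadraticChar_dichotomy hu with h1 | h1 <;>
        rcases quadraticChar_dichotomy hv with h2 | h2 <;>
        rw [eta, eta, h1, h2] <;> rcases hσ with rfl | rfl <;> norm_num
  set c : ℤ := -2 * 1 with hc
  set d : ℤ := -2 * -1 with hd
  have hab : a ∉ ({b, c, d} : Finset ℤ) := by
    simp only [Finset.mem_insert, Finset.mem_singleton]; lia
  have hbc : b ∉ ({c, d} : Finset ℤ) := by
    simp only [Finset.mem_insert, Finset.mem_singleton]; lia
  have hcd : c ∉ ({d} : Finset ℤ) := by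
    simp only [Finset.mem_singleton]; lia
  have h0 : (0 : ℤ) ∉ ({a, b, c, d} : Finset ℤ) := by
    simp only [Finset.mem_insert, Finset.mem_singleton]; lia
  have hV : ∀ u v : ZMod p, pairSum p 2 ((p - 1) / 2) u v
      ∈ insert 0 ({a, b, c, d} : Finset ℤ) := by
    intro u v
    simp only [Finset.mem_insert, Finset.mem_singleton]
    rcases hcases u v with (rfl | rfl) | ⟨hu, hv⟩
    · rw [pairSum_two_half_zero_left hp4]
      rcases eta_trichotomy v with h1 | h1 | h1 <;> rw [h1] <;> lia
    · rw [pairSum_two_half_zero_right]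
      rcases eta_trichotomy u with h1 | h1 | h1 <;> rw [h1] <;> lia
    · rw [pairSum_two_half_of_mod_eight_eq_one hp4 h8 hu hv]
      rcases quadraticChar_dichotomy hu with h1 | h1 <;>
        rcases quadraticChar_dichotomy hv with h2 | h2 <;>
        rw [eta, eta, h1, h2] <;> lia
  have hE1 := hE 1 (Or.inl rfl)
  have hE2 := hE (-1) (Or.inr rfl)
  have hS1 := hS 1 (Or.inl rfl)
  have hS2 := hS (-1) (Or.inr rfl)
  refine ⟨fun hs ht => ?_, fun i hi j hj => ?_⟩
  · have h := isWeightCode_code hp4 hK hodd hst hf hg {a, b, c, d} h0 hV ?_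
    · rwa [Finset.card_insert_of_notMem hab, Finset.card_insert_of_notMem hbc,
        Finset.card_insert_of_notMem hcd, Finset.card_singleton] at h
    · obtain ⟨j, hj⟩ := exists_eta_eq_neg_one hp4
      intro τ hτ
      simp only [Finset.mem_insert, Finset.mem_singleton] at hτ
      rcases hτ with rfl | rfl | rfl | rfl
      · exact pairCount_ne_zero hp4 hK hf hg hs ht ((hE1 0 1).2 (Or.inl ⟨rfl, eta_one⟩))
      · exact pairCount_ne_zero hp4 hK hf hg hs ht ((hE2 0 j).2 (Or.inl ⟨rfl, hj⟩))
      · exact pairCount_ne_zero hp4 hK hf hg hs ht ((hS1 1 1).2 ⟨eta_one, eta_one⟩)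
      · exact pairCount_ne_zero hp4 hK hf hg hs ht ((hS2 j j).2 ⟨hj, hj⟩)
  · have h := hasWeightDistribution_code_of_values hp4 hK hodd hst hf hg {a, b, c, d} h0 hV
    rw [Finset.sum_insert hab, Finset.sum_insert hbc, Finset.sum_insert hcd, Finset.sum_singleton,
      Finset.sum_insert hab, Finset.sum_insert hbc, Finset.sum_insert hcd, Finset.sum_singleton,
      pairCount_congr hE1, pairCount_congr hE2, pairCount_congr hS1, pairCount_congr hS2,
      pairCount_eta_eq_eta_eq hp4 hK hf hg (Or.inl rfl) hi,
      pairCount_eta_eq_eta_eq hp4 hK hf hg (Or.inr rfl) hj] at h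
    have ea : (εf * εg : ℤ) * dev p m s t * a = (p - 1) * (εf * εg : ℤ) * dev p m s t := by
      rw [ha]; push_cast; ring
    have eb : (εf * εg : ℤ) * dev p m s t * b = -((p - 1) * (εf * εg : ℤ) * dev p m s t) := by
      rw [hb]; push_cast; ring
    have ec : (εf * εg : ℤ) * dev p m s t * c = -(2 * (εf * εg : ℤ) * dev p m s t) := by
      rw [hc]; push_cast; ring
    have ed : (εf * εg : ℤ) * dev p m s t * d = 2 * (εf * εg : ℤ) * dev p m s t := by
      rw [hd]; push_cast; ring
    rw [ea, eb, ec, ed, sub_neg_eq_add, sub_neg_eq_add] at h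
    convert h using 1
    rw [table3, zpow_two_mul_natCast, mul_add]
    simp only [← add_assoc, ← sub_sub]

/-- The pairs of non-zero dual values are listed one by one, those with a zero are grouped. -/
theorem table4_correct (hp4 : p % 4 = 1) (h8 : p % 8 = 5) (hK : Fintype.card K = p ^ m)
    (hodd : Odd (s + t)) (hst : s + t + 2 ≤ 2 * m)
    (hf : HasDual p m s f εf fd 2) (hg : HasDual p m t g εg gd ((p - 1) / 2)) :
    HasWeightDistribution (code p (definingSet p f g))
      (table4 p m s t (εf * εg)
        (pairCount p m s t f g fd gd (predE34 p (squares p)))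
        (pairCount p m s t f g fd gd (predE34 p (nonSquares p)))
        (fun c => dualCount p m s f fd c) (fun c => dualCount p m t g gd c)) := by
  classical
  have h5 := five_le hp4
  rw [squares_eq, nonSquares_eq]
  set a : ℤ := 1 * ((p : ℤ) - 1) with ha
  set b : ℤ := -1 * ((p : ℤ) - 1) with hb
  have hab : a ≠ b := by lia
  have h0 : (0 : ℤ) ∉ ({a, b} : Finset ℤ) := by
    simp only [Finset.mem_insert, Finset.mem_singleton]; lia
  have hE : ∀ σ : ℤ, σ = 1 ∨ σ = -1 → ∀ u v : ZMod p,
      (¬ (u ≠ 0 ∧ v ≠ 0) ∧ pairSum p 2 ((p - 1) / 2) u v = σ * ((p : ℤ) - 1)) ↔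
        predE34 p {c | eta p c = σ} u v := by
    intro σ hσ u v
    by_cases huv : u = 0 ∨ v = 0
    · rw [pairSum_two_half_eq_iff_predE34 hp4 hσ huv]
      exact and_iff_right (by tauto)
    · refine iff_of_false (by tauto) ?_
      rw [not_or] at huv
      simp [predE34, huv.1, huv.2]
  have hV : ∀ u v : ZMod p, ¬ (u ≠ 0 ∧ v ≠ 0) → pairSum p 2 ((p - 1) / 2) u v
      ∈ insert 0 ({a, b} : Finset ℤ) := by
    intro u v huv
    simp only [Finset.mem_insert, Finset.mem_singleton]
    have huv : u = 0 ∨ v = 0 := by tauto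
    rcases huv with rfl | rfl
    · rw [pairSum_two_half_zero_left hp4]
      rcases eta_trichotomy v with h1 | h1 | h1 <;> rw [h1] <;> lia
    · rw [pairSum_two_half_zero_right]
      rcases eta_trichotomy u with h1 | h1 | h1 <;> rw [h1] <;> lia
  -- the pairs of non-zero values are indexed by pairs of units
  have hunits : ∀ {M : Type} [AddCommMonoid M] (F : ZMod p × ZMod p → M),
      ∑ q ∈ Finset.univ.filter (fun q : ZMod p × ZMod p => q.1 ≠ 0 ∧ q.2 ≠ 0), F q
        = ∑ u : (ZMod p)ˣ, ∑ v : (ZMod p)ˣ, F (u, v) := by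
    intro M _ F
    rw [← Fintype.sum_prod_type (f := fun w : (ZMod p)ˣ × (ZMod p)ˣ =>
      F ((w.1 : ZMod p), (w.2 : ZMod p)))]
    symm
    refine Finset.sum_bij (fun w _ => ((w.1 : ZMod p), (w.2 : ZMod p))) ?_ ?_ ?_ ?_
    · intro w _; simp
    · intro w _ w' _ h
      rw [Prod.mk.injEq] at h
      exact Prod.ext (Units.ext h.1) (Units.ext h.2)
    · intro q hq
      have hq := (Finset.mem_filter.1 hq).2
      exact ⟨(Units.mk0 q.1 hq.1, Units.mk0 q.2 hq.2), Finset.mem_univ _, rfl⟩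
    · intro w _; rfl
  have h := hasWeightDistribution_code hp4 hK hodd hst hf hg {a, b} h0
    (fun u v => u ≠ 0 ∧ v ≠ 0) hV
  rw [Finset.sum_pair hab, Finset.sum_pair hab, pairCount_congr (hE 1 (Or.inl rfl)),
    pairCount_congr (hE (-1) (Or.inr rfl))] at h
  have ea : (εf * εg : ℤ) * dev p m s t * a = (p - 1) * (εf * εg : ℤ) * dev p m s t := by
    rw [ha]; push_cast; ring
  have eb : (εf * εg : ℤ) * dev p m s t * b = -((p - 1) * (εf * εg : ℤ) * dev p m s t) := by
    rw [hb]; push_cast; ring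
  have e1 := hunits fun q => (dualCount p m s f fd q.1 * dualCount p m t g gd q.2 : ℝ)
  have e2 := hunits fun q => Finsupp.single (pairWeight p m s t (εf * εg) 2 ((p - 1) / 2) q)
    (dualCount p m s f fd q.1 * dualCount p m t g gd q.2 : ℝ)
  have e3 : ∀ u v : (ZMod p)ˣ, pairWeight p m s t (εf * εg) 2 ((p - 1) / 2) (u, v)
      = mainWeight p m - (εf * εg : ℤ) * dev p m s t * (eta p u *
          (companionSum p 4 ((v : ZMod p) / u) - eta p ((v : ZMod p) / u)) : ℤ) := by
    intro u v
    rw [pairWeight, pairSum_two_half_of_mod_eight_eq_five hp4 h8 u.ne_zero]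
  simp only [e3] at e2
  rw [ea, eb, sub_neg_eq_add] at h
  convert h using 1
  rw [table4, zpow_two_mul_natCast, ← e1, ← e2]
  simp only [← add_assoc, ← sub_sub]
  congr!

end Tables

end PlateauedCode

open PlateauedCode in
theorem mainTheorem1 {p m s t : ℕ} [Fact p.Prime] (hp : p % 4 = 1) (hm : 2 ≤ m)
    {K : Type*} [Field K] [Fintype K] [Algebra (ZMod p) K] (hK : Fintype.card K = p ^ m)
    (f g : K → ZMod p)
    (hfg : (IsWRP p m s f ∧ IsWRP p m t g) ∨ (IsWRPB p m s f ∧ IsWRPB p m t g))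
    (hodd : Odd (s + t)) (hst : s + t + 2 ≤ 2 * m) :
    (∃ εf fd, IsSignDual p m s f εf fd) ∧ (∃ εg gd, IsSignDual p m t g εg gd) ∧
    ∀ (εf εg : ℤ) (fd gd : K → ZMod p),
      IsSignDual p m s f εf fd → IsSignDual p m t g εg gd →
      IsIndex p m t g gd ((p - 1) / 2) →
      -- closed forms of the numbers that occur in the tables
      (∀ c, (dualCount p m s f fd c : ℝ) = dualCountFormula p ((m : ℤ) - s) εf c) ∧
      (∀ c, (dualCount p m t g gd c : ℝ) = dualCountFormula p ((m : ℤ) - t) εg c) ∧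
      (∀ i ∈ squares p,
        pairCount p m s t f g fd gd (predE12 p (squares p))
          = (p - 1) * (dualCount p m s f fd i * dualCount p m t g gd i)) ∧
      (∀ j ∈ nonSquares p,
        pairCount p m s t f g fd gd (predE12 p (nonSquares p))
          = (p - 1) * (dualCount p m s f fd j * dualCount p m t g gd j)) ∧
      (∀ i ∈ squares p,
        pairCount p m s t f g fd gd (predE34 p (squares p))
          = (p - 1) / 2 * (dualCount p m s f fd 0 * dualCount p m t g gd i
              + dualCount p m s f fd i * dualCount p m t g gd 0)) ∧
      (∀ j ∈ nonSquares p,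
        pairCount p m s t f g fd gd (predE34 p (nonSquares p))
          = (p - 1) / 2 * (dualCount p m s f fd 0 * dualCount p m t g gd j
              + dualCount p m s f fd j * dualCount p m t g gd 0)) ∧
      (Odd ((m : ℤ) - s) →
        (pairCount p m s t f g fd gd (predB p (squares p)) : ℝ)
            = bFormula p ((m : ℤ) - s) ((m : ℤ) - t) εf εg 1 ∧
        (pairCount p m s t f g fd gd (predB p (nonSquares p)) : ℝ)
            = bFormula p ((m : ℤ) - s) ((m : ℤ) - t) εf εg (-1)) ∧
      (Even ((m : ℤ) - s) →
        (pairCount p m s t f g fd gd (predB p (squares p)) : ℝ)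
            = bFormula p ((m : ℤ) - t) ((m : ℤ) - s) εg εf 1 ∧
        (pairCount p m s t f g fd gd (predB p (nonSquares p)) : ℝ)
            = bFormula p ((m : ℤ) - t) ((m : ℤ) - s) εg εf (-1)) ∧
      -- index `(p - 1) / 2`
      (IsIndex p m s f fd ((p - 1) / 2) →
        HasParameters (code p (definingSet p f g)) (p ^ (2 * m - 1) - 1) (2 * m) ∧
        IsWeightCode (code p (definingSet p f g)) 3 ∧
        HasWeightDistribution (code p (definingSet p f g)) (table1 p m s t)) ∧
      -- index `p - 1`
      (IsIndex p m s f fd (p - 1) →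
        HasParameters (code p (definingSet p f g)) (p ^ (2 * m - 1) - 1) (2 * m) ∧
        (s + 2 ≤ m → t + 2 ≤ m → IsWeightCode (code p (definingSet p f g)) 5) ∧
        HasWeightDistribution (code p (definingSet p f g))
          (table2 p m s t (εf * εg)
            (pairCount p m s t f g fd gd (predE12 p (squares p)))
            (pairCount p m s t f g fd gd (predE12 p (nonSquares p)))
            (pairCount p m s t f g fd gd (predB p (squares p)))
            (pairCount p m s t f g fd gd (predB p (nonSquares p))))) ∧
      -- index `2`, `p ≡ 1 mod 8`
      (IsIndex p m s f fd 2 → p % 8 = 1 →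
        HasParameters (code p (definingSet p f g)) (p ^ (2 * m - 1) - 1) (2 * m) ∧
        (s + 2 ≤ m → t + 2 ≤ m → IsWeightCode (code p (definingSet p f g)) 5) ∧
        ∀ i ∈ squares p, ∀ j ∈ nonSquares p,
          HasWeightDistribution (code p (definingSet p f g))
            (table3 p m s t (εf * εg)
              (pairCount p m s t f g fd gd (predE34 p (squares p)))
              (pairCount p m s t f g fd gd (predE34 p (nonSquares p)))
              (dualCount p m s f fd i * dualCount p m t g gd i)
              (dualCount p m s f fd j * dualCount p m t g gd j))) ∧
      -- index `2`, `p ≡ 5 mod 8`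
      (IsIndex p m s f fd 2 → p % 8 = 5 →
        HasParameters (code p (definingSet p f g)) (p ^ (2 * m - 1) - 1) (2 * m) ∧
        HasWeightDistribution (code p (definingSet p f g))
          (table4 p m s t (εf * εg)
            (pairCount p m s t f g fd gd (predE34 p (squares p)))
            (pairCount p m s t f g fd gd (predE34 p (nonSquares p)))
            (fun c => dualCount p m s f fd c) (fun c => dualCount p m t g gd c))) := by
  have hf : IsWeaklyRegularPlateaued p m s f := hfg.elim (·.1.1) (·.1.1)
  have hg : IsWeaklyRegularPlateaued p m t g := hfg.elim (·.2.1) (·.2.1)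
  have hfh : IsHomogeneous p f := hfg.elim (·.1.2.2) (·.1.2.2)
  have hgh : IsHomogeneous p g := hfg.elim (·.2.2.2) (·.2.2.2)
  refine ⟨exists_isSignDual hp hf, exists_isSignDual hp hg, ?_⟩
  intro εf εg fd gd hdf hdg hlg
  have hG := HasDual.of_homogeneous hg hgh hdg hlg
  -- `predB` is symmetric, which reduces the case of even `m - s` to that of odd `m - s`
  have hswap : ∀ R : Set (ZMod p), (∀ c, -c ∈ R ↔ c ∈ R) → ∀ u v : ZMod p,
      predB p R u v ↔ predB p R v u := by
    intro R hR u v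
    rw [predB, predB, add_comm, ← hR (u - v), neg_sub]
  have hnegR : ∀ σ : ℤ, ∀ c : ZMod p, -c ∈ {c | eta p c = σ} ↔ c ∈ {c | eta p c = σ} := by
    intro σ c
    rw [Set.mem_ofPred_eq, Set.mem_ofPred_eq, eta_neg hp]
  refine ⟨dualCount_eq_formula hp hK hf.1 hfh.1 hdf, dualCount_eq_formula hp hK hg.1 hgh.1 hdg,
    ?_, ?_, ?_, ?_, ?_, ?_, ?_, ?_, ?_, ?_⟩
  · rw [squares_eq]
    exact fun i hi => pairCount_predE12 hp hK hf.1 hfh.1 hdf hg.1 hgh.1 hdg (Or.inl rfl) hi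
  · rw [nonSquares_eq]
    exact fun j hj => pairCount_predE12 hp hK hf.1 hfh.1 hdf hg.1 hgh.1 hdg (Or.inr rfl) hj
  · rw [squares_eq]
    exact fun i hi => pairCount_predE34 hp hK hf.1 hfh.1 hdf hg.1 hgh.1 hdg (Or.inl rfl) hi
  · rw [nonSquares_eq]
    exact fun j hj => pairCount_predE34 hp hK hf.1 hfh.1 hdf hg.1 hgh.1 hdg (Or.inr rfl) hj
  · intro ho
    rw [squares_eq, nonSquares_eq]
    exact ⟨pairCount_predB hp hK hf.1 hfh.1 hdf hg.1 hgh.1 hdg ho hodd (Or.inl rfl),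
      pairCount_predB hp hK hf.1 hfh.1 hdf hg.1 hgh.1 hdg ho hodd (Or.inr rfl)⟩
  · intro he
    have ho : Odd ((m : ℤ) - t) := by
      rcases he with ⟨a, ha⟩
      rcases hodd with ⟨b, hb⟩
      exact ⟨a + s - b - 1, by lia⟩
    have hodd' : Odd (t + s) := by rwa [add_comm]
    rw [squares_eq, nonSquares_eq, pairCount_swap (hswap _ (hnegR 1)),
      pairCount_swap (hswap _ (hnegR (-1)))]
    exact ⟨pairCount_predB hp hK hg.1 hgh.1 hdg hf.1 hfh.1 hdf ho hodd' (Or.inl rfl),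
      pairCount_predB hp hK hg.1 hgh.1 hdg hf.1 hfh.1 hdf ho hodd' (Or.inr rfl)⟩
  · intro hlf
    have hF := HasDual.of_homogeneous hf hfh hdf hlf
    exact ⟨hasParameters_code hp hm hK hodd hst hF hG, table1_correct hp hK hodd hst hF hG⟩
  · intro hlf
    have hF := HasDual.of_homogeneous hf hfh hdf hlf
    exact ⟨hasParameters_code hp hm hK hodd hst hF hG, table2_correct hp hK hodd hst hF hG⟩
  · intro hlf h8
    have hF := HasDual.of_homogeneous hf hfh hdf hlf
    exact ⟨hasParameters_code hp hm hK hodd hst hF hG, table3_correct hp h8 hK hodd hst hF hG⟩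
  · intro hlf h8
    have hF := HasDual.of_homogeneous hf hfh hdf hlf
    exact ⟨hasParameters_code hp hm hK hodd hst hF hG, table4_correct hp h8 hK hodd hst hF hG⟩
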